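/- Let $\{Z_t\}_{t\in\mathbb Z}$ be a strictly stationary real-valued process such that, for every order $k\ge 1$, $$\sum_{\ell_1,\dots,\ell_{k-1}\in\mathbb Z}\Bigl(1+\sum_{j=1}^{k-1}|\ell_j|\Bigr)\sup_{(u_1,\dots,u_k)\in\mathbb R^k}\bigl|\mathrm{Cum}\bigl(e^{iu_1Z_{\ell_1}},\dots,e^{iu_{k-1}Z_{\ell_{k-1}}},e^{iu_kZ_0}\bigr)\bigr|<\infty,$$ where $\mathrm{Cum}$ denotes the joint cumulant, and let $$f(\lambda;u,v)=\frac1{2\pi}\sum_{\ell\in\mathbb Z}\bigl(\mathrm E\,e^{iuZ_\ell+ivZ_0}-\mathrm E\,e^{iuZ_\ell}\,\mathrm E\,e^{ivZ_0}\bigr)e^{-i\ell\lambda}$$ be its generalized spectrum. Let $L>0$, let $\Theta\subset\mathbb R^d$ be compact, and let $\{f_\theta(\lambda;u,v):\theta\in\Theta\}$ be a family of complex-valued functions that is identifiable: if $\theta,\theta'\in\Theta$ and $f_\theta(\lambda;u,v)=f_{\theta'}(\lambda;u,v)$ for all $\lambda\in[0,2\pi]$ and $(u,v)\in[-L,L]^2$,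 then $\theta=\theta'$. Let $\mathcal S\subset[-L,L]^2$ be a closed set whose neighbourhoods $\mathcal S_\varepsilon=\{(u,v)\in[-L,L]^2:\mathrm{dist}((u,v),\mathcal S)\le\varepsilon\}$ (with $\mathcal S_\varepsilon=\emptyset$ if $\mathcal S=\emptyset$) have Lebesgue measure $O(\varepsilon)$ as $\varepsilon\downarrow0$. Assume that there are $\alpha,\beta,\gamma\in(0,1]$, $\tau\ge0$ and $C>0$ such that $|f_\theta(\lambda;u,v)|\le C$ for all $\theta\in\Theta$, $\lambda\in[0,2\pi]$ and $(u,v)\in[-L,L]^2$, and such that, for every $\varepsilon>0$, $$|f_\theta(\lambda;u,v)-f_{\theta'}(\lambda';u',v')|\le C\varepsilon^{-\tau}\bigl(|\lambda-\lambda'|^\alpha+\|(u,v)-(u',v')\|^\beta+\|\theta-\theta'\|^\gamma\bigr)$$ for all $\lambda,\lambda'\in[0,2\pi]$, all $(u,v),(u',v')\in[-L,L]^2\setminus\mathcal S_\varepsilon$ and all $\theta,\theta'\in\Theta$ (all norms and distances are Euclidean). Assume also that there are $\tilde\alpha,\tilde\beta>0$, $\tilde\tau\ge0$ and $\tilde C>0$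 such that, for every $\varepsilon>0$, $$|f(\lambda;u,v)-f(\lambda';u',v')|\le\tilde C\varepsilon^{-\tilde\tau}\bigl(|\lambda-\lambda'|^{\tilde\alpha}+\|(u,v)-(u',v')\|^{\tilde\beta}\bigr)$$ for all $\lambda,\lambda'\in[0,2\pi)$ and $(u,v),(u',v')\in[-L,L]^2\setminus\mathcal S_\varepsilon$. Put $D(f,f_\theta)=\int_0^{2\pi}\int_{-L}^L\int_{-L}^L|f(\lambda;u,v)-f_\theta(\lambda;u,v)|^2\,du\,dv\,d\lambda$ and assume that $\theta\mapsto D(f,f_\theta)$ has a unique minimizer $\theta_0$ over $\Theta$. Let $M_n$ be non-negative integers with $M_n\to\infty$ as $n\to\infty$, and put $\lambda_j=2\pi j/n$, $u_i=v_i=-L+2Li/M_n$, $$I_n(\lambda;u,v)=\frac1{2\pi n}d_n(\lambda;u)\,d_n(-\lambda;v),\qquad d_n(\lambda;u)=\sum_{t=1}^n e^{iuZ_t}e^{-it\lambda},$$ $$D_n(I_n,f_\theta)=\frac{8\pi L^2}{nM_n^2}\sum_{j=1}^{n-1}\sum_{i_1,i_2=1}^{M_n}\bigl|I_n(\lambda_j;u_{i_1},v_{i_2})-f_\theta(\lambda_j;u_{i_1},v_{i_2})\bigr|^2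 .$$ If, for each $n$, $\hat\theta_n$ is almost surely a minimizer of $\theta\mapsto D_n(I_n,f_\theta)$ over $\Theta$, then $\hat\theta_n\to\theta_0$ in probability as $n\to\infty$. -/

import Mathlib

open MeasureTheory Filter Topology Set
open scoped ENNReal

noncomputable section

namespace GenSpectrum

variable {Ω : Type*} [MeasurableSpace Ω]

/-- Strict stationarity of a real process indexed by `ℤ`: all finite-dimensional laws are
invariant under time shifts. -/
def StrictlyStationary (μ : Measure Ω) (Z : ℤ → Ω → ℝ) : Prop :=
  ∀ (m : ℕ) (t : Fin m → ℤ) (h : ℤ),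
    μ.map (fun ω (i : Fin m) => Z (t i + h) ω) = μ.map (fun ω (i : Fin m) => Z (t i) ω)

/-- The joint cumulant `Cum(X₁, …, X_k)` of complex random variables: the sum over all partitions
of the index set of `(-1)^(p-1) (p-1)! ∏_B E ∏_{j ∈ B} X_j`, with `p` the number of blocks. -/
def cumulant (μ : Measure Ω) {k : ℕ} (X : Fin k → Ω → ℂ) : ℂ :=
  ∑ P : Finpartition (Finset.univ : Finset (Fin k)),
    (-1 : ℂ) ^ (P.parts.card - 1) * ((P.parts.card - 1).factorial : ℂ) *
      ∏ B ∈ P.parts, ∫ ω, ∏ j ∈ B, X j ω ∂μ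

/-- `Cum(e^{i u₁ Z_{ℓ₁}}, …, e^{i u_m Z_{ℓ_m}}, e^{i u_{m+1} Z_0})`. -/
def expCumulant (μ : Measure Ω) (Z : ℤ → Ω → ℝ) {m : ℕ} (l : Fin m → ℤ) (u : Fin (m + 1) → ℝ) :
    ℂ :=
  cumulant μ fun (j : Fin (m + 1)) ω =>
    Complex.exp (Complex.I * (u j : ℂ) * (Z (Fin.snoc (α := fun _ => ℤ) l 0 j) ω : ℂ))

/-- Weighted summability, for every order `k = m + 1`, of the cumulants of `e^{iuZ_t}`:
`∑_{ℓ₁,…,ℓ_{k-1}} (1 + ∑_j |ℓ_j|^q) sup_u |Cum(e^{iu₁Z_{ℓ₁}}, …, e^{iu_kZ_0})| < ∞`. -/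
def CumulantSummable (μ : Measure Ω) (Z : ℤ → Ω → ℝ) (q : ℕ) : Prop :=
  ∀ m : ℕ,
    (∑' l : Fin m → ℤ, ENNReal.ofReal (1 + ∑ j, |(l j : ℝ)| ^ q) *
      (⨆ u : Fin (m + 1) → ℝ, ENNReal.ofReal ‖expCumulant μ Z l u‖)) < ∞

/-- `Cov(e^{iuZ_ℓ}, e^{-ivZ_0}) = E e^{iuZ_ℓ + ivZ_0} - E e^{iuZ_ℓ} E e^{ivZ_0}`. -/
def expCov (μ : Measure Ω) (Z : ℤ → Ω → ℝ) (l : ℤ) (u v : ℝ) : ℂ :=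
  (∫ ω, Complex.exp (Complex.I * (u : ℂ) * (Z l ω : ℂ) + Complex.I * (v : ℂ) * (Z 0 ω : ℂ)) ∂μ) -
    (∫ ω, Complex.exp (Complex.I * (u : ℂ) * (Z l ω : ℂ)) ∂μ) *
      (∫ ω, Complex.exp (Complex.I * (v : ℂ) * (Z 0 ω : ℂ)) ∂μ)

/-- The generalized spectrum of order two,
`f(λ; u, v) = (2π)⁻¹ ∑_{ℓ ∈ ℤ} Cov(e^{iuZ_ℓ}, e^{-ivZ_0}) e^{-iℓλ}`. -/
def spectrum2 (μ : Measure Ω) (Z : ℤ → Ω → ℝ) (lam u v : ℝ) : ℂ :=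
  (1 / (2 * (Real.pi : ℂ))) *
    ∑' l : ℤ, expCov μ Z l u v * Complex.exp (-(Complex.I * (l : ℂ) * (lam : ℂ)))

/-- `d_n(λ; u) = ∑_{t=1}^n e^{iuZ_t} e^{-itλ}`. -/
def dft (Z : ℤ → Ω → ℝ) (n : ℕ) (lam u : ℝ) (ω : Ω) : ℂ :=
  ∑ t ∈ Finset.Icc 1 n, Complex.exp (Complex.I * (u : ℂ) * (Z (t : ℤ) ω : ℂ)) *
    Complex.exp (-(Complex.I * (t : ℂ) * (lam : ℂ)))

/-- The generalized periodogram `I_n(λ; u, v) = (2πn)⁻¹ d_n(λ; u) d_n(-λ; v)`. -/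
def periodogram (Z : ℤ → Ω → ℝ) (n : ℕ) (lam u v : ℝ) (ω : Ω) : ℂ :=
  (1 / (2 * (Real.pi : ℂ) * (n : ℂ))) * dft Z n lam u ω * dft Z n (-lam) v ω

/-- The `L²` divergence `∫₀^{2π} ∫_{-L}^L ∫_{-L}^L |f - g|² du dv dλ`. -/
def divergence (L : ℝ) (f g : ℝ → ℝ → ℝ → ℂ) : ℝ :=
  ∫ p in Icc (0 : ℝ) (2 * Real.pi) ×ˢ Icc (-L) L ×ˢ Icc (-L) L,
    ‖f p.1 p.2.1 p.2.2 - g p.1 p.2.1 p.2.2‖ ^ 2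

/-- The grid points `-L + 2Li/M`. -/
def gridPoint (L : ℝ) (M i : ℕ) : ℝ := -L + 2 * L * i / M

/-- The Riemann sum
`8πL²/(nM²) ∑_{j=1}^{n-1} ∑_{i₁,i₂=1}^{M} |f(λ_j; u_{i₁}, v_{i₂}) - g(λ_j; u_{i₁}, v_{i₂})|²`,
`λ_j = 2πj/n`, that approximates the `L²` divergence. -/
def discreteDivergence (L : ℝ) (n M : ℕ) (f g : ℝ → ℝ → ℝ → ℂ) : ℝ :=
  8 * Real.pi * L ^ 2 / (n * (M : ℝ) ^ 2) *
    ∑ j ∈ Finset.Icc 1 (n - 1), ∑ i₁ ∈ Finset.Icc 1 M, ∑ i₂ ∈ Finset.Icc 1 M,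
      ‖f (2 * Real.pi * j / n) (gridPoint L M i₁) (gridPoint L M i₂) -
        g (2 * Real.pi * j / n) (gridPoint L M i₁) (gridPoint L M i₂)‖ ^ 2

/-- The square `[-L, L]²` in the Euclidean plane. -/
def square (L : ℝ) : Set (EuclideanSpace ℝ (Fin 2)) :=
  {p | p 0 ∈ Icc (-L) L ∧ p 1 ∈ Icc (-L) L}

/-- The closed `ε`-neighbourhood `S_ε` of `S` within `[-L, L]²` (empty when `S` is empty). -/
def nbhd (L : ℝ) (S : Set (EuclideanSpace ℝ (Fin 2))) (ε : ℝ) : Set (EuclideanSpace ℝ (Fin 2)) :=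
  square L ∩ Metric.cthickening ε S

/-- Admissible singular sets: closed subsets `S` of `[-L, L]²` with `Leb(S_ε) = O(ε)`
as `ε ↓ 0`. -/
structure IsSingularSet (L : ℝ) (S : Set (EuclideanSpace ℝ (Fin 2))) : Prop where
  subset_square : S ⊆ square L
  isClosed : IsClosed S
  volume_isBigO : (fun ε : ℝ => (volume (nbhd L S ε)).toReal) =O[𝓝[>] 0] fun ε : ℝ => ε

/-- Identifiability of the family `F` on `[0, 2π] × [-L, L]²`. -/
def Identifiable {d : ℕ} (L : ℝ) (Θ : Set (EuclideanSpace ℝ (Fin d)))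
    (F : EuclideanSpace ℝ (Fin d) → ℝ → ℝ → ℝ → ℂ) : Prop :=
  ∀ θ ∈ Θ, ∀ θ' ∈ Θ,
    (∀ lam ∈ Icc 0 (2 * Real.pi), ∀ u ∈ Icc (-L) L, ∀ v ∈ Icc (-L) L,
      F θ lam u v = F θ' lam u v) → θ = θ'

/-- `UBPH(S, τ, α, β, γ)`: the family `F` is uniformly bounded, and partially Hölder continuous
except for `S`. -/
def UBPH {d : ℕ} (L : ℝ) (Θ : Set (EuclideanSpace ℝ (Fin d)))
    (F : EuclideanSpace ℝ (Fin d) → ℝ → ℝ → ℝ → ℂ) (S : Set (EuclideanSpace ℝ (Fin 2)))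
    (τ α β γ : ℝ) : Prop :=
  ∃ C : ℝ, 0 < C ∧
    (∀ θ ∈ Θ, ∀ lam ∈ Icc 0 (2 * Real.pi), ∀ p ∈ square L, ‖F θ lam (p 0) (p 1)‖ ≤ C) ∧
    ∀ ε : ℝ, 0 < ε →
      ∀ lam ∈ Icc 0 (2 * Real.pi), ∀ lam' ∈ Icc 0 (2 * Real.pi),
      ∀ p ∈ square L \ nbhd L S ε, ∀ p' ∈ square L \ nbhd L S ε,
      ∀ θ ∈ Θ, ∀ θ' ∈ Θ,
        ‖F θ lam (p 0) (p 1) - F θ' lam' (p' 0) (p' 1)‖ ≤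
          C * ε ^ (-τ) * (|lam - lam'| ^ α + ‖p - p'‖ ^ β + ‖θ - θ'‖ ^ γ)

/-- `PH(S, τ, α, β)`: a single function `f(λ; u, v)` is partially Hölder continuous
except for `S`. -/
def PH (L : ℝ) (f : ℝ → ℝ → ℝ → ℂ) (S : Set (EuclideanSpace ℝ (Fin 2))) (τ α β : ℝ) : Prop :=
  ∃ C : ℝ, 0 < C ∧
    ∀ ε : ℝ, 0 < ε →
      ∀ lam ∈ Ico 0 (2 * Real.pi), ∀ lam' ∈ Ico 0 (2 * Real.pi),
      ∀ p ∈ square L \ nbhd L S ε, ∀ p' ∈ square L \ nbhd L S ε,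
        ‖f lam (p 0) (p 1) - f lam' (p' 0) (p' 1)‖ ≤
          C * ε ^ (-τ) * (|lam - lam'| ^ α + ‖p - p'‖ ^ β)

end GenSpectrum

end

/-! The periodogram `I_n` does not converge to `f` pointwise, so `D_n(I_n, f_θ)` need not approach
`D(f, f_θ)`. Consistency survives because the discrepancy is asymptotically free of `θ`. By the
identity `norm_sub_sq_eq_add`, `|I_n - f_θ|²` equals `|f - f_k|²`, plus `|I_n|² - |f|²`, minus twice
the real part of `(I_n - f)` times the conjugate of `f_k`, plus an error controlled by `|f_θ -
f_k|`, where `k` runs through a finite net of `Θ`. The second term does not involve `θ` and drops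
out when two parameters are compared. The first is a deterministic Riemann sum converging to `D(f,
f_k)` (`tendsto_riemann_sum`).

The cross term tends to zero in `L¹` because it averages `I_n - f` over frequencies. Approximating
the weight by trigonometric sums reduces it to weights `e^{ihλ}`. For these the sum over Fourier
frequencies collapses, by orthogonality, to the empirical lag-`h` covariance minus the true one, up
to wrap-around and aliasing (`norm_weighted_periodogram_sub_le`). A law of large numbers finishes
the argument: the variances involve joint moments of order four, which expand into cumulants of
orders two to four, and these decay with the lag. Since the cumulant bounds are suprema over all
frequencies `u`, every rate is uniform in `(u, v)`, and hence nothing links the growth of `M_n` to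
that of `n`.

The net error is handled in mean. The family is Hölder in `θ` off `S_ε` and bounded on `S_ε`, which
contains a small fraction of the grid (`UBPH.exists_majorant`), while `E|I_n|` is bounded at all
non-zero Fourier frequencies (`integral_norm_periodogram_le`).

Thus, up to a random constant, the criterion is uniformly close to `D(f, f_θ)` at the net points
with high probability. This limit is continuous on the compact `Θ`, so its unique minimum is well
separated, and any minimizer of the criterion must lie near `θ₀`. -/

namespace GenSpectrum

/-! ### Enumeration of small partitions -/

/-- A sum over the partitions of `Fin k`, along a list of all of them. -/
theorem sum_finpartition_eq_list_sum {k : ℕ} (L : List (List (Finset (Fin k))))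
    (hnodup : ∀ l ∈ L, l.Nodup) (hL : (L.map List.toFinset).Nodup)
    (hpart : ∀ l ∈ L, ∅ ∉ l ∧ ∀ a, ∃ t ∈ l, a ∈ t ∧ ∀ t' ∈ l, a ∈ t' → t' = t)
    (hall : ∀ c : Fin k → Fin k, (∀ i, c i ≤ i) → ∃ l ∈ L, l.toFinset =
      Finset.univ.image fun i => Finset.univ.filter fun j => c j = c i)
    (w : ℕ → ℂ) (m : Finset (Fin k) → ℂ) :
    ∑ P : Finpartition (Finset.univ : Finset (Fin k)), w P.parts.card * ∏ B ∈ P.parts, m B =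
      (L.map fun l => w l.length * (l.map m).prod).sum := by
  classical
  have himg : (Finset.univ : Finset (Finpartition (Finset.univ : Finset (Fin k)))).image
      Finpartition.parts = (L.map List.toFinset).toFinset := by
    ext T
    simp only [Finset.mem_image, Finset.mem_univ, true_and, List.mem_toFinset, List.mem_map]
    constructor
    · rintro ⟨P, rfl⟩
      have hne : ∀ i, (P.part i).Nonempty := fun i => ⟨i, P.mem_part (Finset.mem_univ i)⟩
      -- A partition is encoded by sending each point to the least element of its block. Such a map
      -- satisfies `c i ≤ i`, so exhaustiveness of a list becomes a decidable check over finitely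
      -- many maps.
      let c : Fin k → Fin k := fun i => (P.part i).min' (hne i)
      have hc : ∀ i j, c j = c i ↔ P.part j = P.part i := by
        intro i j
        constructor
        · intro h
          have h1 : c j ∈ P.part j := Finset.min'_mem _ _
          have h2 : c j ∈ P.part i := h ▸ Finset.min'_mem _ _
          exact P.eq_of_mem_parts (P.part_mem.2 (Finset.mem_univ _))
            (P.part_mem.2 (Finset.mem_univ _)) h1 h2
        · intro h
          simp only [c, h]
      obtain ⟨l, hl, hl'⟩ := hall c fun i => Finset.min'_le _ _ (P.mem_part (Finset.mem_univ i))
      refine ⟨l, hl, hl'.trans ?_⟩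
      have hpart' : ∀ i, (Finset.univ.filter fun j => c j = c i) = P.part i := by
        intro i
        ext j
        simp only [Finset.mem_filter, Finset.mem_univ, true_and, hc]
        constructor
        · intro h
          exact h ▸ P.mem_part (Finset.mem_univ j)
        · intro h
          exact P.eq_of_mem_parts (P.part_mem.2 (Finset.mem_univ _))
            (P.part_mem.2 (Finset.mem_univ _)) (P.mem_part (Finset.mem_univ j)) h
      ext B
      simp only [Finset.mem_image, Finset.mem_univ, true_and, hpart']
      constructor
      · rintro ⟨i, rfl⟩
        exact P.part_mem.2 (Finset.mem_univ i)
      · intro hB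
        obtain ⟨x, -, hx⟩ := P.part_surjOn hB
        exact ⟨x, hx⟩
    · rintro ⟨l, hl, rfl⟩
      obtain ⟨h1, h2⟩ := hpart l hl
      refine ⟨Finpartition.ofExistsUnique l.toFinset (fun _ _ => Finset.subset_univ _) ?_ ?_, rfl⟩
      · intro a _
        obtain ⟨t, ht, hat, hu⟩ := h2 a
        exact ⟨t, ⟨by simpa using ht, hat⟩, fun t' ht' => hu t' (by simpa using ht'.1) ht'.2⟩
      · simpa using h1
  have hinj : ∀ P ∈ (Finset.univ : Finset (Finpartition (Finset.univ : Finset (Fin k)))),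
      ∀ Q ∈ (Finset.univ : Finset (Finpartition (Finset.univ : Finset (Fin k)))),
      P.parts = Q.parts → P = Q := fun P _ Q _ h => Finpartition.ext h
  rw [← Finset.sum_image (f := fun T : Finset (Finset (Fin k)) => w T.card * ∏ B ∈ T, m B) hinj,
    himg, List.sum_toFinset _ hL, List.map_map]
  congr 1
  refine List.map_congr_left fun l hl => ?_
  simp only [Function.comp]
  rw [List.toFinset_card_of_nodup (hnodup l hl), List.prod_toFinset _ (hnodup l hl)]

theorem sum_finpartition_two (w : ℕ → ℂ) (m : Finset (Fin 2) → ℂ) :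
    ∑ P : Finpartition (Finset.univ : Finset (Fin 2)), w P.parts.card * ∏ B ∈ P.parts, m B =
      w 1 * m {0, 1} + w 2 * (m {0} * m {1}) := by
  rw [sum_finpartition_eq_list_sum [[{0, 1}], [{0}, {1}]]
    (by decide) (by decide) (by decide) (by decide)]
  simp

theorem sum_finpartition_three (w : ℕ → ℂ) (m : Finset (Fin 3) → ℂ) :
    ∑ P : Finpartition (Finset.univ : Finset (Fin 3)), w P.parts.card * ∏ B ∈ P.parts, m B =
      w 1 * m {0, 1, 2} + w 2 * (m {0} * m {1, 2} + m {1} * m {0, 2} + m {2} * m {0, 1}) +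
        w 3 * (m {0} * m {1} * m {2}) := by
  rw [sum_finpartition_eq_list_sum [[{0, 1, 2}], [{0}, {1, 2}], [{1}, {0, 2}], [{2}, {0, 1}],
    [{0}, {1}, {2}]] (by decide) (by decide) (by decide) (by decide)]
  simp
  ring

set_option maxRecDepth 100000 in
theorem sum_finpartition_four (w : ℕ → ℂ) (m : Finset (Fin 4) → ℂ) :
    ∑ P : Finpartition (Finset.univ : Finset (Fin 4)), w P.parts.card * ∏ B ∈ P.parts, m B =
      w 1 * m {0, 1, 2, 3} +
      w 2 * (m {0} * m {1, 2, 3} + m {1} * m {0, 2, 3} + m {2} * m {0, 1, 3} + m {3} * m {0, 1, 2}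
        + m {0, 1} * m {2, 3} + m {0, 2} * m {1, 3} + m {0, 3} * m {1, 2}) +
      w 3 * (m {0} * m {1} * m {2, 3} + m {0} * m {2} * m {1, 3} + m {0} * m {3} * m {1, 2}
        + m {1} * m {2} * m {0, 3} + m {1} * m {3} * m {0, 2} + m {2} * m {3} * m {0, 1}) +
      w 4 * (m {0} * m {1} * m {2} * m {3}) := by
  rw [sum_finpartition_eq_list_sum [[{0, 1, 2, 3}], [{0}, {1, 2, 3}], [{1}, {0, 2, 3}],
    [{2}, {0, 1, 3}], [{3}, {0, 1, 2}], [{0, 1}, {2, 3}], [{0, 2}, {1, 3}], [{0, 3}, {1, 2}],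
    [{0}, {1}, {2, 3}], [{0}, {2}, {1, 3}], [{0}, {3}, {1, 2}], [{1}, {2}, {0, 3}],
    [{1}, {3}, {0, 2}], [{2}, {3}, {0, 1}], [{0}, {1}, {2}, {3}]]
    (by decide +kernel) (by decide +kernel) (by decide +kernel) (by decide +kernel)]
  simp
  ring

end GenSpectrum

namespace GenSpectrum

variable {Ω : Type*}

/-! ### The process `e^{iuZ_t}` and its cumulants -/

/-- The process `e^{iuZ_t}`. -/
noncomputable def expProc (Z : ℤ → Ω → ℝ) (t : ℤ) (u : ℝ) (ω : Ω) : ℂ :=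
  Complex.exp (Complex.I * (u : ℂ) * (Z t ω : ℂ))

theorem norm_expProc (Z : ℤ → Ω → ℝ) (t : ℤ) (u : ℝ) (ω : Ω) : ‖expProc Z t u ω‖ = 1 := by
  have : Complex.I * (u : ℂ) * (Z t ω : ℂ) = ((u * Z t ω : ℝ) : ℂ) * Complex.I := by
    push_cast; ring
  rw [expProc, this, Complex.norm_exp_ofReal_mul_I]

theorem conj_expProc (Z : ℤ → Ω → ℝ) (t : ℤ) (u : ℝ) (ω : Ω) :
    (starRingEnd ℂ) (expProc Z t u ω) = expProc Z t (-u) ω := by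
  unfold expProc
  rw [← Complex.exp_conj]
  simp

variable [MeasurableSpace Ω]

theorem cumulant_two (μ : Measure Ω) (X : Fin 2 → Ω → ℂ) :
    cumulant μ X = ∫ ω, X 0 ω * X 1 ω ∂μ - (∫ ω, X 0 ω ∂μ) * ∫ ω, X 1 ω ∂μ := by
  unfold cumulant
  rw [sum_finpartition_two (fun p => (-1 : ℂ) ^ (p - 1) * ((p - 1).factorial : ℂ))
    (fun B => ∫ ω, ∏ j ∈ B, X j ω ∂μ)]
  simp [sub_eq_add_neg]

theorem cumulant_three (μ : Measure Ω) (X : Fin 3 → Ω → ℂ) :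
    cumulant μ X = ∫ ω, X 0 ω * X 1 ω * X 2 ω ∂μ - (∫ ω, X 0 ω ∂μ) * ∫ ω, X 1 ω * X 2 ω ∂μ
      - (∫ ω, X 1 ω ∂μ) * ∫ ω, X 0 ω * X 2 ω ∂μ - (∫ ω, X 2 ω ∂μ) * ∫ ω, X 0 ω * X 1 ω ∂μ
      + 2 * ((∫ ω, X 0 ω ∂μ) * (∫ ω, X 1 ω ∂μ) * ∫ ω, X 2 ω ∂μ) := by
  unfold cumulant
  rw [sum_finpartition_three (fun p => (-1 : ℂ) ^ (p - 1) * ((p - 1).factorial : ℂ))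
    (fun B => ∫ ω, ∏ j ∈ B, X j ω ∂μ)]
  simp [mul_assoc]
  ring

theorem cumulant_four (μ : Measure Ω) (X : Fin 4 → Ω → ℂ) :
    cumulant μ X = ∫ ω, X 0 ω * X 1 ω * (X 2 ω * X 3 ω) ∂μ
      - (∫ ω, X 0 ω ∂μ) * ∫ ω, X 1 ω * X 2 ω * X 3 ω ∂μ
      - (∫ ω, X 1 ω ∂μ) * ∫ ω, X 0 ω * X 2 ω * X 3 ω ∂μ
      - (∫ ω, X 2 ω ∂μ) * ∫ ω, X 0 ω * X 1 ω * X 3 ω ∂μ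
      - (∫ ω, X 3 ω ∂μ) * ∫ ω, X 0 ω * X 1 ω * X 2 ω ∂μ
      - (∫ ω, X 0 ω * X 1 ω ∂μ) * ∫ ω, X 2 ω * X 3 ω ∂μ
      - (∫ ω, X 0 ω * X 2 ω ∂μ) * ∫ ω, X 1 ω * X 3 ω ∂μ
      - (∫ ω, X 0 ω * X 3 ω ∂μ) * ∫ ω, X 1 ω * X 2 ω ∂μ
      + 2 * ((∫ ω, X 0 ω ∂μ) * (∫ ω, X 1 ω ∂μ) * ∫ ω, X 2 ω * X 3 ω ∂μ)
      + 2 * ((∫ ω, X 0 ω ∂μ) * (∫ ω, X 2 ω ∂μ) * ∫ ω, X 1 ω * X 3 ω ∂μ)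
      + 2 * ((∫ ω, X 0 ω ∂μ) * (∫ ω, X 3 ω ∂μ) * ∫ ω, X 1 ω * X 2 ω ∂μ)
      + 2 * ((∫ ω, X 1 ω ∂μ) * (∫ ω, X 2 ω ∂μ) * ∫ ω, X 0 ω * X 3 ω ∂μ)
      + 2 * ((∫ ω, X 1 ω ∂μ) * (∫ ω, X 3 ω ∂μ) * ∫ ω, X 0 ω * X 2 ω ∂μ)
      + 2 * ((∫ ω, X 2 ω ∂μ) * (∫ ω, X 3 ω ∂μ) * ∫ ω, X 0 ω * X 1 ω ∂μ)
      - 6 * ((∫ ω, X 0 ω ∂μ) * (∫ ω, X 1 ω ∂μ) * (∫ ω, X 2 ω ∂μ) * ∫ ω, X 3 ω ∂μ) := by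
  unfold cumulant
  rw [sum_finpartition_four (fun p => (-1 : ℂ) ^ (p - 1) * ((p - 1).factorial : ℂ))
    (fun B => ∫ ω, ∏ j ∈ B, X j ω ∂μ)]
  simp [mul_assoc, Nat.factorial]
  ring

/-- The moment-cumulant formula, arranged so that every term involves a cumulant which mixes the
first two variables with the last two. -/
theorem integral_four_sub_eq (μ : Measure Ω) (a b c d : Ω → ℂ) :
    ∫ ω, a ω * b ω * (c ω * d ω) ∂μ - (∫ ω, a ω * b ω ∂μ) * ∫ ω, c ω * d ω ∂μ =
      cumulant μ ![a, b, c, d] + (∫ ω, a ω ∂μ) * cumulant μ ![b, c, d]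
      + (∫ ω, b ω ∂μ) * cumulant μ ![a, c, d] + (∫ ω, c ω ∂μ) * cumulant μ ![a, b, d]
      + (∫ ω, d ω ∂μ) * cumulant μ ![a, b, c]
      + cumulant μ ![a, c] * cumulant μ ![b, d] + cumulant μ ![a, d] * cumulant μ ![b, c]
      + (∫ ω, a ω ∂μ) * (∫ ω, c ω ∂μ) * cumulant μ ![b, d]
      + (∫ ω, a ω ∂μ) * (∫ ω, d ω ∂μ) * cumulant μ ![b, c]
      + (∫ ω, b ω ∂μ) * (∫ ω, c ω ∂μ) * cumulant μ ![a, d]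
      + (∫ ω, b ω ∂μ) * (∫ ω, d ω ∂μ) * cumulant μ ![a, c] := by
  simp only [cumulant_four, cumulant_three, cumulant_two]
  simp
  ring

theorem measurable_expProc {Z : ℤ → Ω → ℝ} (hZ : ∀ t, Measurable (Z t)) (t : ℤ) (u : ℝ) :
    Measurable (expProc Z t u) := by
  have := hZ t
  unfold expProc
  fun_prop

/-- A bounded measurable complex function is integrable for a finite measure. -/
theorem integrable_of_norm_le {μ : Measure Ω} [IsFiniteMeasure μ] {g : Ω → ℂ} (hg : Measurable g)
    {C : ℝ} (h : ∀ ω, ‖g ω‖ ≤ C) : Integrable g μ :=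
  Integrable.of_bound hg.aestronglyMeasurable C (ae_of_all _ h)

theorem norm_integral_le_one {μ : Measure Ω} [IsProbabilityMeasure μ] {g : Ω → ℂ}
    (h : ∀ ω, ‖g ω‖ ≤ 1) : ‖∫ ω, g ω ∂μ‖ ≤ 1 := by
  simpa using norm_integral_le_of_norm_le_const (μ := μ) (ae_of_all _ h)

theorem StrictlyStationary.integral_prod_expProc {μ : Measure Ω} {Z : ℤ → Ω → ℝ}
    (hstat : StrictlyStationary μ Z) (hZ : ∀ t, Measurable (Z t)) {k : ℕ} (t : Fin k → ℤ)
    (u : Fin k → ℝ) (h : ℤ) (B : Finset (Fin k)) :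
    ∫ ω, ∏ j ∈ B, expProc Z (t j + h) (u j) ω ∂μ = ∫ ω, ∏ j ∈ B, expProc Z (t j) (u j) ω ∂μ := by
  have hg : Measurable fun z : Fin k → ℝ =>
      ∏ j ∈ B, Complex.exp (Complex.I * (u j : ℂ) * (z j : ℂ)) := by fun_prop
  have h1 := hstat k t h
  have h2 : Measurable fun ω (i : Fin k) => Z (t i + h) ω := measurable_pi_lambda _ fun i => hZ _
  have h3 : Measurable fun ω (i : Fin k) => Z (t i) ω := measurable_pi_lambda _ fun i => hZ _
  have e2 := integral_map (μ := μ) h2.aemeasurable (f := fun z : Fin k → ℝ =>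
      ∏ j ∈ B, Complex.exp (Complex.I * (u j : ℂ) * (z j : ℂ))) hg.aestronglyMeasurable
  have e3 := integral_map (μ := μ) h3.aemeasurable (f := fun z : Fin k → ℝ =>
      ∏ j ∈ B, Complex.exp (Complex.I * (u j : ℂ) * (z j : ℂ))) hg.aestronglyMeasurable
  rw [h1] at e2
  exact e2.symm.trans e3

/-- Every block moment is invariant under a common time shift. Shifting by minus the last time puts
the last variable at time `0`, where the summability hypothesis applies. -/
theorem StrictlyStationary.cumulant_expProc {μ : Measure Ω} {Z : ℤ → Ω → ℝ}
    (hstat : StrictlyStationary μ Z) (hZ : ∀ t, Measurable (Z t)) {m : ℕ} (t : Fin (m + 1) → ℤ)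
    (u : Fin (m + 1) → ℝ) :
    cumulant μ (fun j => expProc Z (t j) (u j)) =
      expCumulant μ Z (fun j => t j.castSucc - t (Fin.last m)) u := by
  have hsnoc : ∀ j, (Fin.snoc (α := fun _ => ℤ) (fun j : Fin m => t j.castSucc - t (Fin.last m)) 0 j
      : ℤ) = t j + -t (Fin.last m) := by
    intro j
    refine Fin.lastCases ?_ (fun i => ?_) j
    · simp
    · simp [sub_eq_add_neg]
  unfold expCumulant cumulant
  refine Finset.sum_congr rfl fun P _ => ?_
  congr 1
  refine Finset.prod_congr rfl fun B _ => ?_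
  rw [← hstat.integral_prod_expProc hZ t u (-t (Fin.last m)) B]
  simp only [hsnoc, expProc]

/-- The supremum over the frequencies of the cumulant of `e^{iu₁Z_{l₁}}, …, e^{iu_{m+1}Z_0}`. -/
noncomputable def cumBound (μ : Measure Ω) (Z : ℤ → Ω → ℝ) {m : ℕ} (l : Fin m → ℤ) : ℝ :=
  (⨆ u : Fin (m + 1) → ℝ, ENNReal.ofReal ‖expCumulant μ Z l u‖).toReal

theorem cumBound_nonneg (μ : Measure Ω) (Z : ℤ → Ω → ℝ) {m : ℕ} (l : Fin m → ℤ) :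
    0 ≤ cumBound μ Z l := ENNReal.toReal_nonneg

theorem CumulantSummable.tsum_iSup_ne_top {μ : Measure Ω} {Z : ℤ → Ω → ℝ} {q : ℕ}
    (h : CumulantSummable μ Z q) (m : ℕ) :
    ∑' l : Fin m → ℤ, ⨆ u : Fin (m + 1) → ℝ, ENNReal.ofReal ‖expCumulant μ Z l u‖ ≠ ∞ := by
  refine ne_top_of_le_ne_top (h m).ne (ENNReal.tsum_le_tsum fun l => ?_)
  -- The weight `1 + ∑ |l j| ^ q` is at least one.
  refine le_mul_of_one_le_left' ?_
  rw [← ENNReal.ofReal_one]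
  refine ENNReal.ofReal_le_ofReal ?_
  have : 0 ≤ ∑ j, |(l j : ℝ)| ^ q := by positivity
  linarith

theorem CumulantSummable.norm_expCumulant_le {μ : Measure Ω} {Z : ℤ → Ω → ℝ} {q : ℕ}
    (h : CumulantSummable μ Z q) {m : ℕ} (l : Fin m → ℤ) (u : Fin (m + 1) → ℝ) :
    ‖expCumulant μ Z l u‖ ≤ cumBound μ Z l := by
  have h1 := ENNReal.ne_top_of_tsum_ne_top (h.tsum_iSup_ne_top m) l
  refine (ENNReal.ofReal_le_iff_le_toReal h1).1 ?_
  exact le_iSup (fun u : Fin (m + 1) → ℝ => ENNReal.ofReal ‖expCumulant μ Z l u‖) u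

theorem CumulantSummable.summable_cumBound {μ : Measure Ω} {Z : ℤ → Ω → ℝ} {q : ℕ}
    (h : CumulantSummable μ Z q) (m : ℕ) : Summable fun l : Fin m → ℤ => cumBound μ Z l :=
  ENNReal.summable_toReal (h.tsum_iSup_ne_top m)

/-- A summable family vanishes along the cofinite filter, hence along any injective one-parameter
family of lag vectors. Decay is all that the law of large numbers needs from the higher-order
cumulants. -/
theorem CumulantSummable.tendsto_cumBound {μ : Measure Ω} {Z : ℤ → Ω → ℝ} {q : ℕ}
    (h : CumulantSummable μ Z q) {m : ℕ} {ι : ℤ → Fin m → ℤ} (hι : Function.Injective ι) :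
    Tendsto (fun k => cumBound μ Z (ι k)) cofinite (𝓝 0) :=
  (h.summable_cumBound m).tendsto_cofinite_zero.comp hι.tendsto_cofinite

theorem norm_cumulant_expProc_le {μ : Measure Ω} {Z : ℤ → Ω → ℝ} {q : ℕ}
    (hstat : StrictlyStationary μ Z) (hZ : ∀ t, Measurable (Z t)) (h : CumulantSummable μ Z q)
    {m : ℕ} (t : Fin (m + 1) → ℤ) (u : Fin (m + 1) → ℝ) :
    ‖cumulant μ (fun j => expProc Z (t j) (u j))‖ ≤
      cumBound μ Z (fun j : Fin m => t j.castSucc - t (Fin.last m)) :=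
  hstat.cumulant_expProc hZ t u ▸ h.norm_expCumulant_le _ u

/-! ### Cumulant bounds at explicit lags and the mixing rate of lagged products -/

section

variable {μ : Measure Ω} {Z : ℤ → Ω → ℝ} {q : ℕ}

theorem norm_cumulant_two_le (hstat : StrictlyStationary μ Z) (hZ : ∀ t, Measurable (Z t))
    (h : CumulantSummable μ Z q) (s t : ℤ) (u v : ℝ) :
    ‖cumulant μ ![expProc Z s u, expProc Z t v]‖ ≤ cumBound μ Z ![s - t] := by
  have := norm_cumulant_expProc_le hstat hZ h ![s, t] ![u, v]
  convert this using 3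
  · funext j; fin_cases j <;> rfl
  · rename_i j; fin_cases j; rfl

theorem norm_cumulant_three_le (hstat : StrictlyStationary μ Z) (hZ : ∀ t, Measurable (Z t))
    (h : CumulantSummable μ Z q) (a b c : ℤ) (u v w : ℝ) :
    ‖cumulant μ ![expProc Z a u, expProc Z b v, expProc Z c w]‖ ≤ cumBound μ Z ![a - c, b - c] := by
  have := norm_cumulant_expProc_le hstat hZ h ![a, b, c] ![u, v, w]
  convert this using 3
  · funext j; fin_cases j <;> rfl
  · rename_i j; fin_cases j <;> rfl

theorem norm_cumulant_four_le (hstat : StrictlyStationary μ Z) (hZ : ∀ t, Measurable (Z t))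
    (h : CumulantSummable μ Z q) (a b c d : ℤ) (u v w x : ℝ) :
    ‖cumulant μ ![expProc Z a u, expProc Z b v, expProc Z c w, expProc Z d x]‖ ≤
      cumBound μ Z ![a - d, b - d, c - d] := by
  have := norm_cumulant_expProc_le hstat hZ h ![a, b, c, d] ![u, v, w, x]
  convert this using 3
  · funext j; fin_cases j <;> rfl
  · rename_i j; fin_cases j <;> rfl

/-- Decay rate of the covariances of the products `e^{iuZ_{t+h}} e^{ivZ_t}`. -/
noncomputable def mixRate (μ : Measure Ω) (Z : ℤ → Ω → ℝ) (h k : ℤ) : ℝ :=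
  cumBound μ Z ![k + h, k, h] + cumBound μ Z ![k, h] + cumBound μ Z ![k + h, h]
    + cumBound μ Z ![k + h, k] + cumBound μ Z ![k, k - h] + 2 * cumBound μ Z ![k]
    + 2 * cumBound μ Z ![k - h] + cumBound μ Z ![k] + cumBound μ Z ![k - h]
    + cumBound μ Z ![k + h] + cumBound μ Z ![k]

theorem tendsto_mixRate (hsum : CumulantSummable μ Z q) (h : ℤ) :
    Tendsto (mixRate μ Z h) cofinite (𝓝 0) := by
  -- A first coordinate `k + c` already makes the family of lag vectors injective in `k`.
  have key : ∀ {m : ℕ} (ι : ℤ → Fin (m + 1) → ℤ) (c : ℤ), (∀ k, ι k 0 = k + c) →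
      Tendsto (fun k => cumBound μ Z (ι k)) cofinite (𝓝 0) := by
    intro m ι c hc
    refine hsum.tendsto_cumBound fun k k' hk => ?_
    have := congrFun hk 0
    rw [hc, hc] at this
    linarith
  have h1 := key (fun k => ![k + h, k, h]) h (by simp)
  have h2 := key (fun k => ![k, h]) 0 (by simp)
  have h3 := key (fun k => ![k + h, h]) h (by simp)
  have h4 := key (fun k => ![k + h, k]) h (by simp)
  have h5 := key (fun k => ![k, k - h]) 0 (by simp)
  have h6 := key (fun k => ![k]) 0 (by simp)
  have h7 := key (fun k => ![k - h]) (-h) (by simp [sub_eq_add_neg])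
  have h8 := key (fun k => ![k + h]) h (by simp)
  have :=  (((((((((h1.add h2).add h3).add h4).add h5).add (h6.const_mul 2)).add
    (h7.const_mul 2)).add h6).add h7).add h8).add h6
  simp only [mul_zero, add_zero] at this
  exact this

/-- In `integral_four_sub_eq` each summand contains a cumulant mixing a variable at time `s` or `s +
h` with one at time `t` or `t + h`. That factor decays in `s - t`, and the remaining factors are
bounded by constants. -/
theorem norm_cov_expProc_mul_le [IsProbabilityMeasure μ] (hstat : StrictlyStationary μ Z)
    (hZ : ∀ t, Measurable (Z t)) (hsum : CumulantSummable μ Z q) (h s t : ℤ) (u v u' v' : ℝ) :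
    ‖∫ ω, expProc Z (s + h) u ω * expProc Z s v ω * (expProc Z (t + h) u' ω * expProc Z t v' ω) ∂μ -
      (∫ ω, expProc Z (s + h) u ω * expProc Z s v ω ∂μ) *
        ∫ ω, expProc Z (t + h) u' ω * expProc Z t v' ω ∂μ‖ ≤ mixRate μ Z h (s - t) := by
  have hE : ∀ a w, ‖∫ ω, expProc Z a w ω ∂μ‖ ≤ 1 := fun a w =>
    norm_integral_le_one fun ω => (norm_expProc Z a w ω).le
  have hE2 : ∀ a w b x, ‖∫ ω, expProc Z a w ω * expProc Z b x ω ∂μ‖ ≤ 1 := fun a w b x =>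
    norm_integral_le_one fun ω => by simp [norm_expProc]
  -- A second-order cumulant is a difference of two terms of modulus at most one. This is the origin
  -- of the coefficients `2` in `mixRate`.
  have hC : ∀ a w b x, ‖cumulant μ ![expProc Z a w, expProc Z b x]‖ ≤ 2 := by
    intro a w b x
    rw [cumulant_two]
    refine (norm_sub_le _ _).trans ?_
    rw [norm_mul]
    have h1 := hE2 a w b x
    have h2 := mul_le_mul (hE a w) (hE b x) (norm_nonneg _) zero_le_one
    simp only [Matrix.cons_val_zero, Matrix.cons_val_one]
    linarith
  rw [integral_four_sub_eq]
  have e1 : ∀ x y : ℂ, ∀ b : ℝ, ‖x‖ ≤ 1 → ‖y‖ ≤ b → ‖x * y‖ ≤ b := by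
    intro x y b hx hy
    rw [norm_mul]
    nlinarith [norm_nonneg x, norm_nonneg y]
  have e2 : ∀ x y : ℂ, ∀ b : ℝ, ‖x‖ ≤ 2 → ‖y‖ ≤ b → ‖x * y‖ ≤ 2 * b := by
    intro x y b hx hy
    rw [norm_mul]
    nlinarith [norm_nonneg x, norm_nonneg y]
  have e3 : ∀ x y z : ℂ, ∀ b : ℝ, ‖x‖ ≤ 1 → ‖y‖ ≤ 1 → ‖z‖ ≤ b → ‖x * y * z‖ ≤ b := by
    intro x y z b hx hy hz
    rw [mul_assoc]
    exact e1 _ _ _ hx (e1 _ _ _ hy hz)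
  have c4 := norm_cumulant_four_le hstat hZ hsum (s + h) s (t + h) t u v u' v'
  have c123 := norm_cumulant_three_le hstat hZ hsum s (t + h) t v u' v'
  have c023 := norm_cumulant_three_le hstat hZ hsum (s + h) (t + h) t u u' v'
  have c013 := norm_cumulant_three_le hstat hZ hsum (s + h) s t u v v'
  have c012 := norm_cumulant_three_le hstat hZ hsum (s + h) s (t + h) u v u'
  have c02 := norm_cumulant_two_le hstat hZ hsum (s + h) (t + h) u u'
  have c03 := norm_cumulant_two_le hstat hZ hsum (s + h) t u v'
  have c12 := norm_cumulant_two_le hstat hZ hsum s (t + h) v u'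
  have c13 := norm_cumulant_two_le hstat hZ hsum s t v v'
  have r1 : s + h - t = s - t + h := by ring
  have r2 : t + h - t = h := by ring
  have r3 : s + h - (t + h) = s - t := by ring
  have r4 : s - (t + h) = s - t - h := by ring
  rw [r1, r2] at c4
  rw [r2] at c123
  rw [r1, r2] at c023
  rw [r1] at c013
  rw [r3, r4] at c012
  rw [r3] at c02
  rw [r1] at c03
  rw [r4] at c12
  refine (norm_add_le_of_le (norm_add_le_of_le (norm_add_le_of_le (norm_add_le_of_le
    (norm_add_le_of_le (norm_add_le_of_le (norm_add_le_of_le (norm_add_le_of_le (norm_add_le_of_le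
    (norm_add_le_of_le c4 (e1 _ _ _ (hE _ _) c123)) (e1 _ _ _ (hE _ _) c023))
    (e1 _ _ _ (hE _ _) c013)) (e1 _ _ _ (hE _ _) c012)) (e2 _ _ _ (hC _ _ _ _) c13))
    (e2 _ _ _ (hC _ _ _ _) c12)) (e3 _ _ _ _ (hE _ _) (hE _ _) c13))
    (e3 _ _ _ _ (hE _ _) (hE _ _) c12)) (e3 _ _ _ _ (hE _ _) (hE _ _) c03))
    (e3 _ _ _ _ (hE _ _) (hE _ _) c02)).trans ?_
  -- The bounds were added in the order of the summands of `mixRate`.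
  exact le_refl _

end

end GenSpectrum

namespace GenSpectrum

variable {Ω : Type*} [MeasurableSpace Ω]

/-! ### Laws of large numbers with uniform rates -/

/-- The variance of `‖g‖` is non-negative. This turns second-moment estimates into `L¹` rates. -/
theorem integral_norm_le_sqrt {μ : Measure Ω} [IsProbabilityMeasure μ] {g : Ω → ℂ}
    (hg : Measurable g) {C : ℝ} (hC : ∀ ω, ‖g ω‖ ≤ C) {b : ℝ} (hb : ∫ ω, ‖g ω‖ ^ 2 ∂μ ≤ b) :
    ∫ ω, ‖g ω‖ ∂μ ≤ √b := by
  set a := ∫ ω, ‖g ω‖ ∂μ with ha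
  have hi : Integrable (fun ω => ‖g ω‖) μ := (integrable_of_norm_le hg hC).norm
  have hi2 : Integrable (fun ω => ‖g ω‖ ^ 2) μ := by
    refine Integrable.of_bound (hg.norm.pow_const 2).aestronglyMeasurable (C ^ 2)
      (ae_of_all _ fun ω => ?_)
    rw [Real.norm_of_nonneg (by positivity)]
    exact pow_le_pow_left₀ (norm_nonneg _) (hC ω) 2
  have h0 : 0 ≤ ∫ ω, (‖g ω‖ - a) ^ 2 ∂μ := integral_nonneg fun ω => sq_nonneg _
  have h1 : ∫ ω, (‖g ω‖ - a) ^ 2 ∂μ = ∫ ω, ‖g ω‖ ^ 2 ∂μ - a ^ 2 := by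
    have : ∀ ω, (‖g ω‖ - a) ^ 2 = ‖g ω‖ ^ 2 - 2 * a * ‖g ω‖ + a ^ 2 := fun ω => by ring
    simp_rw [this]
    have hi3 : Integrable (fun ω => ‖g ω‖ ^ 2 - 2 * a * ‖g ω‖) μ := hi2.sub (hi.const_mul _)
    rw [integral_add hi3 (integrable_const _),
      integral_sub hi2 (hi.const_mul _), integral_const_mul, ← ha]
    simp
    ring
  refine Real.le_sqrt_of_sq_le ?_
  linarith

/-- The second moment of a sum of bounded variables, in terms of a bound on covariances. -/
theorem integral_norm_sum_sub_sq_le {μ : Measure Ω} [IsProbabilityMeasure μ] {W : ℕ → Ω → ℂ}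
    (hW : ∀ t, Measurable (W t)) (hb : ∀ t ω, ‖W t ω‖ ≤ 1) {r : ℤ → ℝ}
    (hr : ∀ s t : ℕ, ‖∫ ω, W s ω * (starRingEnd ℂ) (W t ω) ∂μ -
      (∫ ω, W s ω ∂μ) * ∫ ω, (starRingEnd ℂ) (W t ω) ∂μ‖ ≤ r (s - t)) (A : Finset ℕ) :
    ∫ ω, ‖∑ t ∈ A, (W t ω - ∫ ω', W t ω' ∂μ)‖ ^ 2 ∂μ ≤ ∑ s ∈ A, ∑ t ∈ A, r ((s : ℤ) - t) := by
  have hint : ∀ t, Integrable (W t) μ := fun t => integrable_of_norm_le (hW t) (hb t)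
  have hcm : ∀ t, Measurable fun ω => (starRingEnd ℂ) (W t ω) := fun t =>
    Complex.continuous_conj.measurable.comp (hW t)
  have hcint : ∀ t, Integrable (fun ω => (starRingEnd ℂ) (W t ω)) μ := fun t =>
    integrable_of_norm_le (hcm t) (C := 1) fun ω => by simpa using hb t ω
  have hpint : ∀ s t, Integrable (fun ω => W s ω * (starRingEnd ℂ) (W t ω)) μ := fun s t =>
    integrable_of_norm_le ((hW s).mul (hcm t)) (C := 1) fun ω => by
      simpa using mul_le_mul (hb s ω) (hb t ω) (norm_nonneg _) zero_le_one
  have hV : ∀ s t, (∫ ω, (W s ω - ∫ ω', W s ω' ∂μ) *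
      (starRingEnd ℂ) (W t ω - ∫ ω', W t ω' ∂μ) ∂μ) = ∫ ω, W s ω * (starRingEnd ℂ) (W t ω) ∂μ -
      (∫ ω, W s ω ∂μ) * ∫ ω, (starRingEnd ℂ) (W t ω) ∂μ := by
    intro s t
    have e : ∀ ω, (W s ω - ∫ ω', W s ω' ∂μ) * (starRingEnd ℂ) (W t ω - ∫ ω', W t ω' ∂μ) =
        W s ω * (starRingEnd ℂ) (W t ω) - W s ω * (∫ ω', (starRingEnd ℂ) (W t ω') ∂μ) -
        (∫ ω', W s ω' ∂μ) * (starRingEnd ℂ) (W t ω) +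
        (∫ ω', W s ω' ∂μ) * (∫ ω', (starRingEnd ℂ) (W t ω') ∂μ) := by
      intro ω
      rw [map_sub, integral_conj]
      ring
    simp_rw [e]
    have i1 : Integrable (fun ω => W s ω * (starRingEnd ℂ) (W t ω) -
        W s ω * (∫ ω', (starRingEnd ℂ) (W t ω') ∂μ)) μ := (hpint s t).sub ((hint s).mul_const _)
    have i2 : Integrable (fun ω => W s ω * (starRingEnd ℂ) (W t ω) -
        W s ω * (∫ ω', (starRingEnd ℂ) (W t ω') ∂μ) -
        (∫ ω', W s ω' ∂μ) * (starRingEnd ℂ) (W t ω)) μ := i1.sub ((hcint t).const_mul _)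
    rw [integral_add i2 (integrable_const _), integral_sub i1
      ((hcint t).const_mul _), integral_sub (hpint s t) ((hint s).mul_const _),
      integral_mul_const, integral_const_mul]
    simp
  have hVint : ∀ s t, Integrable (fun ω => (W s ω - ∫ ω', W s ω' ∂μ) *
      (starRingEnd ℂ) (W t ω - ∫ ω', W t ω' ∂μ)) μ := by
    intro s t
    have hm : ∀ t, ‖∫ ω', W t ω' ∂μ‖ ≤ 1 := fun t => norm_integral_le_one (hb t)
    refine integrable_of_norm_le (C := 2 * 2) (((hW s).sub_const _).mul
      (Complex.continuous_conj.measurable.comp ((hW t).sub_const _))) fun ω => ?_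
    rw [norm_mul, RCLike.norm_conj]
    refine mul_le_mul ?_ ?_ (norm_nonneg _) (by norm_num)
    · exact (norm_sub_le _ _).trans (by linarith [hb s ω, hm s])
    · exact (norm_sub_le _ _).trans (by linarith [hb t ω, hm t])
  have hsq : ∀ ω, ((‖∑ t ∈ A, (W t ω - ∫ ω', W t ω' ∂μ)‖ ^ 2 : ℝ) : ℂ) = ∑ s ∈ A, ∑ t ∈ A,
      (W s ω - ∫ ω', W s ω' ∂μ) * (starRingEnd ℂ) (W t ω - ∫ ω', W t ω' ∂μ) := by
    intro ω
    rw [Complex.ofReal_pow, ← Complex.mul_conj', map_sum, Finset.sum_mul_sum]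
  have hI : ((∫ ω, ‖∑ t ∈ A, (W t ω - ∫ ω', W t ω' ∂μ)‖ ^ 2 ∂μ : ℝ) : ℂ) = ∑ s ∈ A, ∑ t ∈ A,
      (∫ ω, W s ω * (starRingEnd ℂ) (W t ω) ∂μ -
      (∫ ω, W s ω ∂μ) * ∫ ω, (starRingEnd ℂ) (W t ω) ∂μ) := by
    rw [← integral_complex_ofReal]
    simp_rw [hsq]
    rw [integral_finsetSum _ fun s _ => integrable_finsetSum _ fun t _ => hVint s t]
    refine Finset.sum_congr rfl fun s _ => ?_
    rw [integral_finsetSum _ fun t _ => hVint s t]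
    exact Finset.sum_congr rfl fun t _ => hV s t
  have h0 : 0 ≤ ∫ ω, ‖∑ t ∈ A, (W t ω - ∫ ω', W t ω' ∂μ)‖ ^ 2 ∂μ :=
    integral_nonneg fun ω => by positivity
  calc _ = ‖((∫ ω, ‖∑ t ∈ A, (W t ω - ∫ ω', W t ω' ∂μ)‖ ^ 2 ∂μ : ℝ) : ℂ)‖ := by
        rw [Complex.norm_real, Real.norm_of_nonneg h0]
    _ ≤ _ := by
        rw [hI]
        exact norm_sum_le_of_le _ fun s _ => norm_sum_le_of_le _ fun t _ => hr s t

/-- Double Cesàro means of a sequence which vanishes at infinity. -/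
theorem tendsto_double_average {r : ℤ → ℝ} (h0 : ∀ k, 0 ≤ r k)
    (hr : Tendsto r cofinite (𝓝 0)) :
    Tendsto (fun n : ℕ => (∑ s ∈ Finset.Icc 1 n, ∑ t ∈ Finset.Icc 1 n, r ((s : ℤ) - t)) / (n : ℝ) ^ 2)
      atTop (𝓝 0) := by
  rw [Metric.tendsto_atTop]
  intro ε hε
  have hfin : {k | ¬ r k < ε / 2}.Finite := by
    have := hr.eventually (gt_mem_nhds (half_pos hε))
    exact Filter.eventually_cofinite.1 this
  set E := hfin.toFinset with hE
  set R := ∑ k ∈ E, r k with hR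
  have hR0 : 0 ≤ R := Finset.sum_nonneg fun k _ => h0 k
  -- For `n > 2R/ε` the bound `n (n ε/2 + R)` of the double sum is below `ε n²`.
  obtain ⟨N, hN⟩ := exists_nat_gt (2 * R / ε)
  refine ⟨max N 1, fun n hn => ?_⟩
  have hn1 : 1 ≤ n := le_of_max_le_right hn
  have hnN : N ≤ n := le_of_max_le_left hn
  have hnpos : (0 : ℝ) < n := by exact_mod_cast hn1
  -- For fixed `s` the lags `s - t` are distinct, so the exceptional lags contribute at most `R` to
  -- a row and each other lag at most `ε / 2`.
  have hrow : ∀ s : ℕ, ∑ t ∈ Finset.Icc 1 n, r ((s : ℤ) - t) ≤ n * (ε / 2) + R := by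
    intro s
    have hle : ∀ t ∈ Finset.Icc 1 n, r ((s : ℤ) - t) ≤
        ε / 2 + if (s : ℤ) - t ∈ E then r ((s : ℤ) - t) else 0 := by
      intro t _
      split_ifs with h
      · linarith
      · have : r ((s : ℤ) - t) < ε / 2 := by simpa [hE] using h
        linarith
    refine (Finset.sum_le_sum hle).trans ?_
    rw [Finset.sum_add_distrib]
    refine add_le_add (by simp) ?_
    rw [← Finset.sum_filter]
    have hinj : Set.InjOn (fun t : ℕ => (s : ℤ) - t)
        ((Finset.Icc 1 n).filter fun t : ℕ => (s : ℤ) - t ∈ E) := by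
      intro a _ b _ hab
      simp only at hab
      omega
    rw [← Finset.sum_image (f := r) hinj]
    refine Finset.sum_le_sum_of_subset_of_nonneg ?_ fun k _ _ => h0 k
    intro k hk
    obtain ⟨t, ht, rfl⟩ := Finset.mem_image.1 hk
    exact (Finset.mem_filter.1 ht).2
  have htot : ∑ s ∈ Finset.Icc 1 n, ∑ t ∈ Finset.Icc 1 n, r ((s : ℤ) - t) ≤
      n * (n * (ε / 2) + R) := by
    refine (Finset.sum_le_sum fun s _ => hrow s).trans (le_of_eq ?_)
    simp
    ring
  have hpos : 0 ≤ ∑ s ∈ Finset.Icc 1 n, ∑ t ∈ Finset.Icc 1 n, r ((s : ℤ) - t) :=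
    Finset.sum_nonneg fun _ _ => Finset.sum_nonneg fun _ _ => h0 _
  rw [Real.dist_eq, sub_zero, abs_of_nonneg (by positivity), div_lt_iff₀ (by positivity)]
  have h2 : 2 * R < ε * n := by
    rw [div_lt_iff₀ hε] at hN
    have : (N : ℝ) ≤ n := by exact_mod_cast hnN
    nlinarith
  nlinarith

section

variable {μ : Measure Ω} {Z : ℤ → Ω → ℝ} {q : ℕ}

theorem StrictlyStationary.integral_expProc (hstat : StrictlyStationary μ Z)
    (hZ : ∀ t, Measurable (Z t)) (t : ℤ) (u : ℝ) :
    ∫ ω, expProc Z t u ω ∂μ = ∫ ω, expProc Z 0 u ω ∂μ := by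
  simpa using hstat.integral_prod_expProc hZ (fun _ : Fin 1 => 0) (fun _ => u) t Finset.univ

theorem StrictlyStationary.integral_expProc_mul (hstat : StrictlyStationary μ Z)
    (hZ : ∀ t, Measurable (Z t)) (t h : ℤ) (u v : ℝ) :
    ∫ ω, expProc Z (t + h) u ω * expProc Z t v ω ∂μ =
      ∫ ω, expProc Z h u ω * expProc Z 0 v ω ∂μ := by
  simpa [Fin.prod_univ_two, add_comm h t] using
    hstat.integral_prod_expProc hZ ![h, 0] ![u, v] t Finset.univ

/-- The averages of `e^{iuZ_{t+h}} e^{ivZ_t}` converge in mean, uniformly in `u` and `v`. -/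
theorem exists_rate_average_expProc_mul [IsProbabilityMeasure μ] (hstat : StrictlyStationary μ Z)
    (hZ : ∀ t, Measurable (Z t)) (hsum : CumulantSummable μ Z q) (h : ℤ) :
    ∃ ρ : ℕ → ℝ, Tendsto ρ atTop (𝓝 0) ∧ ∀ n : ℕ, 1 ≤ n → ∀ u v : ℝ,
      ∫ ω, ‖(n : ℂ)⁻¹ * ∑ t ∈ Finset.Icc 1 n, expProc Z (t + h) u ω * expProc Z t v ω -
        ∫ ω', expProc Z h u ω' * expProc Z 0 v ω' ∂μ‖ ∂μ ≤ ρ n := by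
  have hnn : ∀ k, 0 ≤ mixRate μ Z h k := by
    intro k
    have h3 := fun l : Fin 3 → ℤ => cumBound_nonneg μ Z l
    have h2 := fun l : Fin 2 → ℤ => cumBound_nonneg μ Z l
    have h1 := fun l : Fin 1 → ℤ => cumBound_nonneg μ Z l
    unfold mixRate
    linarith [h3 ![k + h, k, h], h2 ![k, h], h2 ![k + h, h], h2 ![k + h, k], h2 ![k, k - h],
      h1 ![k], h1 ![k - h], h1 ![k + h]]
  refine ⟨fun n => √((∑ s ∈ Finset.Icc 1 n, ∑ t ∈ Finset.Icc 1 n, mixRate μ Z h ((s : ℤ) - t)) /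
    (n : ℝ) ^ 2), ?_, ?_⟩
  · simpa using (tendsto_double_average hnn (tendsto_mixRate hsum h)).sqrt
  intro n hn u v
  have hn0 : (n : ℂ) ≠ 0 := by exact_mod_cast (by omega : n ≠ 0)
  set W : ℕ → Ω → ℂ := fun t ω => expProc Z (t + h) u ω * expProc Z t v ω with hWdef
  have hWm : ∀ t, Measurable (W t) := fun t =>
    (measurable_expProc hZ _ _).mul (measurable_expProc hZ _ _)
  have hWb : ∀ t ω, ‖W t ω‖ ≤ 1 := fun t ω => by simp [W, norm_expProc]
  have hmean : ∀ t, ∫ ω, W t ω ∂μ = ∫ ω', expProc Z h u ω' * expProc Z 0 v ω' ∂μ := fun t =>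
    hstat.integral_expProc_mul hZ t h u v
  have key := integral_norm_sum_sub_sq_le (μ := μ) hWm hWb (r := mixRate μ Z h) (by
    intro s t
    -- Conjugation only changes the sign of the frequencies, and the covariance bound is uniform
    -- over them.
    simp only [hWdef, map_mul, conj_expProc]
    exact norm_cov_expProc_mul_le hstat hZ hsum h s t u v (-u) (-v)) (Finset.Icc 1 n)
  set m := ∫ ω', expProc Z h u ω' * expProc Z 0 v ω' ∂μ with hm
  have hm1 : ‖m‖ ≤ 1 := norm_integral_le_one fun ω => by simp [norm_expProc]
  have hrew : ∀ ω, (n : ℂ)⁻¹ * ∑ t ∈ Finset.Icc 1 n, W t ω - m =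
      (n : ℂ)⁻¹ * ∑ t ∈ Finset.Icc 1 n, (W t ω - ∫ ω', W t ω' ∂μ) := by
    intro ω
    simp only [hmean, Finset.sum_sub_distrib, Finset.sum_const, Nat.card_Icc, nsmul_eq_mul,
      Nat.add_sub_cancel]
    field_simp
  refine integral_norm_le_sqrt (C := 2) ?_ ?_ ?_
  · exact ((Finset.measurable_fun_sum _ fun t _ => hWm t).const_mul _).sub_const _
  · intro ω
    refine (norm_sub_le _ _).trans ?_
    have : ‖(n : ℂ)⁻¹ * ∑ t ∈ Finset.Icc 1 n, W t ω‖ ≤ 1 := by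
      rw [norm_mul, norm_inv, Complex.norm_natCast]
      have h1 : ‖∑ t ∈ Finset.Icc 1 n, W t ω‖ ≤ n := by
        refine (norm_sum_le_of_le _ fun t _ => hWb t ω).trans (by simp)
      rw [inv_mul_le_iff₀ (by exact_mod_cast hn)]
      simpa using h1
    change ‖(n : ℂ)⁻¹ * ∑ t ∈ Finset.Icc 1 n, W t ω‖ + ‖m‖ ≤ 2
    linarith
  · have : ∀ ω, ‖(n : ℂ)⁻¹ * ∑ t ∈ Finset.Icc 1 n, expProc Z (t + h) u ω * expProc Z t v ω - m‖ ^ 2 =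
        ((n : ℝ) ^ 2)⁻¹ * ‖∑ t ∈ Finset.Icc 1 n, (W t ω - ∫ ω', W t ω' ∂μ)‖ ^ 2 := by
      intro ω
      rw [← inv_pow, ← mul_pow]
      congr 1
      have := hrew ω
      simp only [hWdef] at this ⊢
      rw [this, norm_mul, norm_inv, Complex.norm_natCast]
    simp_rw [this]
    rw [integral_const_mul, div_eq_inv_mul]
    exact mul_le_mul_of_nonneg_left key (by positivity)

/-- The case `h = 0`, `v = 0` of the preceding result, as `e^{i0Z} = 1`. -/
theorem exists_rate_average_expProc [IsProbabilityMeasure μ] (hstat : StrictlyStationary μ Z)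
    (hZ : ∀ t, Measurable (Z t)) (hsum : CumulantSummable μ Z q) :
    ∃ ρ : ℕ → ℝ, Tendsto ρ atTop (𝓝 0) ∧ ∀ n : ℕ, 1 ≤ n → ∀ u : ℝ,
      ∫ ω, ‖(n : ℂ)⁻¹ * ∑ t ∈ Finset.Icc 1 n, expProc Z t u ω - ∫ ω', expProc Z 0 u ω' ∂μ‖ ∂μ
        ≤ ρ n := by
  obtain ⟨ρ, hρ, h⟩ := exists_rate_average_expProc_mul hstat hZ hsum 0
  refine ⟨ρ, hρ, fun n hn u => ?_⟩
  have h0 : ∀ t ω, expProc Z t 0 ω = 1 := fun t ω => by simp [expProc]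
  simpa [h0] using h n hn u 0

end

end GenSpectrum

namespace GenSpectrum

/-! ### Sums over Fourier frequencies -/

/-- A geometric sum whose ratio is an `n`-th root of unity, equal to one exactly when `n` divides
`k`. -/
theorem sum_range_exp_fourier {n : ℕ} (hn : 1 ≤ n) (k : ℤ) :
    ∑ j ∈ Finset.range n, Complex.exp (-(Complex.I * (k : ℂ) * ((2 * Real.pi * j / n : ℝ) : ℂ))) =
      if (n : ℤ) ∣ k then (n : ℂ) else 0 := by
  have hn0 : (n : ℂ) ≠ 0 := by exact_mod_cast (by omega : n ≠ 0)
  set z : ℂ := Complex.exp (-(2 * Real.pi * Complex.I * (k / n))) with hz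
  have hpow : ∀ j : ℕ, Complex.exp (-(Complex.I * (k : ℂ) * ((2 * Real.pi * j / n : ℝ) : ℂ))) =
      z ^ j := by
    intro j
    rw [hz, ← Complex.exp_nat_mul]
    congr 1
    push_cast
    ring
  simp_rw [hpow]
  have hzn : z ^ n = 1 := by
    rw [hz, ← Complex.exp_nat_mul, Complex.exp_eq_one_iff]
    refine ⟨-k, ?_⟩
    push_cast
    field_simp
  have hz1 : z = 1 ↔ (n : ℤ) ∣ k := by
    rw [hz, Complex.exp_eq_one_iff]
    have hpi : (2 * Real.pi * Complex.I : ℂ) ≠ 0 := Complex.two_pi_I_ne_zero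
    constructor
    · rintro ⟨a, ha⟩
      refine ⟨-a, ?_⟩
      have h1 : (k : ℂ) / n = -a := by
        apply mul_left_cancel₀ hpi
        linear_combination -ha
      rw [div_eq_iff hn0] at h1
      have : ((k : ℤ) : ℂ) = ((n * -a : ℤ) : ℂ) := by
        push_cast
        rw [h1]
        ring
      exact_mod_cast this
    · rintro ⟨a, rfl⟩
      refine ⟨-a, ?_⟩
      push_cast
      field_simp
  split_ifs with h
  · rw [hz1.2 h]
    simp
  · have h1 : z ≠ 1 := fun h' => h (hz1.1 h')
    rw [geom_sum_eq h1, hzn]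
    simp

/-- Constants are invisible to `dft` at non-zero Fourier frequencies, so `e^{iuZ_t}` may be centred
there for free. The signs `e = ±1` serve the two factors `d_n(λ; u)` and `d_n(-λ; v)`. -/
theorem sum_Icc_exp_fourier_eq_zero {n j : ℕ} (hj : j ∈ Finset.Icc 1 (n - 1)) (e : ℤ)
    (he : e = 1 ∨ e = -1) :
    ∑ t ∈ Finset.Icc 1 n,
      Complex.exp (-(Complex.I * (t : ℂ) * ((e * (2 * Real.pi * j / n) : ℝ) : ℂ))) = 0 := by
  rw [Finset.mem_Icc] at hj
  have hn : 1 ≤ n := by omega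
  have h0 := sum_range_exp_fourier hn (e * j)
  have hnd : ¬ (n : ℤ) ∣ e * j := by
    intro h
    have h' : (n : ℤ) ∣ j := by
      rcases he with rfl | rfl
      · simpa using h
      · simpa using h
    have := Nat.le_of_dvd (by omega) (Int.natCast_dvd_natCast.1 h')
    omega
  rw [if_neg hnd] at h0
  have hset : Finset.Icc 1 n = (Finset.range n).map ⟨fun t => t + 1, add_left_injective 1⟩ := by
    ext t
    simp only [Finset.mem_Icc, Finset.mem_map, Finset.mem_range, Function.Embedding.coeFn_mk]
    constructor
    · rintro ⟨h1, h2⟩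
      exact ⟨t - 1, by omega, by omega⟩
    · rintro ⟨a, ha, rfl⟩
      omega
  rw [hset, Finset.sum_map]
  have hterm : ∀ t ∈ Finset.range n, Complex.exp (-(Complex.I *
      ((⟨fun t => t + 1, add_left_injective 1⟩ : ℕ ↪ ℕ) t : ℂ) *
      ((e * (2 * Real.pi * j / n) : ℝ) : ℂ))) =
      Complex.exp (-(Complex.I * ((e * j : ℤ) : ℂ) * ((2 * Real.pi * t / n : ℝ) : ℂ))) *
        Complex.exp (-(Complex.I * ((e * (2 * Real.pi * j / n) : ℝ) : ℂ))) := by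
    intro t _
    rw [← Complex.exp_add]
    congr 1
    simp only [Function.Embedding.coeFn_mk]
    push_cast
    ring
  rw [Finset.sum_congr rfl hterm, ← Finset.sum_mul, h0, zero_mul]

/-- Exactly one `s` between `1` and `n` is congruent to `t + h` modulo `n`. It is `t + h` itself
unless this leaves the observation window, and then the wrap-around costs at most `2`. -/
theorem norm_sum_dvd_sub_le {n : ℕ} (hn : 1 ≤ n) (h : ℤ) (t : ℕ) {x : ℤ → ℂ}
    (hx : ∀ s, ‖x s‖ ≤ 1) :
    ‖∑ s ∈ Finset.Icc 1 n, (if (n : ℤ) ∣ s - t - h then x s else 0) - x (t + h)‖ ≤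
      if 1 ≤ (t : ℤ) + h ∧ (t : ℤ) + h ≤ n then 0 else 2 := by
  have hnpos : (0 : ℤ) < n := by exact_mod_cast hn
  have hm0 := Int.emod_nonneg ((t : ℤ) + h - 1) hnpos.ne'
  have hm1 := Int.emod_lt_of_pos ((t : ℤ) + h - 1) hnpos
  -- The representative of `t + h` modulo `n` in `{1, …, n}` rather than `{0, …, n - 1}`, hence the
  -- shifts by one.
  obtain ⟨σ, hσ⟩ : ∃ σ : ℕ, (σ : ℤ) = ((t : ℤ) + h - 1) % n + 1 :=
    ⟨(((t : ℤ) + h - 1) % n + 1).toNat, by omega⟩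
  have hiff : ∀ s ∈ Finset.Icc 1 n, ((n : ℤ) ∣ s - t - h ↔ s = σ) := by
    intro s hs
    rw [Finset.mem_Icc] at hs
    have h1 : ((s : ℤ) - 1) % n = s - 1 := Int.emod_eq_of_lt (by omega) (by omega)
    have h2 : (n : ℤ) ∣ s - t - h ↔ ((t : ℤ) + h - 1) % n = ((s : ℤ) - 1) % n := by
      rw [Int.emod_eq_emod_iff_emod_sub_eq_zero, ← Int.dvd_iff_emod_eq_zero, ← Int.dvd_neg]
      ring_nf
    rw [h2, h1]
    omega
  have hsum : ∑ s ∈ Finset.Icc 1 n, (if (n : ℤ) ∣ s - t - h then x s else 0) = x σ := by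
    rw [Finset.sum_congr rfl fun s hs => if_congr (hiff s hs) rfl rfl,
      Finset.sum_ite_eq' , if_pos]
    rw [Finset.mem_Icc]
    omega
  rw [hsum]
  split_ifs with hc
  · have : (σ : ℤ) = t + h := by
      rw [hσ, Int.emod_eq_of_lt (by omega) (by omega)]
      ring
    rw [this, sub_self, norm_zero]
  · exact (norm_sub_le _ _).trans (by linarith [hx σ, hx (t + h)])

/-- At most `|h|` times leave the window, all at its upper end for `h ≥ 0` and all at its lower end
for `h ≤ 0`. -/
theorem sum_Icc_shift_outside_le (n : ℕ) (h : ℤ) :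
    ∑ t ∈ Finset.Icc 1 n, (if 1 ≤ (t : ℤ) + h ∧ (t : ℤ) + h ≤ n then (0 : ℝ) else 2) ≤
      2 * (h.natAbs : ℝ) := by
  rw [Finset.sum_ite, Finset.sum_const_zero, zero_add, Finset.sum_const, nsmul_eq_mul, mul_comm]
  refine mul_le_mul_of_nonneg_left ?_ (by norm_num)
  norm_cast
  rcases le_total 0 h with h0 | h0
  · have : (Finset.Icc 1 n).filter (fun t : ℕ => ¬ (1 ≤ (t : ℤ) + h ∧ (t : ℤ) + h ≤ n)) ⊆
        Finset.Ioc (n - h.natAbs) n := by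
      intro t ht
      rw [Finset.mem_filter, Finset.mem_Icc] at ht
      rw [Finset.mem_Ioc]
      omega
    refine (Finset.card_le_card this).trans ?_
    rw [Nat.card_Ioc]
    omega
  · have : (Finset.Icc 1 n).filter (fun t : ℕ => ¬ (1 ≤ (t : ℤ) + h ∧ (t : ℤ) + h ≤ n)) ⊆
        Finset.Icc 1 h.natAbs := by
      intro t ht
      rw [Finset.mem_filter, Finset.mem_Icc] at ht
      rw [Finset.mem_Icc]
      omega
    refine (Finset.card_le_card this).trans ?_
    rw [Nat.card_Icc]
    omega

theorem norm_exp_neg_I_mul_int_mul_real (l : ℤ) (x : ℝ) :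
    ‖Complex.exp (-(Complex.I * (l : ℂ) * (x : ℂ)))‖ = 1 := by
  have : -(Complex.I * (l : ℂ) * (x : ℂ)) = ((-(l * x) : ℝ) : ℂ) * Complex.I := by
    push_cast; ring
  rw [this, Complex.norm_exp_ofReal_mul_I]

/-! ### Pointwise bounds of the periodogram -/

variable {Ω : Type*} {Z : ℤ → Ω → ℝ}

theorem dft_eq (n : ℕ) (lam u : ℝ) (ω : Ω) : dft Z n lam u ω =
    ∑ t ∈ Finset.Icc 1 n, expProc Z t u ω * Complex.exp (-(Complex.I * (t : ℂ) * (lam : ℂ))) := rfl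

theorem norm_dft_le (n : ℕ) (lam u : ℝ) (ω : Ω) : ‖dft Z n lam u ω‖ ≤ n := by
  rw [dft_eq]
  refine (norm_sum_le_of_le _ (f := _) (n := fun _ => 1) fun t _ => ?_).trans (by simp)
  have := norm_exp_neg_I_mul_int_mul_real t lam
  push_cast at this
  rw [norm_mul, norm_expProc, one_mul, this]

theorem norm_one_div_two_pi_le : ‖(1 / (2 * (Real.pi : ℂ)) : ℂ)‖ ≤ 1 := by
  rw [norm_div, norm_mul, Complex.norm_real, Real.norm_of_nonneg Real.pi_pos.le]
  simp only [norm_one, Complex.norm_ofNat]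
  rw [div_le_one (by positivity)]
  linarith [Real.pi_gt_three]

theorem norm_periodogram_le (n : ℕ) (lam u v : ℝ) (ω : Ω) :
    ‖periodogram Z n lam u v ω‖ ≤ (n : ℝ)⁻¹ * (‖dft Z n lam u ω‖ * ‖dft Z n (-lam) v ω‖) := by
  have e : periodogram Z n lam u v ω = (1 / (2 * (Real.pi : ℂ))) *
      ((n : ℂ)⁻¹ * (dft Z n lam u ω * dft Z n (-lam) v ω)) := by
    unfold periodogram
    rw [← div_div]
    ring
  rw [e, norm_mul]
  refine (mul_le_of_le_one_left (norm_nonneg _) norm_one_div_two_pi_le).trans (le_of_eq ?_)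
  rw [norm_mul, norm_mul, norm_inv, Complex.norm_natCast]

theorem norm_periodogram_le_natCast (n : ℕ) (lam u v : ℝ) (ω : Ω) :
    ‖periodogram Z n lam u v ω‖ ≤ n := by
  refine (norm_periodogram_le n lam u v ω).trans ?_
  have h1 := norm_dft_le (Z := Z) n lam u ω
  have h2 := norm_dft_le (Z := Z) n (-lam) v ω
  rcases Nat.eq_zero_or_pos n with rfl | hn
  · simp
  have hn' : (0 : ℝ) < n := by exact_mod_cast hn
  rw [inv_mul_le_iff₀ hn']
  exact mul_le_mul h1 h2 (norm_nonneg _) hn'.le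

/-! ### The covariances and the spectrum -/

variable [MeasurableSpace Ω] {μ : Measure Ω} {q : ℕ}

theorem expCov_eq_cumulant (l : ℤ) (u v : ℝ) :
    expCov μ Z l u v = cumulant μ ![expProc Z l u, expProc Z 0 v] := by
  rw [cumulant_two]
  simp [expCov, expProc, Complex.exp_add]

/-- A uniform bound of the covariance `Cov(e^{iuZ_l}, e^{-ivZ_0})`. -/
noncomputable def covBound (μ : Measure Ω) (Z : ℤ → Ω → ℝ) (l : ℤ) : ℝ := cumBound μ Z ![l]

theorem covBound_nonneg (l : ℤ) : 0 ≤ covBound μ Z l := cumBound_nonneg _ _ _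

theorem CumulantSummable.summable_covBound (h : CumulantSummable μ Z q) :
    Summable (covBound μ Z) := by
  refine (h.summable_cumBound 1).comp_injective (i := fun l : ℤ => (![l] : Fin 1 → ℤ)) ?_
  intro a b hab
  simpa using congrFun hab 0

theorem norm_cov_expProc_le (hstat : StrictlyStationary μ Z) (hZ : ∀ t, Measurable (Z t))
    (h : CumulantSummable μ Z q) (s t : ℤ) (u v : ℝ) :
    ‖∫ ω, expProc Z s u ω * expProc Z t v ω ∂μ -
      (∫ ω, expProc Z s u ω ∂μ) * ∫ ω, expProc Z t v ω ∂μ‖ ≤ covBound μ Z (s - t) := by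
  have := norm_cumulant_two_le hstat hZ h s t u v
  rw [cumulant_two] at this
  simpa [covBound] using this

theorem norm_expCov_le (hstat : StrictlyStationary μ Z) (hZ : ∀ t, Measurable (Z t))
    (h : CumulantSummable μ Z q) (l : ℤ) (u v : ℝ) : ‖expCov μ Z l u v‖ ≤ covBound μ Z l := by
  have := norm_cumulant_two_le hstat hZ h l 0 u v
  rw [sub_zero] at this
  rw [expCov_eq_cumulant]
  exact this

theorem continuous_expCov [IsProbabilityMeasure μ] (hZ : ∀ t, Measurable (Z t)) (l : ℤ) :
    Continuous fun p : ℝ × ℝ => expCov μ Z l p.1 p.2 := by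
  have h1 : ∀ t, Continuous fun u : ℝ => ∫ ω, expProc Z t u ω ∂μ := by
    intro t
    refine continuous_of_dominated (bound := fun _ => 1)
      (fun u => (measurable_expProc hZ t u).aestronglyMeasurable)
      (fun u => ae_of_all _ fun ω => (norm_expProc Z t u ω).le) (integrable_const _)
      (ae_of_all _ fun ω => ?_)
    unfold expProc
    fun_prop
  have h2 : Continuous fun p : ℝ × ℝ => ∫ ω, expProc Z l p.1 ω * expProc Z 0 p.2 ω ∂μ := by
    refine continuous_of_dominated (bound := fun _ => 1)
      (fun p => ((measurable_expProc hZ _ _).mul (measurable_expProc hZ _ _)).aestronglyMeasurable)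
      (fun p => ae_of_all _ fun ω => by simp [norm_expProc]) (integrable_const _)
      (ae_of_all _ fun ω => ?_)
    unfold expProc
    fun_prop
  simp_rw [expCov_eq_cumulant, cumulant_two]
  exact h2.sub (((h1 l).comp continuous_fst).mul ((h1 0).comp continuous_snd))

/-- A uniform bound of the spectrum, and of the mean modulus of the periodogram. -/
noncomputable def specBound (μ : Measure Ω) (Z : ℤ → Ω → ℝ) : ℝ := ∑' l, covBound μ Z l

theorem specBound_nonneg : 0 ≤ specBound μ Z := tsum_nonneg fun l => covBound_nonneg l

/-- The Weierstrass test with the summable majorant `covBound` gives continuity on the whole space.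
-/
theorem continuous_spectrum2 [IsProbabilityMeasure μ] (hstat : StrictlyStationary μ Z)
    (hZ : ∀ t, Measurable (Z t)) (h : CumulantSummable μ Z q) :
    Continuous fun p : ℝ × ℝ × ℝ => spectrum2 μ Z p.1 p.2.1 p.2.2 := by
  unfold spectrum2
  refine continuous_const.mul (continuous_tsum (fun l => ?_) h.summable_covBound fun l p => ?_)
  · refine ((continuous_expCov hZ l).comp continuous_snd).mul ?_
    fun_prop
  · rw [norm_mul, norm_exp_neg_I_mul_int_mul_real, mul_one]
    exact norm_expCov_le hstat hZ h l _ _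

theorem norm_spectrum2_le (hstat : StrictlyStationary μ Z)
    (hZ : ∀ t, Measurable (Z t)) (h : CumulantSummable μ Z q) (lam u v : ℝ) :
    ‖spectrum2 μ Z lam u v‖ ≤ specBound μ Z := by
  unfold spectrum2
  rw [norm_mul]
  have h2 : ‖∑' l : ℤ, expCov μ Z l u v * Complex.exp (-(Complex.I * (l : ℂ) * (lam : ℂ)))‖ ≤
      specBound μ Z := by
    refine tsum_of_norm_bounded h.summable_covBound.hasSum fun l => ?_
    rw [norm_mul, norm_exp_neg_I_mul_int_mul_real, mul_one]
    exact norm_expCov_le hstat hZ h l _ _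
  calc _ ≤ 1 * specBound μ Z :=
        mul_le_mul norm_one_div_two_pi_le h2 (norm_nonneg _) zero_le_one
    _ = _ := one_mul _

/-! ### The periodogram -/

theorem measurable_dft (hZ : ∀ t, Measurable (Z t)) (n : ℕ) (lam u : ℝ) :
    Measurable (dft Z n lam u) :=
  Finset.measurable_fun_sum _ fun t _ => (measurable_expProc hZ t u).mul_const _

theorem measurable_periodogram (hZ : ∀ t, Measurable (Z t)) (n : ℕ) (lam u v : ℝ) :
    Measurable (periodogram Z n lam u v) :=
  ((measurable_dft hZ n lam u).const_mul _).mul (measurable_dft hZ n (-lam) v)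

/-- At a non-zero Fourier frequency the mean of `dft` vanishes, so its second moment is a variance:
a double sum of covariances in which each of the `n` rows meets every lag at most once. -/
theorem integral_norm_dft_sq_le [IsProbabilityMeasure μ] (hstat : StrictlyStationary μ Z)
    (hZ : ∀ t, Measurable (Z t)) (h : CumulantSummable μ Z q) {n j : ℕ}
    (hj : j ∈ Finset.Icc 1 (n - 1)) (e : ℤ) (he : e = 1 ∨ e = -1) (u : ℝ) :
    ∫ ω, ‖dft Z n (e * (2 * Real.pi * j / n)) u ω‖ ^ 2 ∂μ ≤ n * specBound μ Z := by
  set x : ℝ := e * (2 * Real.pi * j / n) with hx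
  have hexp : ∀ t : ℕ, ‖Complex.exp (-(Complex.I * (t : ℂ) * (x : ℂ)))‖ = 1 := by
    intro t
    simpa using norm_exp_neg_I_mul_int_mul_real t x
  have key := integral_norm_sum_sub_sq_le (μ := μ)
    (W := fun t ω => expProc Z t u ω * Complex.exp (-(Complex.I * (t : ℂ) * (x : ℂ))))
    (fun t => (measurable_expProc hZ t u).mul_const _)
    (fun t ω => by rw [norm_mul, norm_expProc, hexp, one_mul]) (r := covBound μ Z) (by
      intro s t
      simp only [map_mul, conj_expProc]
      have e1 : ∀ ω, expProc Z s u ω * Complex.exp (-(Complex.I * (s : ℂ) * (x : ℂ))) *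
          (expProc Z t (-u) ω * (starRingEnd ℂ) (Complex.exp (-(Complex.I * (t : ℂ) * (x : ℂ))))) =
          expProc Z s u ω * expProc Z t (-u) ω * (Complex.exp (-(Complex.I * (s : ℂ) * (x : ℂ))) *
          (starRingEnd ℂ) (Complex.exp (-(Complex.I * (t : ℂ) * (x : ℂ))))) := fun ω => by ring
      simp_rw [e1]
      rw [integral_mul_const, integral_mul_const, integral_mul_const]
      have e2 : ∀ a b c y z : ℂ, a * (y * z) - b * y * (c * z) = (a - b * c) * (y * z) := by
        intros; ring
      rw [e2, norm_mul, norm_mul, RCLike.norm_conj, hexp, hexp, mul_one, mul_one]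
      exact norm_cov_expProc_le hstat hZ h s t u (-u)) (Finset.Icc 1 n)
  have hmean : ∑ t ∈ Finset.Icc 1 n, ∫ ω', expProc Z t u ω' *
      Complex.exp (-(Complex.I * (t : ℂ) * (x : ℂ))) ∂μ = 0 := by
    simp_rw [integral_mul_const, hstat.integral_expProc hZ]
    rw [← Finset.mul_sum, hx, sum_Icc_exp_fourier_eq_zero hj e he, mul_zero]
  have hd : ∀ ω, dft Z n x u ω = ∑ t ∈ Finset.Icc 1 n, (expProc Z t u ω *
      Complex.exp (-(Complex.I * (t : ℂ) * (x : ℂ))) - ∫ ω', expProc Z t u ω' *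
      Complex.exp (-(Complex.I * (t : ℂ) * (x : ℂ))) ∂μ) := by
    intro ω
    rw [Finset.sum_sub_distrib, hmean, sub_zero, dft_eq]
  simp_rw [hd]
  refine key.trans ?_
  have hrow : ∀ s ∈ Finset.Icc 1 n, ∑ t ∈ Finset.Icc 1 n, covBound μ Z ((s : ℤ) - t) ≤
      specBound μ Z := by
    intro s _
    have hinj : Set.InjOn (fun t : ℕ => (s : ℤ) - t) (Finset.Icc 1 n) := by
      intro a _ b _ hab
      simp only at hab
      omega
    rw [← Finset.sum_image (f := covBound μ Z) hinj]
    exact h.summable_covBound.sum_le_tsum _ fun k _ => covBound_nonneg k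
  refine (Finset.sum_le_sum hrow).trans ?_
  simp

/-- By `2ab ≤ a² + b²` this follows from the second moments of the two transforms. A bounded first
moment replaces the pointwise convergence that the periodogram lacks. -/
theorem integral_norm_periodogram_le [IsProbabilityMeasure μ] (hstat : StrictlyStationary μ Z)
    (hZ : ∀ t, Measurable (Z t)) (h : CumulantSummable μ Z q) {n j : ℕ}
    (hj : j ∈ Finset.Icc 1 (n - 1)) (u v : ℝ) :
    ∫ ω, ‖periodogram Z n (2 * Real.pi * j / n) u v ω‖ ∂μ ≤ specBound μ Z := by
  have hn : (0 : ℝ) < n := by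
    rw [Finset.mem_Icc] at hj
    exact_mod_cast (by omega : 0 < n)
  set x : ℝ := 2 * Real.pi * j / n with hx
  have h1 := integral_norm_dft_sq_le hstat hZ h hj 1 (Or.inl rfl) u
  have h2 := integral_norm_dft_sq_le hstat hZ h hj (-1) (Or.inr rfl) v
  simp only [Int.cast_one, one_mul, Int.cast_neg, neg_mul, ← hx] at h1 h2
  have hint : ∀ y w, Integrable (fun ω => ‖dft Z n y w ω‖ ^ 2) μ := by
    intro y w
    refine Integrable.of_bound ((measurable_dft hZ n y w).norm.pow_const 2).aestronglyMeasurable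
      ((n : ℝ) ^ 2) (ae_of_all _ fun ω => ?_)
    rw [Real.norm_of_nonneg (by positivity)]
    exact pow_le_pow_left₀ (norm_nonneg _) (norm_dft_le n y w ω) 2
  have hle : ∀ ω, ‖periodogram Z n x u v ω‖ ≤
      (n : ℝ)⁻¹ * (2⁻¹ * (‖dft Z n x u ω‖ ^ 2 + ‖dft Z n (-x) v ω‖ ^ 2)) := by
    intro ω
    refine (norm_periodogram_le n x u v ω).trans (mul_le_mul_of_nonneg_left ?_ (by positivity))
    nlinarith [sq_nonneg (‖dft Z n x u ω‖ - ‖dft Z n (-x) v ω‖)]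
  calc _ ≤ ∫ ω, (n : ℝ)⁻¹ * (2⁻¹ * (‖dft Z n x u ω‖ ^ 2 + ‖dft Z n (-x) v ω‖ ^ 2)) ∂μ := by
        refine integral_mono_of_nonneg (ae_of_all _ fun ω => norm_nonneg _) ?_ (ae_of_all _ hle)
        exact (((hint _ _).add (hint _ _)).const_mul _).const_mul _
    _ = (n : ℝ)⁻¹ * (2⁻¹ * (∫ ω, ‖dft Z n x u ω‖ ^ 2 ∂μ + ∫ ω, ‖dft Z n (-x) v ω‖ ^ 2 ∂μ)) := by
        rw [integral_const_mul, integral_const_mul, integral_add (hint _ _) (hint _ _)]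
    _ ≤ (n : ℝ)⁻¹ * (2⁻¹ * (n * specBound μ Z + n * specBound μ Z)) := by gcongr
    _ = specBound μ Z := by field_simp; ring

end GenSpectrum

namespace GenSpectrum

/-! ### Weighted averages of the periodogram over the Fourier frequencies -/

theorem sum_range_eq_add_sum_Icc {M : Type*} [AddCommMonoid M] {n : ℕ} (hn : 1 ≤ n) (g : ℕ → M) :
    ∑ j ∈ Finset.range n, g j = g 0 + ∑ j ∈ Finset.Icc 1 (n - 1), g j := by
  obtain ⟨m, rfl⟩ : ∃ m, n = m + 1 := ⟨n - 1, by omega⟩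
  have : Finset.range (m + 1) = insert 0 (Finset.Icc 1 m) := by
    ext j
    simp only [Finset.mem_range, Finset.mem_insert, Finset.mem_Icc]
    omega
  rw [this, Finset.sum_insert (by simp), Nat.add_sub_cancel]

variable {Ω : Type*} {Z : ℤ → Ω → ℝ}

theorem norm_average_expProc_le {n : ℕ} (hn : 1 ≤ n) (u : ℝ) (ω : Ω) :
    ‖(n : ℂ)⁻¹ * ∑ t ∈ Finset.Icc 1 n, expProc Z t u ω‖ ≤ 1 := by
  have hnpos : (0 : ℝ) < n := by exact_mod_cast hn
  rw [norm_mul, norm_inv, Complex.norm_natCast, inv_mul_le_iff₀ hnpos]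
  refine (norm_sum_le_of_le _ (n := fun _ => 1) fun t _ => (norm_expProc Z _ u ω).le).trans ?_
  simp

/-- Over all `n` Fourier frequencies, zero included, orthogonality retains only the pairs `s ≡ t +
h` modulo `n`. What remains is the circular empirical moment at lag `h`. -/
theorem sum_range_periodogram_mul_exp {n : ℕ} (hn : 1 ≤ n) (h : ℤ) (u v : ℝ) (ω : Ω) :
    ∑ j ∈ Finset.range n, periodogram Z n (2 * Real.pi * j / n) u v ω *
        Complex.exp (Complex.I * (h : ℂ) * ((2 * Real.pi * j / n : ℝ) : ℂ)) =
      (1 / (2 * (Real.pi : ℂ))) * ∑ t ∈ Finset.Icc 1 n,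
        (∑ s ∈ Finset.Icc 1 n, if (n : ℤ) ∣ s - t - h then expProc Z s u ω else 0) *
          expProc Z t v ω := by
  have hn0 : (n : ℂ) ≠ 0 := by exact_mod_cast (by omega : n ≠ 0)
  have hterm : ∀ j : ℕ, periodogram Z n (2 * Real.pi * j / n) u v ω *
        Complex.exp (Complex.I * (h : ℂ) * ((2 * Real.pi * j / n : ℝ) : ℂ)) =
      ∑ t ∈ Finset.Icc 1 n, ∑ s ∈ Finset.Icc 1 n, (1 / (2 * (Real.pi : ℂ) * n)) *
        (expProc Z s u ω * expProc Z t v ω) * Complex.exp (-(Complex.I * ((s - t - h : ℤ) : ℂ) *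
          ((2 * Real.pi * j / n : ℝ) : ℂ))) := by
    intro j
    unfold periodogram
    rw [mul_assoc (1 / _), dft_eq, dft_eq, Finset.sum_mul_sum, Finset.mul_sum, Finset.sum_mul,
      Finset.sum_comm]
    refine Finset.sum_congr rfl fun s _ => ?_
    rw [Finset.mul_sum, Finset.sum_mul]
    refine Finset.sum_congr rfl fun t _ => ?_
    have : Complex.exp (-(Complex.I * ((s - t - h : ℤ) : ℂ) * ((2 * Real.pi * j / n : ℝ) : ℂ))) =
        Complex.exp (-(Complex.I * (s : ℂ) * ((2 * Real.pi * j / n : ℝ) : ℂ))) *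
        Complex.exp (-(Complex.I * (t : ℂ) * ((-(2 * Real.pi * j / n) : ℝ) : ℂ))) *
        Complex.exp (Complex.I * (h : ℂ) * ((2 * Real.pi * j / n : ℝ) : ℂ)) := by
      rw [← Complex.exp_add, ← Complex.exp_add]
      congr 1
      push_cast
      ring
    rw [this]
    ring
  simp_rw [hterm]
  rw [Finset.sum_comm, Finset.mul_sum]
  refine Finset.sum_congr rfl fun t _ => ?_
  rw [Finset.sum_comm, Finset.sum_mul, Finset.mul_sum]
  refine Finset.sum_congr rfl fun s _ => ?_
  rw [← Finset.mul_sum, sum_range_exp_fourier hn]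
  split_ifs with hd
  · field_simp
  · simp

variable [MeasurableSpace Ω] {μ : Measure Ω} {q : ℕ}

/-- Sampling the spectrum at `n` points folds together the covariances at all lags congruent to `h`
modulo `n`. -/
theorem sum_range_spectrum2_mul_exp (hstat : StrictlyStationary μ Z) (hZ : ∀ t, Measurable (Z t))
    (hsum : CumulantSummable μ Z q) {n : ℕ} (hn : 1 ≤ n) (h : ℤ) (u v : ℝ) :
    (n : ℂ)⁻¹ * ∑ j ∈ Finset.range n, spectrum2 μ Z (2 * Real.pi * j / n) u v *
        Complex.exp (Complex.I * (h : ℂ) * ((2 * Real.pi * j / n : ℝ) : ℂ)) =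
      (1 / (2 * (Real.pi : ℂ))) * ∑' l : ℤ, if (n : ℤ) ∣ l - h then expCov μ Z l u v else 0 := by
  have hn0 : (n : ℂ) ≠ 0 := by exact_mod_cast (by omega : n ≠ 0)
  have hs : ∀ x : ℝ, Summable fun l : ℤ =>
      expCov μ Z l u v * Complex.exp (-(Complex.I * (l : ℂ) * (x : ℂ))) := by
    intro x
    refine hsum.summable_covBound.of_norm_bounded fun l => ?_
    rw [norm_mul, norm_exp_neg_I_mul_int_mul_real, mul_one]
    exact norm_expCov_le hstat hZ hsum l _ _
  have hterm : ∀ j : ℕ, spectrum2 μ Z (2 * Real.pi * j / n) u v *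
        Complex.exp (Complex.I * (h : ℂ) * ((2 * Real.pi * j / n : ℝ) : ℂ)) =
      (1 / (2 * (Real.pi : ℂ))) * ∑' l : ℤ, expCov μ Z l u v *
        Complex.exp (-(Complex.I * ((l - h : ℤ) : ℂ) * ((2 * Real.pi * j / n : ℝ) : ℂ))) := by
    intro j
    unfold spectrum2
    rw [mul_assoc, ← tsum_mul_right]
    congr 2
    funext l
    rw [mul_assoc, ← Complex.exp_add]
    congr 2
    push_cast
    ring
  have hs' : ∀ j : ℕ, Summable fun l : ℤ => expCov μ Z l u v *
        Complex.exp (-(Complex.I * ((l - h : ℤ) : ℂ) * ((2 * Real.pi * j / n : ℝ) : ℂ))) := by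
    intro j
    refine hsum.summable_covBound.of_norm_bounded fun l => ?_
    rw [norm_mul, norm_exp_neg_I_mul_int_mul_real, mul_one]
    exact norm_expCov_le hstat hZ hsum l _ _
  simp_rw [hterm]
  rw [← Finset.mul_sum, ← Summable.tsum_finsetSum fun j _ => hs' j, mul_left_comm, ← tsum_mul_left]
  congr 2
  funext l
  rw [← Finset.mul_sum, sum_range_exp_fourier hn]
  split_ifs with hd
  · field_simp
  · simp

/-- The mass of the covariances at the aliases of lag `h`. -/
noncomputable def aliasBound (μ : Measure Ω) (Z : ℤ → Ω → ℝ) (h : ℤ) (n : ℕ) : ℝ :=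
  ∑' l : ℤ, if l ≠ h ∧ (n : ℤ) ∣ l - h then covBound μ Z l else 0

theorem tendsto_aliasBound (hsum : CumulantSummable μ Z q) (h : ℤ) :
    Tendsto (aliasBound μ Z h) atTop (𝓝 0) := by
  have := tendsto_tsum_of_dominated_convergence (𝓕 := atTop)
    (f := fun (n : ℕ) (l : ℤ) => if l ≠ h ∧ (n : ℤ) ∣ l - h then covBound μ Z l else 0)
    (g := fun _ => (0 : ℝ)) (bound := covBound μ Z) hsum.summable_covBound ?_ ?_
  · rw [tsum_zero] at this
    exact this
  · intro l
    refine tendsto_const_nhds.congr' ?_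
    -- Once `n > |l - h|`, the number `n` divides `l - h` only for `l = h`, so each fixed term is
    -- eventually zero.
    filter_upwards [eventually_gt_atTop (l - h).natAbs] with n hn
    rw [if_neg]
    rintro ⟨h1, h2⟩
    have := Int.natAbs_dvd_natAbs.2 h2
    have := Nat.le_of_dvd (by omega) this
    simp at this
    omega
  · refine Eventually.of_forall fun n l => ?_
    split_ifs
    · rw [Real.norm_of_nonneg (covBound_nonneg l)]
    · simpa using covBound_nonneg l

theorem norm_tsum_alias_sub_le (hstat : StrictlyStationary μ Z) (hZ : ∀ t, Measurable (Z t))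
    (hsum : CumulantSummable μ Z q) (n : ℕ) (h : ℤ) (u v : ℝ) :
    ‖(∑' l : ℤ, if (n : ℤ) ∣ l - h then expCov μ Z l u v else 0) - expCov μ Z h u v‖ ≤
      aliasBound μ Z h n := by
  have hs : Summable fun l : ℤ => if (n : ℤ) ∣ l - h then expCov μ Z l u v else 0 := by
    refine hsum.summable_covBound.of_norm_bounded fun l => ?_
    split_ifs
    · exact norm_expCov_le hstat hZ hsum l _ _
    · simpa using covBound_nonneg l
  have hs2 : Summable fun l : ℤ => if l ≠ h ∧ (n : ℤ) ∣ l - h then covBound μ Z l else 0 := by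
    refine hsum.summable_covBound.of_norm_bounded fun l => ?_
    split_ifs
    · rw [Real.norm_of_nonneg (covBound_nonneg l)]
    · simpa using covBound_nonneg l
  rw [hs.tsum_eq_add_tsum_ite h]
  simp only [sub_self, dvd_zero, if_true, add_sub_cancel_left]
  refine tsum_of_norm_bounded hs2.hasSum fun l => ?_
  by_cases hl : l = h
  · simp [hl]
  · by_cases hd : (n : ℤ) ∣ l - h
    · simpa [hl, hd] using norm_expCov_le hstat hZ hsum l u v
    · simp [hl, hd]

theorem expCov_eq (hstat : StrictlyStationary μ Z) (hZ : ∀ t, Measurable (Z t)) (h : ℤ) (u v : ℝ) :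
    expCov μ Z h u v = ∫ ω, expProc Z h u ω * expProc Z 0 v ω ∂μ -
      (∫ ω, expProc Z 0 u ω ∂μ) * ∫ ω, expProc Z 0 v ω ∂μ := by
  rw [expCov_eq_cumulant, cumulant_two]
  simp [hstat.integral_expProc hZ h u]

/-- The sum over non-zero frequencies is the full sum minus the term `j = 0`. For `I_n` that term is
the product of the two empirical means, which is what turns the raw lag-`h` moment into a
covariance. The errors are, in order: wrap-around, the fluctuation of the lag-`h` moment, the
fluctuations of the two means, aliasing, and the term of `f` at frequency zero. -/
theorem norm_weighted_periodogram_sub_le [IsProbabilityMeasure μ] (hstat : StrictlyStationary μ Z)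
    (hZ : ∀ t, Measurable (Z t)) (hsum : CumulantSummable μ Z q) {n : ℕ} (hn : 1 ≤ n) (h : ℤ)
    (u v : ℝ) (ω : Ω) :
    ‖(n : ℂ)⁻¹ * ∑ j ∈ Finset.Icc 1 (n - 1),
        (periodogram Z n (2 * Real.pi * j / n) u v ω - spectrum2 μ Z (2 * Real.pi * j / n) u v) *
          Complex.exp (Complex.I * (h : ℂ) * ((2 * Real.pi * j / n : ℝ) : ℂ))‖ ≤
      2 * (h.natAbs : ℝ) / n +
      ‖(n : ℂ)⁻¹ * ∑ t ∈ Finset.Icc 1 n, expProc Z (t + h) u ω * expProc Z t v ω -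
        ∫ ω', expProc Z h u ω' * expProc Z 0 v ω' ∂μ‖ +
      (‖(n : ℂ)⁻¹ * ∑ t ∈ Finset.Icc 1 n, expProc Z t u ω - ∫ ω', expProc Z 0 u ω' ∂μ‖ +
        ‖(n : ℂ)⁻¹ * ∑ t ∈ Finset.Icc 1 n, expProc Z t v ω - ∫ ω', expProc Z 0 v ω' ∂μ‖) +
      aliasBound μ Z h n + specBound μ Z / n := by
  have hn0 : (n : ℂ) ≠ 0 := by exact_mod_cast (by omega : n ≠ 0)
  have hnpos : (0 : ℝ) < n := by exact_mod_cast hn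
  have hpi : (Real.pi : ℂ) ≠ 0 := by exact_mod_cast Real.pi_ne_zero
  set κ : ℂ := 1 / (2 * (Real.pi : ℂ)) with hκ
  set G : ℂ := ∑ t ∈ Finset.Icc 1 n,
        (∑ s ∈ Finset.Icc 1 n, if (n : ℤ) ∣ s - t - h then expProc Z s u ω else 0) *
          expProc Z t v ω with hG
  set H : ℂ := ∑ t ∈ Finset.Icc 1 n, expProc Z (t + h) u ω * expProc Z t v ω with hH
  set a : ℂ := (n : ℂ)⁻¹ * ∑ t ∈ Finset.Icc 1 n, expProc Z t u ω with ha
  set b : ℂ := (n : ℂ)⁻¹ * ∑ t ∈ Finset.Icc 1 n, expProc Z t v ω with hb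
  set m : ℂ := ∫ ω', expProc Z h u ω' * expProc Z 0 v ω' ∂μ with hm
  set mu : ℂ := ∫ ω', expProc Z 0 u ω' ∂μ with hmu
  set mv : ℂ := ∫ ω', expProc Z 0 v ω' ∂μ with hmv
  set T : ℂ := ∑' l : ℤ, if (n : ℤ) ∣ l - h then expCov μ Z l u v else 0 with hT
  have hI := sum_range_periodogram_mul_exp (Z := Z) hn h u v ω
  rw [sum_range_eq_add_sum_Icc hn] at hI
  have hf := sum_range_spectrum2_mul_exp hstat hZ hsum hn h u v
  rw [sum_range_eq_add_sum_Icc hn] at hf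
  have hzero : (2 * Real.pi * ((0 : ℕ) : ℝ) / n : ℝ) = 0 := by simp
  rw [hzero] at hI hf
  simp only [Complex.ofReal_zero, mul_zero, Complex.exp_zero, mul_one] at hI hf
  have hI0 : (n : ℂ)⁻¹ * periodogram Z n 0 u v ω = κ * (a * b) := by
    unfold periodogram
    rw [dft_eq, dft_eq, ha, hb, hκ]
    simp only [neg_zero, Complex.ofReal_zero, mul_zero, Complex.exp_zero, mul_one]
    field_simp
  have hc := expCov_eq hstat hZ h u v
  rw [← hm, ← hmu, ← hmv] at hc
  have hmain : (n : ℂ)⁻¹ * ∑ j ∈ Finset.Icc 1 (n - 1),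
        (periodogram Z n (2 * Real.pi * j / n) u v ω - spectrum2 μ Z (2 * Real.pi * j / n) u v) *
          Complex.exp (Complex.I * (h : ℂ) * ((2 * Real.pi * j / n : ℝ) : ℂ)) =
      κ * (((n : ℂ)⁻¹ * (G - H) + ((n : ℂ)⁻¹ * H - m)) - (a * b - mu * mv) -
        (T - expCov μ Z h u v)) + (n : ℂ)⁻¹ * spectrum2 μ Z 0 u v := by
    simp_rw [sub_mul]
    rw [Finset.sum_sub_distrib, hc]
    linear_combination (n : ℂ)⁻¹ * hI - hf - hI0
  have hGH : ‖(n : ℂ)⁻¹ * (G - H)‖ ≤ 2 * (h.natAbs : ℝ) / n := by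
    rw [norm_mul, norm_inv, Complex.norm_natCast, div_eq_inv_mul]
    refine mul_le_mul_of_nonneg_left ?_ (by positivity)
    rw [hG, hH, ← Finset.sum_sub_distrib]
    refine (norm_sum_le_of_le _ fun t _ => ?_).trans (sum_Icc_shift_outside_le n h)
    rw [← sub_mul, norm_mul, norm_expProc, mul_one]
    exact norm_sum_dvd_sub_le hn h t (x := fun s => expProc Z s u ω)
      fun s => (norm_expProc Z s u ω).le
  have hab : ‖a * b - mu * mv‖ ≤ ‖a - mu‖ + ‖b - mv‖ := by
    have e : a * b - mu * mv = (a - mu) * b + mu * (b - mv) := by ring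
    have hb1 : ‖b‖ ≤ 1 := norm_average_expProc_le hn v ω
    have hmu1 : ‖mu‖ ≤ 1 := norm_integral_le_one fun ω => (norm_expProc Z 0 u ω).le
    rw [e]
    refine norm_add_le_of_le ?_ ?_
    · rw [norm_mul]; exact mul_le_of_le_one_right (norm_nonneg _) hb1
    · rw [norm_mul]; exact mul_le_of_le_one_left (norm_nonneg _) hmu1
  have hal := norm_tsum_alias_sub_le hstat hZ hsum n h u v
  have hsp : ‖(n : ℂ)⁻¹ * spectrum2 μ Z 0 u v‖ ≤ specBound μ Z / n := by
    rw [norm_mul, norm_inv, Complex.norm_natCast, div_eq_inv_mul]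
    exact mul_le_mul_of_nonneg_left (norm_spectrum2_le hstat hZ hsum _ _ _) (by positivity)
  rw [hmain]
  refine norm_add_le_of_le ?_ hsp
  rw [norm_mul]
  refine (mul_le_of_le_one_left (norm_nonneg _) norm_one_div_two_pi_le).trans ?_
  exact norm_sub_le_of_le (norm_sub_le_of_le (norm_add_le_of_le hGH le_rfl) hab) hal

/-- Averages of `I_n - f` over the Fourier frequencies, weighted by `e^{ihλ}`, converge to zero in
mean, uniformly in `u` and `v`. -/
theorem exists_rate_weighted_periodogram [IsProbabilityMeasure μ] (hstat : StrictlyStationary μ Z)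
    (hZ : ∀ t, Measurable (Z t)) (hsum : CumulantSummable μ Z q) (h : ℤ) :
    ∃ ρ : ℕ → ℝ, Tendsto ρ atTop (𝓝 0) ∧ ∀ n : ℕ, 1 ≤ n → ∀ u v : ℝ,
      ∫ ω, ‖(n : ℂ)⁻¹ * ∑ j ∈ Finset.Icc 1 (n - 1),
        (periodogram Z n (2 * Real.pi * j / n) u v ω - spectrum2 μ Z (2 * Real.pi * j / n) u v) *
          Complex.exp (Complex.I * (h : ℂ) * ((2 * Real.pi * j / n : ℝ) : ℂ))‖ ∂μ ≤ ρ n := by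
  obtain ⟨ρ₁, hρ₁, h₁⟩ := exists_rate_average_expProc_mul hstat hZ hsum h
  obtain ⟨ρ₂, hρ₂, h₂⟩ := exists_rate_average_expProc hstat hZ hsum
  refine ⟨fun n => 2 * (h.natAbs : ℝ) / n + ρ₁ n + (ρ₂ n + ρ₂ n) + aliasBound μ Z h n +
    specBound μ Z / n, ?_, ?_⟩
  · have hc := fun c : ℝ => tendsto_const_div_atTop_nhds_zero_nat c
    simpa using ((((hc _).add hρ₁).add (hρ₂.add hρ₂)).add (tendsto_aliasBound hsum h)).add (hc _)
  intro n hn u v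
  have hbd : ∀ (g : Ω → ℂ) (c : ℂ), Measurable g → (∀ ω, ‖g ω‖ ≤ 1) →
      Integrable (fun ω => ‖g ω - c‖) μ := fun g c hg hb =>
    ((integrable_of_norm_le hg hb).sub (integrable_const c)).norm
  have i1 : Integrable (fun ω => ‖(n : ℂ)⁻¹ * ∑ t ∈ Finset.Icc 1 n,
      expProc Z (t + h) u ω * expProc Z t v ω -
        ∫ ω', expProc Z h u ω' * expProc Z 0 v ω' ∂μ‖) μ := by
    refine hbd _ _ ((Finset.measurable_fun_sum _ fun t _ => (measurable_expProc hZ _ _).mul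
      (measurable_expProc hZ _ _)).const_mul _) fun ω => ?_
    have hnpos : (0 : ℝ) < n := by exact_mod_cast hn
    rw [norm_mul, norm_inv, Complex.norm_natCast, inv_mul_le_iff₀ hnpos]
    refine (norm_sum_le_of_le _ (n := fun _ => 1) fun t _ => ?_).trans (by simp)
    simp [norm_expProc]
  have i2 : ∀ w, Integrable (fun ω => ‖(n : ℂ)⁻¹ * ∑ t ∈ Finset.Icc 1 n, expProc Z t w ω -
      ∫ ω', expProc Z 0 w ω' ∂μ‖) μ := fun w =>
    hbd _ _ ((Finset.measurable_fun_sum _ fun t _ => measurable_expProc hZ _ _).const_mul _)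
      (norm_average_expProc_le hn w)
  have i3 := fun c : ℝ => integrable_const (μ := μ) c
  refine (integral_mono_of_nonneg (ae_of_all _ fun ω => norm_nonneg _)
    (((((i3 _).add i1).add ((i2 u).add (i2 v))).add (i3 _)).add (i3 _))
    (ae_of_all _ (norm_weighted_periodogram_sub_le hstat hZ hsum hn h u v))).trans ?_
  simp only [Pi.add_apply]
  have j1 := (i3 (2 * (h.natAbs : ℝ) / n)).add i1
  have i5 := (i2 u).add (i2 v)
  have j2 := j1.add i5
  have j3 := j2.add (i3 (aliasBound μ Z h n))
  simp only [Pi.add_def] at i5 j1 j2 j3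
  rw [integral_add j3 (i3 _), integral_add j2 (i3 _), integral_add j1 i5,
    integral_add (i3 _) i1]
  have i4 : ∫ ω, (‖(n : ℂ)⁻¹ * ∑ t ∈ Finset.Icc 1 n, expProc Z t u ω -
      ∫ ω', expProc Z 0 u ω' ∂μ‖ + ‖(n : ℂ)⁻¹ * ∑ t ∈ Finset.Icc 1 n, expProc Z t v ω -
      ∫ ω', expProc Z 0 v ω' ∂μ‖) ∂μ ≤ ρ₂ n + ρ₂ n := by
    rw [integral_add (i2 u) (i2 v)]
    exact add_le_add (h₂ n hn u) (h₂ n hn v)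
  simp only [integral_const, probReal_univ, one_smul]
  have := h₁ n hn u v
  gcongr

end GenSpectrum

namespace GenSpectrum

/-! ### Integrals of step functions -/

/-- The index of the right end point of the cell of `x` in the partition of `(a, a + w]` into `N`
intervals of equal length. -/
noncomputable def cellIndex (a w : ℝ) (N : ℕ) (x : ℝ) : ℕ := ⌈(x - a) * N / w⌉₊

theorem measurable_cellIndex (a w : ℝ) (N : ℕ) : Measurable (cellIndex a w N) := by
  unfold cellIndex
  exact Nat.measurable_ceil.comp (by fun_prop)

theorem cellIndex_eq_iff {a w : ℝ} (hw : 0 < w) {N i : ℕ} (hN : 1 ≤ N) (hi : 1 ≤ i) (x : ℝ) :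
    cellIndex a w N x = i ↔ x ∈ Ioc (a + w * (i - 1 : ℕ) / N) (a + w * i / N) := by
  have hN' : (0 : ℝ) < N := by exact_mod_cast hN
  rw [cellIndex, Nat.ceil_eq_iff (by omega), mem_Ioc, lt_div_iff₀ hw, div_le_iff₀ hw,
    ← lt_sub_iff_add_lt', ← sub_le_iff_le_add', div_lt_iff₀ hN', le_div_iff₀ hN', mul_comm w,
    mul_comm w]

theorem cellIndex_mem {a w : ℝ} (hw : 0 < w) {N : ℕ} (hN : 1 ≤ N) {x : ℝ}
    (hx : x ∈ Ioc a (a + w)) : cellIndex a w N x ∈ Finset.Icc 1 N := by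
  have hN' : (0 : ℝ) < N := by exact_mod_cast hN
  rw [Finset.mem_Icc]
  constructor
  · rw [cellIndex, Nat.one_le_ceil_iff]
    exact div_pos (mul_pos (sub_pos.2 hx.1) hN') hw
  · rw [cellIndex, Nat.ceil_le, div_le_iff₀ hw, mul_comm]
    exact mul_le_mul_of_nonneg_left (by linarith [hx.2]) hN'.le

theorem abs_cell_sub_le {a w : ℝ} (hw : 0 < w) {N : ℕ} (hN : 1 ≤ N) {x : ℝ}
    (hx : x ∈ Ioc a (a + w)) : |a + w * cellIndex a w N x / N - x| ≤ w / N := by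
  have hN' : (0 : ℝ) < N := by exact_mod_cast hN
  have h1 := Finset.mem_Icc.1 (cellIndex_mem hw hN hx)
  have h2 := (cellIndex_eq_iff hw hN h1.1 x).1 rfl
  rw [Nat.cast_sub h1.1] at h2
  have h3 : a + w * ((cellIndex a w N x : ℝ) - (1 : ℕ)) / N =
      a + w * cellIndex a w N x / N - w / N := by
    push_cast; ring
  rw [h3] at h2
  rw [abs_le]
  constructor <;> linarith [h2.1, h2.2, div_pos hw hN']

theorem cell_mem_Icc {a w : ℝ} (hw : 0 ≤ w) {N i : ℕ} (hi : i ∈ Finset.Icc 1 N) :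
    a + w * i / N ∈ Icc a (a + w) := by
  rw [Finset.mem_Icc] at hi
  have hN' : (0 : ℝ) < N := by exact_mod_cast (by omega : 0 < N)
  have hiN : (i : ℝ) ≤ N := by exact_mod_cast hi.2
  refine ⟨le_add_of_nonneg_right (by positivity), add_le_add_right ?_ a⟩
  rw [div_le_iff₀ hN']
  exact mul_le_mul_of_nonneg_left hiN hw

/-- Grid sums become integrals of step functions, so that volume comparison and dominated
convergence apply to them. Cells closed on the right match grid indices running from `1` to `N`. -/
theorem setIntegral_cellIndex {a w : ℝ} (hw : 0 < w) {N : ℕ} (hN : 1 ≤ N) (G : ℕ → ℝ) :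
    ∫ x in Ioc a (a + w), G (cellIndex a w N x) = w / N * ∑ i ∈ Finset.Icc 1 N, G i := by
  have hN' : (0 : ℝ) < N := by exact_mod_cast hN
  set s : ℕ → Set ℝ := fun i => Ioc (a + w * (i - 1 : ℕ) / N) (a + w * i / N) with hs
  have hcov : Ioc a (a + w) = ⋃ i ∈ Finset.Icc 1 N, s i := by
    ext x
    simp only [mem_iUnion, exists_prop]
    constructor
    · intro hx
      have h1 := cellIndex_mem hw hN hx
      exact ⟨_, h1, (cellIndex_eq_iff hw hN (Finset.mem_Icc.1 h1).1 x).1 rfl⟩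
    · rintro ⟨i, hi, hx⟩
      refine ⟨lt_of_le_of_lt ?_ hx.1, hx.2.trans (cell_mem_Icc hw.le hi).2⟩
      exact le_add_of_nonneg_right (by positivity)
  have hconst : ∀ i ∈ Finset.Icc 1 N, ∀ x ∈ s i, G (cellIndex a w N x) = G i := by
    intro i hi x hx
    rw [(cellIndex_eq_iff hw hN (Finset.mem_Icc.1 hi).1 x).2 hx]
  have hdisj : (↑(Finset.Icc 1 N) : Set ℕ).Pairwise (Function.onFun Disjoint s) := by
    intro i hi j hj hij
    refine Set.disjoint_left.2 fun x hxi hxj => hij ?_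
    rw [← (cellIndex_eq_iff hw hN (Finset.mem_Icc.1 hi).1 x).2 hxi,
      ← (cellIndex_eq_iff hw hN (Finset.mem_Icc.1 hj).1 x).2 hxj]
  rw [hcov, integral_biUnion_finset _ (fun i _ => measurableSet_Ioc) hdisj, Finset.mul_sum]
  · refine Finset.sum_congr rfl fun i hi => ?_
    rw [setIntegral_congr_fun measurableSet_Ioc (hconst i hi), setIntegral_const, smul_eq_mul]
    congr 1
    rw [Real.volume_real_Ioc_of_le, Nat.cast_sub (Finset.mem_Icc.1 hi).1]
    · push_cast; ring
    · rw [Nat.cast_sub (Finset.mem_Icc.1 hi).1]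
      have : a + w * (i - (1 : ℕ)) / N = a + w * i / N - w / N := by push_cast; ring
      rw [this]
      linarith [div_pos hw hN']
  · intro i hi
    have : IntegrableOn (fun _ => G i) (s i) := integrableOn_const (by simp [hs])
    exact this.congr_fun (fun x hx => (hconst i hi x hx).symm) measurableSet_Ioc

theorem setIntegral_cellIndex_prod {a w : ℝ} (hw : 0 < w) {N : ℕ} (hN : 1 ≤ N) (G : ℕ → ℕ → ℝ)
    {C : ℝ} (hG : ∀ i j, ‖G i j‖ ≤ C) :
    ∫ p in Ioc a (a + w) ×ˢ Ioc a (a + w), G (cellIndex a w N p.1) (cellIndex a w N p.2) =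
      (w / N) ^ 2 * ∑ i ∈ Finset.Icc 1 N, ∑ j ∈ Finset.Icc 1 N, G i j := by
  have hm := measurable_cellIndex a w N
  have hmeas : Measurable fun p : ℝ × ℝ => G (cellIndex a w N p.1) (cellIndex a w N p.2) :=
    (Measurable.of_discrete (f := fun q : ℕ × ℕ => G q.1 q.2)).comp
      ((hm.comp measurable_fst).prodMk (hm.comp measurable_snd))
  have hint : IntegrableOn (fun p : ℝ × ℝ => G (cellIndex a w N p.1) (cellIndex a w N p.2))
      (Ioc a (a + w) ×ˢ Ioc a (a + w)) (volume.prod volume) :=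
    Measure.integrableOn_of_bounded (by
      rw [Measure.prod_prod]; exact ENNReal.mul_ne_top (by simp) (by simp))
      hmeas.aestronglyMeasurable (ae_of_all _ fun p => hG _ _)
  rw [Measure.volume_eq_prod, setIntegral_prod _ hint]
  simp only
  simp_rw [setIntegral_cellIndex hw hN]
  rw [setIntegral_cellIndex hw hN (fun i => w / N * ∑ j ∈ Finset.Icc 1 N, G i j), ← Finset.mul_sum]
  ring

theorem setIntegral_cellIndex_prod_prod {a w b z : ℝ} (hw : 0 < w) (hz : 0 < z) {N K : ℕ}
    (hN : 1 ≤ N) (hK : 1 ≤ K) (G : ℕ → ℕ → ℕ → ℝ) {C : ℝ} (hG : ∀ k i j, ‖G k i j‖ ≤ C) :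
    ∫ p in Ioc b (b + z) ×ˢ Ioc a (a + w) ×ˢ Ioc a (a + w),
      G (cellIndex b z K p.1) (cellIndex a w N p.2.1) (cellIndex a w N p.2.2) =
      z / K * (w / N) ^ 2 *
        ∑ k ∈ Finset.Icc 1 K, ∑ i ∈ Finset.Icc 1 N, ∑ j ∈ Finset.Icc 1 N, G k i j := by
  have hm := measurable_cellIndex a w N
  have hm' := measurable_cellIndex b z K
  have hmeas : Measurable fun p : ℝ × ℝ × ℝ =>
      G (cellIndex b z K p.1) (cellIndex a w N p.2.1) (cellIndex a w N p.2.2) :=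
    (Measurable.of_discrete (f := fun q : ℕ × ℕ × ℕ => G q.1 q.2.1 q.2.2)).comp
      ((hm'.comp measurable_fst).prodMk ((hm.comp (measurable_fst.comp measurable_snd)).prodMk
        (hm.comp (measurable_snd.comp measurable_snd))))
  have hint : IntegrableOn (fun p : ℝ × ℝ × ℝ =>
      G (cellIndex b z K p.1) (cellIndex a w N p.2.1) (cellIndex a w N p.2.2))
      (Ioc b (b + z) ×ˢ Ioc a (a + w) ×ˢ Ioc a (a + w)) (volume.prod volume) :=
    Measure.integrableOn_of_bounded (by
      rw [Measure.prod_prod, Measure.volume_eq_prod, Measure.prod_prod]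
      exact ENNReal.mul_ne_top (by simp) (ENNReal.mul_ne_top (by simp) (by simp)))
      hmeas.aestronglyMeasurable (ae_of_all _ fun p => hG _ _ _)
  refine (setIntegral_prod _ hint).trans ?_
  have hinner : ∀ x, ∫ y in Ioc a (a + w) ×ˢ Ioc a (a + w),
      G (cellIndex b z K x) (cellIndex a w N y.1) (cellIndex a w N y.2) =
      (w / N) ^ 2 * ∑ i ∈ Finset.Icc 1 N, ∑ j ∈ Finset.Icc 1 N, G (cellIndex b z K x) i j :=
    fun x => setIntegral_cellIndex_prod hw hN (G (cellIndex b z K x)) (hG _)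
  simp only [hinner]
  rw [setIntegral_cellIndex hz hK
    (fun k => (w / N) ^ 2 * ∑ i ∈ Finset.Icc 1 N, ∑ j ∈ Finset.Icc 1 N, G k i j), ← Finset.mul_sum]
  ring

/-! ### The Euclidean plane in coordinates -/

/-- The point of the Euclidean plane with coordinates `p`. -/
noncomputable def toPlane (p : ℝ × ℝ) : EuclideanSpace ℝ (Fin 2) := !₂[p.1, p.2]

@[simp] theorem toPlane_zero (p : ℝ × ℝ) : toPlane p 0 = p.1 := rfl

@[simp] theorem toPlane_one (p : ℝ × ℝ) : toPlane p 1 = p.2 := rfl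

theorem measurePreserving_toPlane : MeasurePreserving toPlane volume volume :=
  (PiLp.volume_preserving_toLp (Fin 2)).comp
    (volume_preserving_finTwoArrow ℝ).symm

theorem dist_toPlane_le (p p' : ℝ × ℝ) :
    dist (toPlane p) (toPlane p') ≤ |p.1 - p'.1| + |p.2 - p'.2| := by
  rw [EuclideanSpace.dist_eq, Fin.sum_univ_two, Real.sqrt_le_left (by positivity)]
  simp only [toPlane_zero, toPlane_one, Real.dist_eq]
  nlinarith [mul_nonneg (abs_nonneg (p.1 - p'.1)) (abs_nonneg (p.2 - p'.2))]

theorem continuous_toPlane : Continuous toPlane := by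
  unfold toPlane
  fun_prop

theorem toPlane_mem_square {L : ℝ} {p : ℝ × ℝ} (h1 : p.1 ∈ Icc (-L) L) (h2 : p.2 ∈ Icc (-L) L) :
    toPlane p ∈ square L := ⟨h1, h2⟩

end GenSpectrum

namespace GenSpectrum

/-! ### The singular set -/

theorem isCompact_square (L : ℝ) : IsCompact (square L) := by
  have h : square L = toPlane '' (Icc (-L) L ×ˢ Icc (-L) L) := by
    ext p
    constructor
    · intro hp
      refine ⟨(p 0, p 1), ⟨hp.1, hp.2⟩, ?_⟩
      ext i
      fin_cases i <;> rfl
    · rintro ⟨q, hq, rfl⟩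
      exact ⟨hq.1, hq.2⟩
  rw [h]
  exact (isCompact_Icc.prod isCompact_Icc).image continuous_toPlane

theorem isClosed_nbhd (L : ℝ) (S : Set (EuclideanSpace ℝ (Fin 2))) (ε : ℝ) :
    IsClosed (nbhd L S ε) :=
  (isCompact_square L).isClosed.inter Metric.isClosed_cthickening

theorem volume_nbhd_ne_top (L : ℝ) (S : Set (EuclideanSpace ℝ (Fin 2))) (ε : ℝ) :
    volume (nbhd L S ε) ≠ ∞ :=
  ((measure_mono inter_subset_left).trans_lt (isCompact_square L).measure_lt_top).ne

variable {L : ℝ} {S : Set (EuclideanSpace ℝ (Fin 2))}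

theorem IsSingularSet.tendsto_volume (hS : IsSingularSet L S) :
    Tendsto (fun ε => (volume (nbhd L S ε)).toReal) (𝓝[>] 0) (𝓝 0) :=
  hS.volume_isBigO.trans_tendsto (tendsto_nhdsWithin_of_tendsto_nhds tendsto_id)

theorem IsSingularSet.exists_volume_lt (hS : IsSingularSet L S) {η : ℝ} (hη : 0 < η) :
    ∃ ε > 0, (volume (nbhd L S ε)).toReal < η := by
  have h1 := hS.tendsto_volume.eventually (gt_mem_nhds hη)
  have h2 : ∀ᶠ ε : ℝ in 𝓝[>] 0, 0 < ε := self_mem_nhdsWithin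
  obtain ⟨ε, h, hε⟩ := (h1.and h2).exists
  exact ⟨ε, hε, h⟩

/-- `S` lies in each of its neighbourhoods, whose areas are arbitrarily small. -/
theorem IsSingularSet.volume_eq_zero (hS : IsSingularSet L S) : volume S = 0 := by
  have hle : ∀ ε, volume S ≤ volume (nbhd L S ε) := fun ε =>
    measure_mono fun p hp => ⟨hS.subset_square hp, Metric.self_subset_cthickening S hp⟩
  have hfin : volume S ≠ ∞ := ne_top_of_le_ne_top (volume_nbhd_ne_top L S 1) (hle 1)
  by_contra h0
  obtain ⟨ε, -, h⟩ := hS.exists_volume_lt (ENNReal.toReal_pos h0 hfin)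
  exact absurd h (not_lt.2 (ENNReal.toReal_mono (volume_nbhd_ne_top L S ε) (hle ε)))

theorem IsSingularSet.exists_notMem_nbhd (hS : IsSingularSet L S)
    {p : EuclideanSpace ℝ (Fin 2)} (hp : p ∉ S) : ∃ ε > 0, p ∉ nbhd L S ε := by
  have h : p ∉ ⋂ δ > 0, Metric.cthickening δ S := by
    rw [← Metric.closure_eq_iInter_cthickening, hS.isClosed.closure_eq]
    exact hp
  simp only [mem_iInter, not_forall] at h
  obtain ⟨ε, hε, h⟩ := h
  exact ⟨ε, hε, fun h' => h h'.2⟩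

theorem mem_nbhd_of_dist_le {p p' : EuclideanSpace ℝ (Fin 2)} {ε ε' : ℝ} (hε : 0 ≤ ε)
    (hε' : 0 ≤ ε') (hp : p ∈ square L) (hp' : p' ∈ nbhd L S ε) (hd : dist p p' ≤ ε') :
    p ∈ nbhd L S (ε' + ε) := by
  refine ⟨hp, Metric.cthickening_cthickening_subset hε' hε S ?_⟩
  exact Metric.mem_cthickening_of_dist_le p p' ε' _ hp'.2 hd

/-- The point `(u_{i₁}, v_{i₂})` of the grid. -/
noncomputable def gridPair (L : ℝ) (M i₁ i₂ : ℕ) : EuclideanSpace ℝ (Fin 2) :=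
  toPlane (gridPoint L M i₁, gridPoint L M i₂)

theorem gridPoint_mem (hL : 0 < L) {M i : ℕ} (hi : i ∈ Finset.Icc 1 M) :
    gridPoint L M i ∈ Icc (-L) L := by
  have := cell_mem_Icc (a := -L) (w := 2 * L) (by positivity) hi
  have e : -L + 2 * L = L := by ring
  rwa [e] at this

theorem gridPair_mem (hL : 0 < L) {M i₁ i₂ : ℕ} (hi₁ : i₁ ∈ Finset.Icc 1 M)
    (hi₂ : i₂ ∈ Finset.Icc 1 M) : gridPair L M i₁ i₂ ∈ square L :=
  toPlane_mem_square (gridPoint_mem hL hi₁) (gridPoint_mem hL hi₂)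

open Classical in
/-- The fraction of grid points in a small neighbourhood of the singular set is small. -/
theorem IsSingularSet.exists_grid_fraction_le (hS : IsSingularSet L S) (hL : 0 < L) {η : ℝ}
    (hη : 0 < η) : ∃ ε > 0, ∀ᶠ M : ℕ in atTop,
      ((M : ℝ) ^ 2)⁻¹ * ∑ i₁ ∈ Finset.Icc 1 M, ∑ i₂ ∈ Finset.Icc 1 M,
        (if gridPair L M i₁ i₂ ∈ nbhd L S ε then (1 : ℝ) else 0) ≤ η := by
  obtain ⟨ε₀, hε₀, hvol⟩ := hS.exists_volume_lt (η := η * (2 * L) ^ 2) (by positivity)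
  -- Half of `ε₀` pays for the distance from a point to the grid corner of its cell. If the corner
  -- lies in the `ε₀ / 2` neighbourhood, the whole cell lies in the `ε₀` one, so counting corners is
  -- bounded by area. The factor `(2L)²` is the area of the square.
  refine ⟨ε₀ / 2, half_pos hε₀, ?_⟩
  have hsmall : ∀ᶠ M : ℕ in atTop, 2 * (2 * L) / M < ε₀ / 2 :=
    (tendsto_const_div_atTop_nhds_zero_nat _).eventually (gt_mem_nhds (half_pos hε₀))
  filter_upwards [hsmall, eventually_ge_atTop 1] with M hM hM1
  have hw : (0 : ℝ) < 2 * L := by positivity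
  have hMpos : (0 : ℝ) < M := by exact_mod_cast hM1
  have e : -L + 2 * L = L := by ring
  have key := setIntegral_cellIndex_prod (a := -L) hw hM1
    (fun i j => if gridPair L M i j ∈ nbhd L S (ε₀ / 2) then (1 : ℝ) else 0) (C := 1)
    (fun i j => by split_ifs <;> simp)
  rw [e] at key
  have hle : ∫ p in Ioc (-L) L ×ˢ Ioc (-L) L,
      (if gridPair L M (cellIndex (-L) (2 * L) M p.1) (cellIndex (-L) (2 * L) M p.2) ∈
        nbhd L S (ε₀ / 2) then (1 : ℝ) else 0) ≤ (volume (nbhd L S ε₀)).toReal := by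
    have hA : MeasurableSet (toPlane ⁻¹' nbhd L S ε₀) :=
      continuous_toPlane.measurable (isClosed_nbhd L S ε₀).measurableSet
    have hvolA : volume (toPlane ⁻¹' nbhd L S ε₀) = volume (nbhd L S ε₀) :=
      measurePreserving_toPlane.measure_preimage (isClosed_nbhd L S ε₀).measurableSet.nullMeasurableSet
    have hind : Integrable ((toPlane ⁻¹' nbhd L S ε₀).indicator fun _ => (1 : ℝ)) volume :=
      (integrable_indicator_iff hA).2 (integrableOn_const (hvolA ▸ volume_nbhd_ne_top L S ε₀))
    calc _ ≤ ∫ p in Ioc (-L) L ×ˢ Ioc (-L) L,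
          (toPlane ⁻¹' nbhd L S ε₀).indicator (fun _ => (1 : ℝ)) p := by
          refine integral_mono_of_nonneg (ae_of_all _ fun p => ?_) hind.integrableOn ?_
          · simp only [Pi.zero_apply]
            split_ifs <;> simp
          refine (ae_restrict_iff' (measurableSet_Ioc.prod measurableSet_Ioc)).2
            (ae_of_all _ fun p hp => ?_)
          have hp1 : p.1 ∈ Ioc (-L) (-L + 2 * L) := e.symm ▸ hp.1
          have hp2 : p.2 ∈ Ioc (-L) (-L + 2 * L) := e.symm ▸ hp.2
          simp only
          split_ifs with hin
          · have hmem : p ∈ toPlane ⁻¹' nbhd L S ε₀ := by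
              have hd : dist (toPlane p) (gridPair L M (cellIndex (-L) (2 * L) M p.1)
                  (cellIndex (-L) (2 * L) M p.2)) ≤ ε₀ / 2 := by
                refine (dist_toPlane_le _ _).trans ?_
                have h1 := abs_cell_sub_le hw hM1 hp1
                have h2 := abs_cell_sub_le hw hM1 hp2
                rw [abs_sub_comm] at h1 h2
                have h3 : 2 * (2 * L) / M = 2 * L / M + 2 * L / M := by ring
                simp only [gridPoint]
                linarith
              have := mem_nbhd_of_dist_le (half_pos hε₀).le (half_pos hε₀).le
                (toPlane_mem_square (Ioc_subset_Icc_self hp.1) (Ioc_subset_Icc_self hp.2)) hin hd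
              rwa [add_halves] at this
            rw [indicator_of_mem hmem]
          · exact indicator_nonneg (fun _ _ => zero_le_one) _
      _ ≤ ∫ p, (toPlane ⁻¹' nbhd L S ε₀).indicator (fun _ => (1 : ℝ)) p :=
          setIntegral_le_integral hind
            (ae_of_all _ fun p => indicator_nonneg (fun _ _ => zero_le_one) _)
      _ = _ := by
          rw [integral_indicator_const _ hA, smul_eq_mul, mul_one, Measure.real, hvolA]
  rw [key] at hle
  rw [inv_mul_le_iff₀ (by positivity)]
  have h4 : (2 * L / M) ^ 2 * ∑ i₁ ∈ Finset.Icc 1 M, ∑ i₂ ∈ Finset.Icc 1 M,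
        (if gridPair L M i₁ i₂ ∈ nbhd L S (ε₀ / 2) then (1 : ℝ) else 0) ≤ η * (2 * L) ^ 2 :=
    hle.trans hvol.le
  rw [div_pow, div_mul_eq_mul_div, div_le_iff₀ (by positivity)] at h4
  have h5 : (0 : ℝ) < (2 * L) ^ 2 := by positivity
  nlinarith

/-- Riemann sums of bounded functions which are continuous off the singular set. -/
theorem tendsto_riemann_sum (hS : IsSingularSet L S) (hL : 0 < L) {g : ℝ → ℝ → ℝ → ℝ} {C : ℝ}
    (hC : ∀ lam ∈ Icc 0 (2 * Real.pi), ∀ u ∈ Icc (-L) L, ∀ v ∈ Icc (-L) L, ‖g lam u v‖ ≤ C)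
    (hg : ContinuousOn (fun p : ℝ × ℝ × ℝ => g p.1 p.2.1 p.2.2)
      {p | p.1 ∈ Icc 0 (2 * Real.pi) ∧ toPlane p.2 ∈ square L \ S})
    {M : ℕ → ℕ} (hM : Tendsto M atTop atTop) :
    Tendsto (fun n : ℕ => 8 * Real.pi * L ^ 2 / (n * (M n : ℝ) ^ 2) *
      ∑ j ∈ Finset.Icc 1 (n - 1), ∑ i₁ ∈ Finset.Icc 1 (M n), ∑ i₂ ∈ Finset.Icc 1 (M n),
        g (2 * Real.pi * j / n) (gridPoint L (M n) i₁) (gridPoint L (M n) i₂)) atTop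
      (𝓝 (∫ p in Icc (0 : ℝ) (2 * Real.pi) ×ˢ Icc (-L) L ×ˢ Icc (-L) L, g p.1 p.2.1 p.2.2)) := by
  have hpi := Real.pi_pos
  have hw : (0 : ℝ) < 2 * L := by positivity
  have hz : (0 : ℝ) < 2 * Real.pi := by positivity
  have e : -L + 2 * L = L := by ring
  have hC0 : 0 ≤ C := (norm_nonneg _).trans (hC 0 ⟨le_rfl, hz.le⟩ 0 ⟨by linarith, hL.le⟩ 0
    ⟨by linarith, hL.le⟩)
  set B : Set (ℝ × ℝ × ℝ) := Ioc (0 : ℝ) (2 * Real.pi) ×ˢ Ioc (-L) L ×ˢ Ioc (-L) L with hB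
  have hBm : MeasurableSet B :=
    measurableSet_Ioc.prod (measurableSet_Ioc.prod measurableSet_Ioc)
  have hBvol : volume B ≠ ∞ := by
    rw [hB, Measure.volume_eq_prod, Measure.prod_prod, Measure.volume_eq_prod, Measure.prod_prod]
    exact ENNReal.mul_ne_top measure_Ioc_lt_top.ne
      (ENNReal.mul_ne_top measure_Ioc_lt_top.ne measure_Ioc_lt_top.ne)
  have hae : (Icc (0 : ℝ) (2 * Real.pi) ×ˢ Icc (-L) L ×ˢ Icc (-L) L : Set (ℝ × ℝ × ℝ)) =ᵐ[volume]
      B :=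
    (Measure.set_prod_ae_eq Ioc_ae_eq_Icc
      (Measure.set_prod_ae_eq Ioc_ae_eq_Icc Ioc_ae_eq_Icc)).symm
  rw [setIntegral_congr_set hae]
  -- Extension by zero keeps the step functions bounded everywhere. It also reconciles the `n` cells
  -- in `λ` with a sum that stops at `n - 1`.
  set G : ℕ → ℕ → ℕ → ℕ → ℝ := fun n j i₁ i₂ =>
    if j ∈ Finset.Icc 1 (n - 1) ∧ i₁ ∈ Finset.Icc 1 (M n) ∧ i₂ ∈ Finset.Icc 1 (M n) then
      g (2 * Real.pi * j / n) (gridPoint L (M n) i₁) (gridPoint L (M n) i₂) else 0 with hG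
  have hfreq : ∀ n j : ℕ, j ∈ Finset.Icc 1 (n - 1) → 2 * Real.pi * j / n ∈ Icc 0 (2 * Real.pi) := by
    intro n j hj
    rw [Finset.mem_Icc] at hj
    have := cell_mem_Icc (a := 0) hz.le (N := n) (i := j) (by rw [Finset.mem_Icc]; omega)
    simpa using this
  have hGC : ∀ n j i₁ i₂, ‖G n j i₁ i₂‖ ≤ C := by
    intro n j i₁ i₂
    simp only [hG]
    split_ifs with h
    · exact hC _ (hfreq n j h.1) _ (gridPoint_mem hL h.2.1) _ (gridPoint_mem hL h.2.2)
    · simpa using hC0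
  have hsum : ∀ n, 1 ≤ n → 1 ≤ M n → 8 * Real.pi * L ^ 2 / (n * (M n : ℝ) ^ 2) *
      ∑ j ∈ Finset.Icc 1 (n - 1), ∑ i₁ ∈ Finset.Icc 1 (M n), ∑ i₂ ∈ Finset.Icc 1 (M n),
        g (2 * Real.pi * j / n) (gridPoint L (M n) i₁) (gridPoint L (M n) i₂) =
      ∫ p in B, G n (cellIndex 0 (2 * Real.pi) n p.1) (cellIndex (-L) (2 * L) (M n) p.2.1)
        (cellIndex (-L) (2 * L) (M n) p.2.2) := by
    intro n hn hMn
    have key := setIntegral_cellIndex_prod_prod (a := -L) (b := 0) hw hz hMn hn (G n) (hGC n)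
    rw [e, zero_add] at key
    rw [key]
    congr 1
    · field_simp; ring
    have hsub : Finset.Icc 1 (n - 1) ⊆ Finset.Icc 1 n := Finset.Icc_subset_Icc_right (by omega)
    rw [← Finset.sum_subset hsub]
    · refine Finset.sum_congr rfl fun j hj => Finset.sum_congr rfl fun i₁ hi₁ =>
        Finset.sum_congr rfl fun i₂ hi₂ => ?_
      simp only [hG]
      rw [if_pos ⟨hj, hi₁, hi₂⟩]
    · intro j _ hj
      refine Finset.sum_eq_zero fun i₁ _ => Finset.sum_eq_zero fun i₂ _ => ?_
      simp only [hG]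
      rw [if_neg fun h => hj h.1]
  have hmeas : ∀ n, Measurable fun p : ℝ × ℝ × ℝ =>
      G n (cellIndex 0 (2 * Real.pi) n p.1) (cellIndex (-L) (2 * L) (M n) p.2.1)
        (cellIndex (-L) (2 * L) (M n) p.2.2) := by
    intro n
    have hm := measurable_cellIndex (-L) (2 * L) (M n)
    have hm' := measurable_cellIndex 0 (2 * Real.pi) n
    exact (Measurable.of_discrete (f := fun q : ℕ × ℕ × ℕ => G n q.1 q.2.1 q.2.2)).comp
      ((hm'.comp measurable_fst).prodMk ((hm.comp (measurable_fst.comp measurable_snd)).prodMk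
        (hm.comp (measurable_snd.comp measurable_snd))))
  have hlim : ∀ᵐ p ∂(volume.restrict B), Tendsto (fun n =>
      G n (cellIndex 0 (2 * Real.pi) n p.1) (cellIndex (-L) (2 * L) (M n) p.2.1)
        (cellIndex (-L) (2 * L) (M n) p.2.2)) atTop (𝓝 (g p.1 p.2.1 p.2.2)) := by
    have hnull : ∀ᵐ p : ℝ × ℝ × ℝ, toPlane p.2 ∉ S := by
      have h1 : ∀ᵐ q : ℝ × ℝ, toPlane q ∉ S :=
        measurePreserving_toPlane.quasiMeasurePreserving.ae
          (measure_eq_zero_iff_ae_notMem.1 hS.volume_eq_zero)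
      exact Measure.quasiMeasurePreserving_snd.ae h1
    -- The last frequency cell, of index `n`, carries the value zero. A point with `λ < 2π`
    -- eventually leaves it.
    have hend : ∀ᵐ p : ℝ × ℝ × ℝ, p.1 ≠ 2 * Real.pi :=
      Measure.quasiMeasurePreserving_fst.ae (volume.ae_ne (2 * Real.pi))
    rw [ae_restrict_iff' hBm]
    filter_upwards [hnull, hend] with p hpS hpe hpB
    have hp0 : p.1 ∈ Ioc 0 (0 + 2 * Real.pi) := by simpa using hpB.1
    have hp1 : p.2.1 ∈ Ioc (-L) (-L + 2 * L) := e.symm ▸ hpB.2.1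
    have hp2 : p.2.2 ∈ Ioc (-L) (-L + 2 * L) := e.symm ▸ hpB.2.2
    set x : ℕ → ℝ × ℝ × ℝ := fun n => (2 * Real.pi * cellIndex 0 (2 * Real.pi) n p.1 / n,
      gridPoint L (M n) (cellIndex (-L) (2 * L) (M n) p.2.1),
      gridPoint L (M n) (cellIndex (-L) (2 * L) (M n) p.2.2)) with hx
    have hM1 : ∀ᶠ n in atTop, 1 ≤ M n := hM.eventually_ge_atTop 1
    have t0 : Tendsto (fun n => (x n).1) atTop (𝓝 p.1) := by
      rw [tendsto_iff_dist_tendsto_zero]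
      refine squeeze_zero' (Eventually.of_forall fun _ => dist_nonneg) ?_
        (tendsto_const_div_atTop_nhds_zero_nat (2 * Real.pi))
      filter_upwards [eventually_ge_atTop 1] with n hn
      have := abs_cell_sub_le hz hn hp0
      rwa [zero_add] at this
    have hdiv : Tendsto (fun n => 2 * L / (M n : ℝ)) atTop (𝓝 0) :=
      (tendsto_const_div_atTop_nhds_zero_nat (2 * L)).comp hM
    have t1 : Tendsto (fun n => (x n).2.1) atTop (𝓝 p.2.1) := by
      rw [tendsto_iff_dist_tendsto_zero]
      refine squeeze_zero' (Eventually.of_forall fun _ => dist_nonneg) ?_ hdiv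
      filter_upwards [hM1] with n hn
      exact abs_cell_sub_le hw hn hp1
    have t2 : Tendsto (fun n => (x n).2.2) atTop (𝓝 p.2.2) := by
      rw [tendsto_iff_dist_tendsto_zero]
      refine squeeze_zero' (Eventually.of_forall fun _ => dist_nonneg) ?_ hdiv
      filter_upwards [hM1] with n hn
      exact abs_cell_sub_le hw hn hp2
    have tx : Tendsto x atTop (𝓝 p) := t0.prodMk_nhds (t1.prodMk_nhds t2)
    have hS' : ∀ᶠ n in atTop, toPlane (x n).2 ∉ S :=
      ((continuous_toPlane.comp continuous_snd).continuousAt.tendsto.comp tx).eventually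
        (hS.isClosed.isOpen_compl.mem_nhds hpS)
    have hlt : ∀ᶠ n in atTop, (x n).1 < 2 * Real.pi :=
      t0.eventually (gt_mem_nhds (lt_of_le_of_ne hpB.1.2 hpe))
    have hidx : ∀ᶠ n in atTop, cellIndex 0 (2 * Real.pi) n p.1 ∈ Finset.Icc 1 (n - 1) ∧
        cellIndex (-L) (2 * L) (M n) p.2.1 ∈ Finset.Icc 1 (M n) ∧
        cellIndex (-L) (2 * L) (M n) p.2.2 ∈ Finset.Icc 1 (M n) := by
      filter_upwards [hlt, hM1, eventually_ge_atTop 1] with n hlt hMn hn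
      refine ⟨?_, cellIndex_mem hw hMn hp1, cellIndex_mem hw hMn hp2⟩
      have h1 := Finset.mem_Icc.1 (cellIndex_mem hz hn hp0)
      have hn' : (0 : ℝ) < n := by exact_mod_cast hn
      simp only [hx] at hlt
      rw [div_lt_iff₀ hn'] at hlt
      have h2 : (cellIndex 0 (2 * Real.pi) n p.1 : ℝ) < n := lt_of_mul_lt_mul_left hlt hz.le
      have h3 : cellIndex 0 (2 * Real.pi) n p.1 < n := by exact_mod_cast h2
      rw [Finset.mem_Icc]
      omega
    have hin : ∀ᶠ n in atTop,
        x n ∈ {p : ℝ × ℝ × ℝ | p.1 ∈ Icc 0 (2 * Real.pi) ∧ toPlane p.2 ∈ square L \ S} := by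
      filter_upwards [hidx, hS'] with n h hS'
      exact ⟨hfreq n _ h.1,
        toPlane_mem_square (gridPoint_mem hL h.2.1) (gridPoint_mem hL h.2.2), hS'⟩
    have hpin : p ∈ {p : ℝ × ℝ × ℝ | p.1 ∈ Icc 0 (2 * Real.pi) ∧ toPlane p.2 ∈ square L \ S} :=
      ⟨Ioc_subset_Icc_self hpB.1, toPlane_mem_square (Ioc_subset_Icc_self hpB.2.1)
        (Ioc_subset_Icc_self hpB.2.2), hpS⟩
    have hconv : Tendsto (fun n => g (x n).1 (x n).2.1 (x n).2.2) atTop (𝓝 (g p.1 p.2.1 p.2.2)) :=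
      (hg p hpin).tendsto.comp (tendsto_nhdsWithin_iff.2 ⟨tx, hin⟩)
    refine hconv.congr' ?_
    filter_upwards [hidx] with n h
    simp only [hG]
    rw [if_pos h]
  have hdct := tendsto_integral_of_dominated_convergence (μ := volume.restrict B) (fun _ => C)
    (fun n => (hmeas n).aestronglyMeasurable) (integrableOn_const hBvol)
    (fun n => ae_of_all _ fun p => hGC n _ _ _) hlim
  refine hdct.congr' ?_
  filter_upwards [eventually_ge_atTop 1, hM.eventually_ge_atTop 1] with n hn hMn
  exact (hsum n hn hMn).symm

end GenSpectrum

namespace GenSpectrum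

/-! ### Trigonometric approximation -/

/-- At most `κ n / (2π)` frequencies lie within `κ` of each of the two end points. -/
theorem card_fourier_near_end_le (n : ℕ) {κ : ℝ} (hκ : 0 ≤ κ) :
    (((Finset.Icc 1 (n - 1)).filter fun j : ℕ =>
      2 * Real.pi * j / n < κ ∨ 2 * Real.pi - 2 * Real.pi * j / n < κ).card : ℝ) ≤
      κ / Real.pi * n := by
  have hpi := Real.pi_pos
  rcases Nat.eq_zero_or_pos n with rfl | hn
  · simp
  have hn' : (0 : ℝ) < n := by exact_mod_cast hn
  set m := ⌊κ * n / (2 * Real.pi)⌋₊ with hm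
  have hmle : (m : ℝ) ≤ κ * n / (2 * Real.pi) := Nat.floor_le (by positivity)
  have hsub : ((Finset.Icc 1 (n - 1)).filter fun j : ℕ =>
      2 * Real.pi * j / n < κ ∨ 2 * Real.pi - 2 * Real.pi * j / n < κ) ⊆
      Finset.Icc 1 m ∪ Finset.Ico (n - m) n := by
    intro j hj
    rw [Finset.mem_filter, Finset.mem_Icc] at hj
    obtain ⟨⟨h1, h2⟩, h | h⟩ := hj
    · refine Finset.mem_union_left _ (Finset.mem_Icc.2 ⟨h1, Nat.le_floor ?_⟩)
      rw [div_lt_iff₀ hn'] at h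
      rw [le_div_iff₀ (by positivity)]
      linarith
    · refine Finset.mem_union_right _ (Finset.mem_Ico.2 ⟨?_, by omega⟩)
      have h3 : n - j ≤ m := by
        refine Nat.le_floor ?_
        rw [Nat.cast_sub (by omega), le_div_iff₀ (by positivity)]
        have h4 : 2 * Real.pi - 2 * Real.pi * j / n = 2 * Real.pi * (n - j) / n := by field_simp
        rw [h4, div_lt_iff₀ hn'] at h
        linarith
      omega
  have hcard : ((Finset.Icc 1 (n - 1)).filter fun j : ℕ =>
      2 * Real.pi * j / n < κ ∨ 2 * Real.pi - 2 * Real.pi * j / n < κ).card ≤ m + m := by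
    refine (Finset.card_le_card hsub).trans ((Finset.card_union_le _ _).trans ?_)
    rw [Nat.card_Icc, Nat.card_Ico]
    omega
  calc _ ≤ ((m + m : ℕ) : ℝ) := by exact_mod_cast hcard
    _ ≤ κ * n / (2 * Real.pi) + κ * n / (2 * Real.pi) := by push_cast; linarith
    _ = _ := by field_simp; ring

/-- A function with equal end values descends to the circle, where the span of the characters is
dense in the continuous functions. -/
theorem exists_trig_sum_near {ψ : ℝ → ℂ} (hψ : ContinuousOn ψ (Icc 0 (2 * Real.pi)))
    (hper : ψ 0 = ψ (2 * Real.pi)) {η : ℝ} (hη : 0 < η) :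
    ∃ (s : Finset ℤ) (c : ℤ → ℂ), ∀ lam ∈ Ico 0 (2 * Real.pi),
      ‖ψ lam - ∑ h ∈ s, c h * Complex.exp (Complex.I * (h : ℂ) * (lam : ℂ))‖ < η := by
  have hpi := Real.pi_pos
  have : Fact (0 < 2 * Real.pi) := ⟨by positivity⟩
  let Ψ : C(AddCircle (2 * Real.pi), ℂ) := ⟨AddCircle.liftIco (2 * Real.pi) 0 ψ,
    AddCircle.liftIco_continuous (by simpa using hper) (by simpa using hψ)⟩
  have hmem : Ψ ∈ (Submodule.span ℂ (Set.range (fourier (T := 2 * Real.pi)))).topologicalClosure := by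
    rw [span_fourier_closure_eq_top]
    trivial
  obtain ⟨P, hP, hd⟩ := Metric.mem_closure_iff.1 hmem η hη
  obtain ⟨c, rfl⟩ := (Finsupp.mem_span_range_iff_exists_finsupp).1 hP
  refine ⟨c.support, c, fun lam hlam => ?_⟩
  have h1 := (ContinuousMap.dist_lt_iff hη).1 hd (lam : AddCircle (2 * Real.pi))
  have h2 : Ψ (lam : AddCircle (2 * Real.pi)) = ψ lam :=
    AddCircle.liftIco_coe_apply (by simpa using hlam)
  have h3 : ∀ h ∈ c.support, (c h • fourier h : C(AddCircle (2 * Real.pi), ℂ))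
      (lam : AddCircle (2 * Real.pi)) =
        c h * Complex.exp (Complex.I * (h : ℂ) * (lam : ℂ)) := by
    intro h _
    rw [ContinuousMap.smul_apply, fourier_coe_apply, smul_eq_mul]
    congr 2
    have : (Real.pi : ℂ) ≠ 0 := by exact_mod_cast hpi.ne'
    push_cast
    field_simp
  rw [← Finset.sum_congr rfl h3, ← ContinuousMap.sum_apply, ← h2, ← dist_eq_norm]
  exact h1

/-- Approximation in mean over the Fourier frequencies by trigonometric sums. -/
theorem exists_trig_sum_average_le {φ : ℝ → ℂ} (hφ : ContinuousOn φ (Icc 0 (2 * Real.pi))) {η : ℝ}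
    (hη : 0 < η) : ∃ (s : Finset ℤ) (c : ℤ → ℂ), ∀ n : ℕ,
      (n : ℝ)⁻¹ * ∑ j ∈ Finset.Icc 1 (n - 1), ‖φ (2 * Real.pi * j / n) -
        ∑ h ∈ s, c h * Complex.exp (Complex.I * (h : ℂ) * ((2 * Real.pi * j / n : ℝ) : ℂ))‖ ≤ η := by
  have hpi := Real.pi_pos
  obtain ⟨C, hC⟩ := isCompact_Icc.exists_bound_of_continuousOn hφ
  have hC0 : 0 ≤ C := (norm_nonneg _).trans (hC 0 ⟨le_rfl, by positivity⟩)
  -- `φ` need not be periodic, so it is multiplied by a cut-off `χ` that vanishes at both ends and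
  -- equals one at distance `κ` from them. The affected frequencies have proportion at most `κ / π`
  -- and cost at most `C` each, which is within `η / 2`; `C + 1` avoids a zero denominator.
  set κ : ℝ := Real.pi * η / (2 * (C + 1)) with hκ
  have hκ0 : 0 < κ := by positivity
  set χ : ℝ → ℝ := fun x => max 0 (min 1 (min (x / κ) ((2 * Real.pi - x) / κ))) with hχ
  have hχc : Continuous χ := by
    simp only [hχ]
    fun_prop
  have hχ0 : ∀ x, 0 ≤ χ x := fun x => le_max_left _ _
  have hχ1 : ∀ x, χ x ≤ 1 := fun x => max_le zero_le_one (min_le_left _ _)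
  have hχeq : ∀ x, κ ≤ x → κ ≤ 2 * Real.pi - x → χ x = 1 := by
    intro x h1 h2
    have h3 : 1 ≤ x / κ := (one_le_div hκ0).2 h1
    have h4 : 1 ≤ (2 * Real.pi - x) / κ := (one_le_div hκ0).2 h2
    simp only [hχ]
    rw [min_eq_left (le_min h3 h4), max_eq_right zero_le_one]
  obtain ⟨s, c, hsc⟩ := exists_trig_sum_near (ψ := fun x => (χ x : ℂ) * φ x)
    ((Complex.continuous_ofReal.comp hχc).continuousOn.mul hφ) (by
      have h1 : χ 0 = 0 := by
        simp only [hχ]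
        refine max_eq_left ((min_le_right _ _).trans ((min_le_left _ _).trans (by simp)))
      have h2 : χ (2 * Real.pi) = 0 := by
        simp only [hχ]
        refine max_eq_left ((min_le_right _ _).trans ((min_le_right _ _).trans (by simp)))
      simp [h1, h2]) (half_pos hη)
  refine ⟨s, c, fun n => ?_⟩
  rcases Nat.eq_zero_or_pos n with rfl | hn
  · simpa using hη.le
  have hn' : (0 : ℝ) < n := by exact_mod_cast hn
  have hterm : ∀ j ∈ Finset.Icc 1 (n - 1), ‖φ (2 * Real.pi * j / n) -
        ∑ h ∈ s, c h * Complex.exp (Complex.I * (h : ℂ) * ((2 * Real.pi * j / n : ℝ) : ℂ))‖ ≤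
      η / 2 + if 2 * Real.pi * j / n < κ ∨ 2 * Real.pi - 2 * Real.pi * j / n < κ then C else 0 := by
    intro j hj
    rw [Finset.mem_Icc] at hj
    have hjn : (j : ℝ) < n := by exact_mod_cast (by omega : j < n)
    set x : ℝ := 2 * Real.pi * j / n with hx
    have hxI : x ∈ Ico 0 (2 * Real.pi) := by
      refine ⟨by positivity, ?_⟩
      rw [hx, div_lt_iff₀ hn']
      exact mul_lt_mul_of_pos_left hjn (by positivity)
    have h1 := (hsc x hxI).le
    have h2 : ‖φ x - (χ x : ℂ) * φ x‖ ≤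
        if x < κ ∨ 2 * Real.pi - x < κ then C else 0 := by
      split_ifs with hc
      · have : φ x - (χ x : ℂ) * φ x = ((1 - χ x : ℝ) : ℂ) * φ x := by push_cast; ring
        rw [this, norm_mul, Complex.norm_real, Real.norm_of_nonneg (by linarith [hχ1 x])]
        exact (mul_le_of_le_one_left (norm_nonneg _) (by linarith [hχ0 x])).trans
          (hC x (Ico_subset_Icc_self hxI))
      · push Not at hc
        rw [hχeq x hc.1 hc.2]
        simp
    have h3 := norm_add_le_of_le h1 h2
    refine le_trans (le_of_eq ?_) h3
    congr 1
    ring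
  have hcard := card_fourier_near_end_le n hκ0.le
  rw [inv_mul_le_iff₀ hn']
  refine (Finset.sum_le_sum hterm).trans ?_
  rw [Finset.sum_add_distrib, Finset.sum_const, nsmul_eq_mul, Nat.card_Icc, ← Finset.sum_filter,
    Finset.sum_const, nsmul_eq_mul]
  have h5 : (((n - 1 + 1 - 1 : ℕ) : ℝ)) ≤ n := by exact_mod_cast (by omega)
  have h6 : κ / Real.pi * C ≤ η / 2 := by
    have : κ / Real.pi * C = η / 2 * (C / (C + 1)) := by
      rw [hκ]
      field_simp
    rw [this]
    refine mul_le_of_le_one_right (half_pos hη).le ?_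
    rw [div_le_one (by positivity)]
    linarith
  have h7 := mul_le_mul_of_nonneg_right hcard hC0
  have h8 := mul_le_mul_of_nonneg_right h5 (half_pos hη).le
  have h9 := mul_le_mul_of_nonneg_right h6 hn'.le
  nlinarith

/-! ### Weighted averages of the periodogram over the grid -/

/-- Hölder continuity of a function `φ(λ; u, v)` off every neighbourhood of `S`. -/
def HolderOff (L : ℝ) (φ : ℝ → ℝ → ℝ → ℂ) (S : Set (EuclideanSpace ℝ (Fin 2))) (α β : ℝ) : Prop :=
  ∀ ε : ℝ, 0 < ε → ∃ K : ℝ, 0 ≤ K ∧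
    ∀ lam ∈ Icc 0 (2 * Real.pi), ∀ lam' ∈ Icc 0 (2 * Real.pi),
    ∀ p ∈ square L \ nbhd L S ε, ∀ p' ∈ square L \ nbhd L S ε,
      ‖φ lam (p 0) (p 1) - φ lam' (p' 0) (p' 1)‖ ≤ K * (|lam - lam'| ^ α + ‖p - p'‖ ^ β)

theorem fourier_freq_mem {n j : ℕ} (hj : j ∈ Finset.Icc 1 (n - 1)) :
    2 * Real.pi * j / n ∈ Icc 0 (2 * Real.pi) := by
  rw [Finset.mem_Icc] at hj
  have := cell_mem_Icc (a := 0) (w := 2 * Real.pi) (by positivity) (N := n) (i := j)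
    (by rw [Finset.mem_Icc]; omega)
  simpa using this

theorem HolderOff.continuousOn {L α β : ℝ} {φ : ℝ → ℝ → ℝ → ℂ} {S : Set (EuclideanSpace ℝ (Fin 2))}
    (hφ : HolderOff L φ S α β) (hα : 0 < α) (hβ : 0 < β) {ε : ℝ} (hε : 0 < ε)
    {p : EuclideanSpace ℝ (Fin 2)} (hp : p ∈ square L \ nbhd L S ε) :
    ContinuousOn (fun lam => φ lam (p 0) (p 1)) (Icc 0 (2 * Real.pi)) := by
  obtain ⟨K, hK, h⟩ := hφ ε hε
  intro x hx
  rw [ContinuousWithinAt, tendsto_iff_dist_tendsto_zero]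
  have hlim : Tendsto (fun y : ℝ => K * |y - x| ^ α) (𝓝[Icc 0 (2 * Real.pi)] x) (𝓝 0) := by
    have hc : Continuous fun y : ℝ => K * |y - x| ^ α :=
      continuous_const.mul ((continuous_id.sub continuous_const).abs.rpow_const
        fun _ => Or.inr hα.le)
    have := hc.tendsto x
    simp only [sub_self, abs_zero, Real.zero_rpow hα.ne', mul_zero] at this
    exact this.mono_left nhdsWithin_le_nhds
  refine squeeze_zero' (Eventually.of_forall fun _ => dist_nonneg) ?_ hlim
  filter_upwards [self_mem_nhdsWithin] with y hy
  have := h y hy x hx p hp p hp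
  rw [sub_self, norm_zero, Real.zero_rpow hβ.ne', add_zero] at this
  rwa [dist_eq_norm]

variable {Ω : Type*} [MeasurableSpace Ω] {μ : Measure Ω} {Z : ℤ → Ω → ℝ} {q : ℕ}

theorem integrable_periodogram_sub [IsProbabilityMeasure μ] (hZ : ∀ t, Measurable (Z t)) (n : ℕ)
    (lam u v : ℝ) (c : ℂ) : Integrable (fun ω => periodogram Z n lam u v ω - c) μ :=
  (integrable_of_norm_le (measurable_periodogram hZ n lam u v)
    (norm_periodogram_le_natCast n lam u v)).sub (integrable_const c)

theorem integral_norm_periodogram_sub_le [IsProbabilityMeasure μ] (hstat : StrictlyStationary μ Z)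
    (hZ : ∀ t, Measurable (Z t)) (hsum : CumulantSummable μ Z q) {n j : ℕ}
    (hj : j ∈ Finset.Icc 1 (n - 1)) (u v : ℝ) :
    ∫ ω, ‖periodogram Z n (2 * Real.pi * j / n) u v ω - spectrum2 μ Z (2 * Real.pi * j / n) u v‖ ∂μ
      ≤ 2 * specBound μ Z := by
  have hi := integrable_of_norm_le (μ := μ) (measurable_periodogram hZ n (2 * Real.pi * j / n) u v)
    (norm_periodogram_le_natCast n _ u v)
  have h1 := integral_norm_periodogram_le hstat hZ hsum hj u v
  have h2 := norm_spectrum2_le hstat hZ hsum (2 * Real.pi * j / n) u v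
  calc _ ≤ ∫ ω, (‖periodogram Z n (2 * Real.pi * j / n) u v ω‖ +
          ‖spectrum2 μ Z (2 * Real.pi * j / n) u v‖) ∂μ :=
        integral_mono_of_nonneg (ae_of_all _ fun ω => norm_nonneg _)
          (hi.norm.add (integrable_const _)) (ae_of_all _ fun ω => norm_sub_le _ _)
    _ = ∫ ω, ‖periodogram Z n (2 * Real.pi * j / n) u v ω‖ ∂μ +
          ‖spectrum2 μ Z (2 * Real.pi * j / n) u v‖ := by
        rw [integral_add hi.norm (integrable_const _)]
        simp
    _ ≤ _ := by linarith

/-- The average over the Fourier frequencies of `(I_n - f) ψ` is at most `2B` times the average of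
`|ψ|`, in mean. -/
theorem integral_norm_average_le [IsProbabilityMeasure μ] (hstat : StrictlyStationary μ Z)
    (hZ : ∀ t, Measurable (Z t)) (hsum : CumulantSummable μ Z q) (n : ℕ) (u v : ℝ) (ψ : ℕ → ℂ) :
    ∫ ω, ‖(n : ℂ)⁻¹ * ∑ j ∈ Finset.Icc 1 (n - 1), (periodogram Z n (2 * Real.pi * j / n) u v ω -
        spectrum2 μ Z (2 * Real.pi * j / n) u v) * ψ j‖ ∂μ ≤
      2 * specBound μ Z * ((n : ℝ)⁻¹ * ∑ j ∈ Finset.Icc 1 (n - 1), ‖ψ j‖) := by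
  have hi := fun j : ℕ => (integrable_periodogram_sub (μ := μ) hZ n (2 * Real.pi * j / n) u v
    (spectrum2 μ Z (2 * Real.pi * j / n) u v)).norm
  calc _ ≤ ∫ ω, (n : ℝ)⁻¹ * ∑ j ∈ Finset.Icc 1 (n - 1),
          ‖periodogram Z n (2 * Real.pi * j / n) u v ω -
            spectrum2 μ Z (2 * Real.pi * j / n) u v‖ * ‖ψ j‖ ∂μ := by
        refine integral_mono_of_nonneg (ae_of_all _ fun ω => norm_nonneg _)
          ((integrable_finsetSum _ fun j _ => (hi j).mul_const _).const_mul _)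
          (ae_of_all _ fun ω => ?_)
        simp only
        rw [norm_mul, norm_inv, Complex.norm_natCast]
        refine mul_le_mul_of_nonneg_left ?_ (by positivity)
        exact norm_sum_le_of_le _ fun j _ => (norm_mul _ _).le
    _ = (n : ℝ)⁻¹ * ∑ j ∈ Finset.Icc 1 (n - 1),
          (∫ ω, ‖periodogram Z n (2 * Real.pi * j / n) u v ω -
            spectrum2 μ Z (2 * Real.pi * j / n) u v‖ ∂μ) * ‖ψ j‖ := by
        rw [integral_const_mul, integral_finsetSum _ fun j _ => (hi j).mul_const _]
        simp_rw [integral_mul_const]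
    _ ≤ (n : ℝ)⁻¹ * ∑ j ∈ Finset.Icc 1 (n - 1), 2 * specBound μ Z * ‖ψ j‖ := by
        refine mul_le_mul_of_nonneg_left (Finset.sum_le_sum fun j hj => ?_) (by positivity)
        exact mul_le_mul_of_nonneg_right (integral_norm_periodogram_sub_le hstat hZ hsum hj u v)
          (norm_nonneg _)
    _ = _ := by rw [← Finset.mul_sum]; ring

theorem integrable_average [IsProbabilityMeasure μ] (hZ : ∀ t, Measurable (Z t)) (n : ℕ) (u v : ℝ)
    (ψ : ℕ → ℂ) : Integrable (fun ω => (n : ℂ)⁻¹ * ∑ j ∈ Finset.Icc 1 (n - 1),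
      (periodogram Z n (2 * Real.pi * j / n) u v ω -
        spectrum2 μ Z (2 * Real.pi * j / n) u v) * ψ j) μ :=
  (integrable_finsetSum _ fun _ _ =>
    (integrable_periodogram_sub hZ n _ u v _).mul_const _).const_mul _

/-- Averages of `(I_n - f) φ` over the Fourier frequencies converge to zero in mean, uniformly in
`(u, v)` off a neighbourhood of the singular set. -/
theorem eventually_integral_norm_average_le [IsProbabilityMeasure μ]
    (hstat : StrictlyStationary μ Z) (hZ : ∀ t, Measurable (Z t)) (hsum : CumulantSummable μ Z q)
    {L α β : ℝ} {S : Set (EuclideanSpace ℝ (Fin 2))} {φ : ℝ → ℝ → ℝ → ℂ}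
    (hφ : HolderOff L φ S α β) (hα : 0 < α) (hβ : 0 < β) {ε η : ℝ} (hε : 0 < ε) (hη : 0 < η) :
    ∀ᶠ n : ℕ in atTop, ∀ p ∈ square L \ nbhd L S ε,
      ∫ ω, ‖(n : ℂ)⁻¹ * ∑ j ∈ Finset.Icc 1 (n - 1),
        (periodogram Z n (2 * Real.pi * j / n) (p 0) (p 1) ω -
          spectrum2 μ Z (2 * Real.pi * j / n) (p 0) (p 1)) *
            φ (2 * Real.pi * j / n) (p 0) (p 1)‖ ∂μ ≤ η := by
  obtain ⟨K, hK, hhol⟩ := hφ ε hε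
  have hB := specBound_nonneg (μ := μ) (Z := Z)
  -- With `B = specBound μ Z`, the three errors below are at most `2Bη₂`, `2Bη₂` and `η₂`: moving
  -- the weight from `p` to a net point, replacing it there by a trigonometric sum, and averaging
  -- against that sum.
  set η₂ : ℝ := η / (4 * specBound μ Z + 1) with hη₂
  have hη₂0 : 0 < η₂ := by positivity
  obtain ⟨r, hr, hKr⟩ : ∃ r : ℝ, 0 < r ∧ ∀ x : ℝ, 0 ≤ x → x < r → K * x ^ β ≤ η₂ := by
    have hc : Tendsto (fun x : ℝ => K * x ^ β) (𝓝 0) (𝓝 0) := by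
      have : Continuous fun x : ℝ => K * x ^ β :=
        continuous_const.mul (continuous_id.rpow_const fun _ => Or.inr hβ.le)
      have := this.tendsto 0
      simpa [Real.zero_rpow hβ.ne'] using this
    obtain ⟨r, hr, h⟩ := Metric.eventually_nhds_iff.1 (hc.eventually (gt_mem_nhds hη₂0))
    refine ⟨r, hr, fun x hx hxr => (h ?_).le⟩
    simpa [Real.dist_eq, abs_of_nonneg hx] using hxr
  -- Only the weight is moved to a point of a finite net; the periodogram stays at `p`. The rates
  -- for the weights `e^{ihλ}` are uniform in `(u, v)`, so finitely many trigonometric sums serve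
  -- all `p`.
  have htb : TotallyBounded (square L \ nbhd L S ε) :=
    (isCompact_square L).totallyBounded.subset sdiff_subset
  obtain ⟨t, htT, htfin, hcov⟩ := Metric.finite_approx_of_totallyBounded htb r hr
  have happ : ∀ k ∈ t, ∃ (s : Finset ℤ) (c : ℤ → ℂ), ∀ n : ℕ,
      (n : ℝ)⁻¹ * ∑ j ∈ Finset.Icc 1 (n - 1), ‖φ (2 * Real.pi * j / n) (k 0) (k 1) -
        ∑ h ∈ s, c h * Complex.exp (Complex.I * (h : ℂ) * ((2 * Real.pi * j / n : ℝ) : ℂ))‖ ≤ η₂ :=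
    fun k hk => exists_trig_sum_average_le (hφ.continuousOn hα hβ hε (htT hk)) hη₂0
  choose! s c hsc using happ
  choose ρ hρ hρb using exists_rate_weighted_periodogram hstat hZ hsum
  have hev : ∀ᶠ n : ℕ in atTop, ∀ k ∈ t, ∑ h ∈ s k, ‖c k h‖ * ρ h n < η₂ := by
    rw [Filter.eventually_all_finite htfin]
    intro k _
    have : Tendsto (fun n => ∑ h ∈ s k, ‖c k h‖ * ρ h n) atTop (𝓝 (∑ h ∈ s k, ‖c k h‖ * 0)) :=
      tendsto_finsetSum _ fun h _ => (hρ h).const_mul _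
    simp only [mul_zero, Finset.sum_const_zero] at this
    exact this.eventually (gt_mem_nhds hη₂0)
  filter_upwards [hev, eventually_ge_atTop 1] with n hn hn1 p hp
  have hn' : (0 : ℝ) < n := by exact_mod_cast hn1
  obtain ⟨k, hk, hpk⟩ : ∃ k ∈ t, dist p k < r := by simpa using hcov hp
  set P : ℕ → ℂ := fun j =>
    ∑ h ∈ s k, c k h * Complex.exp (Complex.I * (h : ℂ) * ((2 * Real.pi * j / n : ℝ) : ℂ)) with hP
  set X : ℕ → Ω → ℂ := fun j ω => periodogram Z n (2 * Real.pi * j / n) (p 0) (p 1) ω -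
          spectrum2 μ Z (2 * Real.pi * j / n) (p 0) (p 1) with hX
  have b1 := integral_norm_average_le hstat hZ hsum n (p 0) (p 1)
    fun j => φ (2 * Real.pi * j / n) (p 0) (p 1) - φ (2 * Real.pi * j / n) (k 0) (k 1)
  have b2 := integral_norm_average_le hstat hZ hsum n (p 0) (p 1)
    fun j => φ (2 * Real.pi * j / n) (k 0) (k 1) - P j
  have i1 := integrable_average (μ := μ) hZ n (p 0) (p 1)
    fun j => φ (2 * Real.pi * j / n) (p 0) (p 1) - φ (2 * Real.pi * j / n) (k 0) (k 1)
  have i2 := integrable_average (μ := μ) hZ n (p 0) (p 1)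
    fun j => φ (2 * Real.pi * j / n) (k 0) (k 1) - P j
  have i3 := integrable_average (μ := μ) hZ n (p 0) (p 1) P
  have b3 : ∫ ω, ‖(n : ℂ)⁻¹ * ∑ j ∈ Finset.Icc 1 (n - 1), X j ω * P j‖ ∂μ ≤ η₂ := by
    have i4 := fun h : ℤ => integrable_average (μ := μ) hZ n (p 0) (p 1)
      fun j => Complex.exp (Complex.I * (h : ℂ) * ((2 * Real.pi * j / n : ℝ) : ℂ))
    calc _ ≤ ∫ ω, ∑ h ∈ s k, ‖c k h‖ * ‖(n : ℂ)⁻¹ * ∑ j ∈ Finset.Icc 1 (n - 1), X j ω *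
            Complex.exp (Complex.I * (h : ℂ) * ((2 * Real.pi * j / n : ℝ) : ℂ))‖ ∂μ := by
          refine integral_mono_of_nonneg (ae_of_all _ fun ω => norm_nonneg _)
            (integrable_finsetSum _ fun h _ => (i4 h).norm.const_mul _) (ae_of_all _ fun ω => ?_)
          have e : (n : ℂ)⁻¹ * ∑ j ∈ Finset.Icc 1 (n - 1), X j ω * P j =
              ∑ h ∈ s k, c k h * ((n : ℂ)⁻¹ * ∑ j ∈ Finset.Icc 1 (n - 1), X j ω *
                Complex.exp (Complex.I * (h : ℂ) * ((2 * Real.pi * j / n : ℝ) : ℂ))) := by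
            simp only [hP, Finset.mul_sum]
            rw [Finset.sum_comm]
            refine Finset.sum_congr rfl fun h _ => Finset.sum_congr rfl fun j _ => by ring
          simp only [e]
          exact norm_sum_le_of_le _ fun h _ => (norm_mul _ _).le
      _ = ∑ h ∈ s k, ‖c k h‖ * ∫ ω, ‖(n : ℂ)⁻¹ * ∑ j ∈ Finset.Icc 1 (n - 1), X j ω *
            Complex.exp (Complex.I * (h : ℂ) * ((2 * Real.pi * j / n : ℝ) : ℂ))‖ ∂μ := by
          rw [integral_finsetSum _ fun h _ => (i4 h).norm.const_mul _]
          exact Finset.sum_congr rfl fun h _ => integral_const_mul _ _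
      _ ≤ ∑ h ∈ s k, ‖c k h‖ * ρ h n := Finset.sum_le_sum fun h _ =>
          mul_le_mul_of_nonneg_left (hρb h n hn1 (p 0) (p 1)) (norm_nonneg _)
      _ ≤ η₂ := (hn k hk).le
  have a1 : (n : ℝ)⁻¹ * ∑ j ∈ Finset.Icc 1 (n - 1), ‖φ (2 * Real.pi * j / n) (p 0) (p 1) -
      φ (2 * Real.pi * j / n) (k 0) (k 1)‖ ≤ η₂ := by
    rw [inv_mul_le_iff₀ hn']
    have : ∀ j ∈ Finset.Icc 1 (n - 1), ‖φ (2 * Real.pi * j / n) (p 0) (p 1) -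
        φ (2 * Real.pi * j / n) (k 0) (k 1)‖ ≤ η₂ := by
      intro j hj
      have h1 := hhol _ (fourier_freq_mem hj) _ (fourier_freq_mem hj) p hp k (htT hk)
      rw [sub_self, abs_zero, Real.zero_rpow hα.ne', zero_add] at h1
      exact h1.trans (hKr _ (norm_nonneg _) (by rwa [← dist_eq_norm]))
    refine (Finset.sum_le_sum this).trans ?_
    rw [Finset.sum_const, nsmul_eq_mul, Nat.card_Icc]
    have h5 : (((n - 1 + 1 - 1 : ℕ) : ℝ)) ≤ n := by exact_mod_cast (by omega)
    exact mul_le_mul_of_nonneg_right h5 hη₂0.le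
  have a2 := hsc k hk n
  calc _ ≤ ∫ ω, (‖(n : ℂ)⁻¹ * ∑ j ∈ Finset.Icc 1 (n - 1), X j ω *
          (φ (2 * Real.pi * j / n) (p 0) (p 1) - φ (2 * Real.pi * j / n) (k 0) (k 1))‖ +
        ‖(n : ℂ)⁻¹ * ∑ j ∈ Finset.Icc 1 (n - 1), X j ω *
          (φ (2 * Real.pi * j / n) (k 0) (k 1) - P j)‖ +
        ‖(n : ℂ)⁻¹ * ∑ j ∈ Finset.Icc 1 (n - 1), X j ω * P j‖) ∂μ := by
        refine integral_mono_of_nonneg (ae_of_all _ fun ω => norm_nonneg _)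
          ((i1.norm.add i2.norm).add i3.norm) (ae_of_all _ fun ω => ?_)
        have e : (n : ℂ)⁻¹ * ∑ j ∈ Finset.Icc 1 (n - 1), X j ω *
            φ (2 * Real.pi * j / n) (p 0) (p 1) =
            (n : ℂ)⁻¹ * ∑ j ∈ Finset.Icc 1 (n - 1), X j ω *
              (φ (2 * Real.pi * j / n) (p 0) (p 1) - φ (2 * Real.pi * j / n) (k 0) (k 1)) +
            (n : ℂ)⁻¹ * ∑ j ∈ Finset.Icc 1 (n - 1), X j ω *
              (φ (2 * Real.pi * j / n) (k 0) (k 1) - P j) +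
            (n : ℂ)⁻¹ * ∑ j ∈ Finset.Icc 1 (n - 1), X j ω * P j := by
          rw [← mul_add, ← mul_add, ← Finset.sum_add_distrib, ← Finset.sum_add_distrib]
          congr 1
          exact Finset.sum_congr rfl fun j _ => by ring
        exact (congrArg norm e).le.trans norm_add₃_le
    _ ≤ 2 * specBound μ Z * η₂ + 2 * specBound μ Z * η₂ + η₂ := by
        have i12 := i1.norm.add i2.norm
        simp only [Pi.add_def] at i12
        rw [integral_add i12 i3.norm, integral_add i1.norm i2.norm]
        refine add_le_add (add_le_add (b1.trans ?_) (b2.trans ?_)) b3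
        · exact mul_le_mul_of_nonneg_left a1 (by positivity)
        · exact mul_le_mul_of_nonneg_left a2 (by positivity)
    _ = η := by
        rw [hη₂]
        field_simp
        ring

end GenSpectrum

namespace GenSpectrum

/-! ### Averages over the grid -/

section

variable {E : Type*} [NormedAddCommGroup E] [NormedSpace ℝ E]

/-- The average over the grid, normalized as in `discreteDivergence`. -/
noncomputable def gridAverage (L : ℝ) (n M : ℕ) (g : ℝ → ℝ → ℝ → E) : E :=
  (8 * Real.pi * L ^ 2 / (n * (M : ℝ) ^ 2)) •
    ∑ j ∈ Finset.Icc 1 (n - 1), ∑ i₁ ∈ Finset.Icc 1 M, ∑ i₂ ∈ Finset.Icc 1 M,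
      g (2 * Real.pi * j / n) (gridPoint L M i₁) (gridPoint L M i₂)

theorem discreteDivergence_eq (L : ℝ) (n M : ℕ) (f g : ℝ → ℝ → ℝ → ℂ) :
    discreteDivergence L n M f g =
      gridAverage L n M fun lam u v => ‖f lam u v - g lam u v‖ ^ 2 := rfl

theorem gridAverage_add (L : ℝ) (n M : ℕ) (g h : ℝ → ℝ → ℝ → E) :
    gridAverage L n M (fun lam u v => g lam u v + h lam u v) =
      gridAverage L n M g + gridAverage L n M h := by
  simp only [gridAverage, Finset.sum_add_distrib, smul_add]

theorem gridAverage_sub (L : ℝ) (n M : ℕ) (g h : ℝ → ℝ → ℝ → E) :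
    gridAverage L n M (fun lam u v => g lam u v - h lam u v) =
      gridAverage L n M g - gridAverage L n M h := by
  simp only [gridAverage, Finset.sum_sub_distrib, smul_sub]

theorem gridAverage_mono {L : ℝ} {n M : ℕ} {g h : ℝ → ℝ → ℝ → ℝ}
    (hgh : ∀ j ∈ Finset.Icc 1 (n - 1), ∀ i₁ ∈ Finset.Icc 1 M, ∀ i₂ ∈ Finset.Icc 1 M,
      g (2 * Real.pi * j / n) (gridPoint L M i₁) (gridPoint L M i₂) ≤
        h (2 * Real.pi * j / n) (gridPoint L M i₁) (gridPoint L M i₂)) :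
    gridAverage L n M g ≤ gridAverage L n M h := by
  have := Real.pi_pos
  exact mul_le_mul_of_nonneg_left (Finset.sum_le_sum fun j hj => Finset.sum_le_sum fun i₁ hi₁ =>
    Finset.sum_le_sum fun i₂ hi₂ => hgh j hj i₁ hi₁ i₂ hi₂) (by positivity)

theorem gridAverage_const_mul (L : ℝ) (n M : ℕ) (c : ℝ) (g : ℝ → ℝ → ℝ → ℝ) :
    gridAverage L n M (fun lam u v => c * g lam u v) = c * gridAverage L n M g := by
  simp only [gridAverage, ← Finset.mul_sum, smul_eq_mul]
  ring

theorem norm_gridAverage_le (L : ℝ) (n M : ℕ) (g : ℝ → ℝ → ℝ → E) :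
    ‖gridAverage L n M g‖ ≤ gridAverage L n M fun lam u v => ‖g lam u v‖ := by
  have := Real.pi_pos
  rw [gridAverage, norm_smul, Real.norm_of_nonneg (by positivity)]
  exact mul_le_mul_of_nonneg_left (norm_sum_le_of_le _ fun j _ => norm_sum_le_of_le _ fun i₁ _ =>
    norm_sum_le_of_le _ fun i₂ _ => le_rfl) (by positivity)

theorem abs_gridAverage_le (L : ℝ) (n M : ℕ) (g : ℝ → ℝ → ℝ → ℝ) :
    |gridAverage L n M g| ≤ gridAverage L n M fun lam u v => |g lam u v| :=
  norm_gridAverage_le L n M g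

theorem re_gridAverage (L : ℝ) (n M : ℕ) (g : ℝ → ℝ → ℝ → ℂ) :
    (gridAverage L n M g).re = gridAverage L n M fun lam u v => (g lam u v).re := by
  simp only [gridAverage, Complex.smul_re, Complex.re_sum]

theorem integrable_gridAverage {Ω : Type*} [MeasurableSpace Ω] {μ : Measure Ω} (L : ℝ) (n M : ℕ)
    {g : ℝ → ℝ → ℝ → Ω → E} (hg : ∀ lam u v, Integrable (g lam u v) μ) :
    Integrable (fun ω => gridAverage L n M fun lam u v => g lam u v ω) μ :=
  (integrable_finsetSum _ fun _ _ => integrable_finsetSum _ fun _ _ =>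
    integrable_finsetSum _ fun _ _ => hg _ _ _).smul _

theorem integral_gridAverage {Ω : Type*} [MeasurableSpace Ω] {μ : Measure Ω} (L : ℝ) (n M : ℕ)
    {g : ℝ → ℝ → ℝ → Ω → ℝ} (hg : ∀ lam u v, Integrable (g lam u v) μ) :
    ∫ ω, gridAverage L n M (fun lam u v => g lam u v ω) ∂μ =
      gridAverage L n M fun lam u v => ∫ ω, g lam u v ω ∂μ := by
  simp only [gridAverage, smul_eq_mul]
  rw [integral_const_mul, integral_finsetSum _ fun _ _ => integrable_finsetSum _ fun _ _ =>
    integrable_finsetSum _ fun _ _ => hg _ _ _]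
  congr 1
  refine Finset.sum_congr rfl fun j _ => ?_
  rw [integral_finsetSum _ fun _ _ => integrable_finsetSum _ fun _ _ => hg _ _ _]
  refine Finset.sum_congr rfl fun i₁ _ => ?_
  rw [integral_finsetSum _ fun _ _ => hg _ _ _]

theorem gridAverage_eq_average (L : ℝ) (n M : ℕ) (g : ℝ → ℝ → ℝ → E) :
    gridAverage L n M g = (8 * Real.pi * L ^ 2 * ((M : ℝ) ^ 2)⁻¹) •
      ∑ i₁ ∈ Finset.Icc 1 M, ∑ i₂ ∈ Finset.Icc 1 M, (n : ℝ)⁻¹ • ∑ j ∈ Finset.Icc 1 (n - 1),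
        g (2 * Real.pi * j / n) (gridPoint L M i₁) (gridPoint L M i₂) := by
  simp only [← Finset.smul_sum]
  rw [smul_smul, gridAverage, Finset.sum_comm]
  congr 1
  · rw [div_eq_mul_inv, mul_inv]; ring
  · exact Finset.sum_congr rfl fun i₁ _ => Finset.sum_comm

/-- Grid averages of nonnegative functions of `(u, v)` alone. -/
theorem gridAverage_le_of_average_le {L : ℝ} {n M : ℕ} {ζ : EuclideanSpace ℝ (Fin 2) → ℝ}
    (hζ : ∀ p, 0 ≤ ζ p) {ξ : ℝ} (h : ((M : ℝ) ^ 2)⁻¹ * ∑ i₁ ∈ Finset.Icc 1 M,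
      ∑ i₂ ∈ Finset.Icc 1 M, ζ (gridPair L M i₁ i₂) ≤ ξ) :
    gridAverage L n M (fun _ u v => ζ (toPlane (u, v))) ≤ 8 * Real.pi * L ^ 2 * ξ := by
  have hpi := Real.pi_pos
  rw [gridAverage_eq_average, smul_eq_mul, mul_assoc]
  refine mul_le_mul_of_nonneg_left (le_trans ?_ h) (by positivity)
  refine mul_le_mul_of_nonneg_left (Finset.sum_le_sum fun i₁ _ => Finset.sum_le_sum fun i₂ _ => ?_)
    (by positivity)
  rw [Finset.sum_const, nsmul_eq_mul, Nat.card_Icc, smul_eq_mul, ← mul_assoc]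
  refine mul_le_of_le_one_left (hζ _) ?_
  rcases Nat.eq_zero_or_pos n with rfl | hn
  · simp
  rw [inv_mul_le_iff₀ (by exact_mod_cast hn), mul_one]
  exact_mod_cast (by omega)

end

/-! ### The discretized divergence of the periodogram -/

/-- The algebraic core, with `x` the periodogram, `f` the spectrum, `a` a member of the family and
`b` a nearby net member. The first bracket is free of `a` and `b`, the cross term is linear in `x -
f`, and the last bracket is small when `a` is near `b`. -/
theorem norm_sub_sq_eq_add (x a b f : ℂ) :
    ‖x - a‖ ^ 2 = (‖x‖ ^ 2 - ‖f‖ ^ 2) + ‖f - b‖ ^ 2 - 2 * ((x - f) * (starRingEnd ℂ) b).re +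
      (‖x - a‖ ^ 2 - ‖x - b‖ ^ 2) := by
  simp only [← Complex.normSq_eq_norm_sq, Complex.normSq_apply, Complex.sub_re, Complex.sub_im,
    Complex.mul_re, Complex.conj_re, Complex.conj_im]
  ring

/-- Factoring the difference of squares leaves a bound linear in `‖x‖`, so a first moment of the
periodogram suffices. -/
theorem abs_norm_sub_sq_sub_le {x a b : ℂ} {C z : ℝ} (ha : ‖a‖ ≤ C) (hb : ‖b‖ ≤ C)
    (hz : ‖a - b‖ ≤ z) : |‖x - a‖ ^ 2 - ‖x - b‖ ^ 2| ≤ z * (2 * ‖x‖ + 2 * C) := by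
  have h1 : |‖x - a‖ - ‖x - b‖| ≤ z := by
    refine (abs_norm_sub_norm_le _ _).trans ?_
    rw [sub_sub_sub_cancel_left, norm_sub_rev]
    exact hz
  have h2 : ‖x - a‖ + ‖x - b‖ ≤ 2 * ‖x‖ + 2 * C := by
    linarith [norm_sub_le x a, norm_sub_le x b]
  have h3 : ‖x - a‖ ^ 2 - ‖x - b‖ ^ 2 = (‖x - a‖ - ‖x - b‖) * (‖x - a‖ + ‖x - b‖) := by ring
  rw [h3, abs_mul, abs_of_nonneg (by positivity : 0 ≤ ‖x - a‖ + ‖x - b‖)]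
  exact mul_le_mul h1 h2 (by positivity) ((abs_nonneg _).trans h1)

/-- The right side depends on `a` only through the common bounds `C` and `ζ`. Control for the
finitely many `b` of a net is therefore control over the whole family. -/
theorem abs_discreteDivergence_sub_le {L : ℝ} (hL : 0 < L) {n M : ℕ} {x f a b : ℝ → ℝ → ℝ → ℂ}
    {C : ℝ} {ζ : EuclideanSpace ℝ (Fin 2) → ℝ}
    (ha : ∀ lam ∈ Icc 0 (2 * Real.pi), ∀ p ∈ square L, ‖a lam (p 0) (p 1)‖ ≤ C)
    (hb : ∀ lam ∈ Icc 0 (2 * Real.pi), ∀ p ∈ square L, ‖b lam (p 0) (p 1)‖ ≤ C)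
    (hζ : ∀ lam ∈ Icc 0 (2 * Real.pi), ∀ p ∈ square L,
      ‖a lam (p 0) (p 1) - b lam (p 0) (p 1)‖ ≤ ζ p) :
    |discreteDivergence L n M x a -
        gridAverage L n M (fun lam u v => ‖x lam u v‖ ^ 2 - ‖f lam u v‖ ^ 2) -
        discreteDivergence L n M f b| ≤
      2 * ‖gridAverage L n M fun lam u v => (x lam u v - f lam u v) * (starRingEnd ℂ) (b lam u v)‖ +
        gridAverage L n M fun lam u v => ζ (toPlane (u, v)) * (2 * ‖x lam u v‖ + 2 * C) := by
  have e1 : discreteDivergence L n M x a =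
      gridAverage L n M (fun lam u v => ‖x lam u v‖ ^ 2 - ‖f lam u v‖ ^ 2) +
      discreteDivergence L n M f b -
      2 * (gridAverage L n M fun lam u v =>
        (x lam u v - f lam u v) * (starRingEnd ℂ) (b lam u v)).re +
      gridAverage L n M fun lam u v =>
        ‖x lam u v - a lam u v‖ ^ 2 - ‖x lam u v - b lam u v‖ ^ 2 := by
    rw [re_gridAverage, discreteDivergence_eq, discreteDivergence_eq, ← gridAverage_const_mul,
      ← gridAverage_add, ← gridAverage_sub, ← gridAverage_add]
    congr 1
    funext lam u v
    exact norm_sub_sq_eq_add _ _ _ _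
  have e2 : |gridAverage L n M fun lam u v =>
        ‖x lam u v - a lam u v‖ ^ 2 - ‖x lam u v - b lam u v‖ ^ 2| ≤
      gridAverage L n M fun lam u v => ζ (toPlane (u, v)) * (2 * ‖x lam u v‖ + 2 * C) := by
    refine (abs_gridAverage_le _ _ _ _).trans (gridAverage_mono fun j hj i₁ hi₁ i₂ hi₂ => ?_)
    have hp := gridPair_mem hL hi₁ hi₂
    have hl := fourier_freq_mem hj
    exact abs_norm_sub_sq_sub_le (ha _ hl _ hp) (hb _ hl _ hp) (hζ _ hl _ hp)
  have e3 := Complex.abs_re_le_norm (gridAverage L n M fun lam u v =>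
        (x lam u v - f lam u v) * (starRingEnd ℂ) (b lam u v))
  rw [e1]
  rw [abs_le] at e2 e3 ⊢
  constructor <;> linarith [e2.1, e2.2, e3.1, e3.2]

theorem measure_ge_le_of_integral_le {Ω : Type*} [MeasurableSpace Ω] {μ : Measure Ω}
    [IsFiniteMeasure μ] {g : Ω → ℝ} (hg : ∀ ω, 0 ≤ g ω) (hi : Integrable g μ) {η y : ℝ}
    (hη : 0 < η) (h : ∫ ω, g ω ∂μ ≤ η * y) : μ {ω | η ≤ g ω} ≤ ENNReal.ofReal y := by
  have := (mul_meas_ge_le_integral_of_nonneg (ae_of_all _ hg) hi η).trans h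
  rw [← ofReal_measureReal]
  exact ENNReal.ofReal_le_ofReal (le_of_mul_le_mul_left this hη)

/-- Off the singular set, Hölder functions are continuous. -/
theorem HolderOff.continuousOn_off {L α β : ℝ} {φ : ℝ → ℝ → ℝ → ℂ}
    {S : Set (EuclideanSpace ℝ (Fin 2))} (hφ : HolderOff L φ S α β) (hα : 0 < α) (hβ : 0 < β)
    (hS : IsSingularSet L S) :
    ContinuousOn (fun p : ℝ × ℝ × ℝ => φ p.1 p.2.1 p.2.2)
      {p | p.1 ∈ Icc 0 (2 * Real.pi) ∧ toPlane p.2 ∈ square L \ S} := by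
  intro x hx
  obtain ⟨ε, hε, hxε⟩ := hS.exists_notMem_nbhd hx.2.2
  obtain ⟨K, hK, h⟩ := hφ ε hε
  rw [ContinuousWithinAt, tendsto_iff_dist_tendsto_zero]
  have hc : Continuous fun y : ℝ × ℝ × ℝ =>
      K * (|y.1 - x.1| ^ α + ‖toPlane y.2 - toPlane x.2‖ ^ β) := by
    refine continuous_const.mul (Continuous.add ?_ ?_)
    · exact (continuous_fst.sub continuous_const).abs.rpow_const fun _ => Or.inr hα.le
    · exact ((continuous_toPlane.comp continuous_snd).sub continuous_const).norm.rpow_const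
        fun _ => Or.inr hβ.le
  have hlim := (hc.tendsto x).mono_left (nhdsWithin_le_nhds
    (s := {p : ℝ × ℝ × ℝ | p.1 ∈ Icc 0 (2 * Real.pi) ∧ toPlane p.2 ∈ square L \ S}))
  simp only [sub_self, abs_zero, norm_zero, Real.zero_rpow hα.ne', Real.zero_rpow hβ.ne',
    add_zero, mul_zero] at hlim
  refine squeeze_zero' (Eventually.of_forall fun _ => dist_nonneg) ?_ hlim
  have hopen : ∀ᶠ y in 𝓝 x, toPlane y.2 ∉ nbhd L S ε :=
    (continuous_toPlane.comp continuous_snd).continuousAt.eventually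
      ((isClosed_nbhd L S ε).isOpen_compl.mem_nhds hxε)
  filter_upwards [self_mem_nhdsWithin, hopen.filter_mono nhdsWithin_le_nhds] with y hy hyε
  rw [dist_eq_norm]
  exact h y.1 hy.1 x.1 hx.1 (toPlane y.2) ⟨hy.2.1, hyε⟩ (toPlane x.2) ⟨hx.2.1, hxε⟩

/-! ### Equicontinuity of the parametric family and limits of grid averages -/

section

variable {d : ℕ} {L : ℝ} {Θ : Set (EuclideanSpace ℝ (Fin d))}
  {F : EuclideanSpace ℝ (Fin d) → ℝ → ℝ → ℝ → ℂ} {S : Set (EuclideanSpace ℝ (Fin 2))}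
  {τ α β γ : ℝ}

theorem UBPH.holderOff (hF : UBPH L Θ F S τ α β γ) (hγ : 0 < γ) {θ : EuclideanSpace ℝ (Fin d)}
    (hθ : θ ∈ Θ) : HolderOff L (F θ) S α β := by
  obtain ⟨C, hC, -, h⟩ := hF
  intro ε hε
  refine ⟨C * ε ^ (-τ), by positivity, fun lam hlam lam' hlam' p hp p' hp' => ?_⟩
  have := h ε hε lam hlam lam' hlam' p hp p' hp' θ hθ θ hθ
  rwa [sub_self θ, norm_zero, Real.zero_rpow hγ.ne', add_zero] at this

theorem HolderOff.conj {φ : ℝ → ℝ → ℝ → ℂ} (hφ : HolderOff L φ S α β) :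
    HolderOff L (fun lam u v => (starRingEnd ℂ) (φ lam u v)) S α β := by
  intro ε hε
  obtain ⟨K, hK, h⟩ := hφ ε hε
  refine ⟨K, hK, fun lam hlam lam' hlam' p hp p' hp' => ?_⟩
  rw [← map_sub, RCLike.norm_conj]
  exact h lam hlam lam' hlam' p hp p' hp'

open Classical in
/-- Equicontinuity in mean of the parametric family, with a majorant which depends only on
`(u, v)`. -/
theorem UBPH.exists_majorant (hF : UBPH L Θ F S τ α β γ) (hα : 0 < α) (hβ : 0 < β) (hγ : 0 < γ)
    (hS : IsSingularSet L S) (hL : 0 < L) {ξ : ℝ} (hξ : 0 < ξ) :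
    ∃ δ > 0, ∃ ζ : EuclideanSpace ℝ (Fin 2) → ℝ, (∀ p, 0 ≤ ζ p) ∧
      (∀ θ ∈ Θ, ∀ θ' ∈ Θ, dist θ θ' < δ → ∀ lam ∈ Icc 0 (2 * Real.pi), ∀ p ∈ square L,
        ‖F θ lam (p 0) (p 1) - F θ' lam (p 0) (p 1)‖ ≤ ζ p) ∧
      ∀ᶠ M : ℕ in atTop, ((M : ℝ) ^ 2)⁻¹ * ∑ i₁ ∈ Finset.Icc 1 M, ∑ i₂ ∈ Finset.Icc 1 M,
        ζ (gridPair L M i₁ i₂) ≤ ξ := by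
  obtain ⟨C, hC, hbd, hhol⟩ := hF
  -- Near `S` the difference is at most `2C` on a fraction `ξ / (4C)` of the grid; elsewhere the
  -- Hölder bound in `θ` applies for this fixed `ε`. Each part contributes `ξ / 2`.
  obtain ⟨ε, hε, hfrac⟩ := hS.exists_grid_fraction_le hL (η := ξ / (4 * C)) (by positivity)
  obtain ⟨δ, hδ, hKδ⟩ : ∃ δ : ℝ, 0 < δ ∧ ∀ x : ℝ, 0 ≤ x → x < δ → C * ε ^ (-τ) * x ^ γ ≤ ξ / 2 := by
    have hc : Tendsto (fun x : ℝ => C * ε ^ (-τ) * x ^ γ) (𝓝 0) (𝓝 0) := by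
      have : Continuous fun x : ℝ => C * ε ^ (-τ) * x ^ γ :=
        continuous_const.mul (continuous_id.rpow_const fun _ => Or.inr hγ.le)
      have := this.tendsto 0
      simpa [Real.zero_rpow hγ.ne'] using this
    obtain ⟨r, hr, h⟩ := Metric.eventually_nhds_iff.1 (hc.eventually (gt_mem_nhds (half_pos hξ)))
    refine ⟨r, hr, fun x hx hxr => (h ?_).le⟩
    simpa [Real.dist_eq, abs_of_nonneg hx] using hxr
  refine ⟨δ, hδ, fun p => ξ / 2 + 2 * C * (if p ∈ nbhd L S ε then 1 else 0), fun p => ?_, ?_, ?_⟩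
  · beta_reduce
    split_ifs <;> positivity
  · intro θ hθ θ' hθ' hd lam hlam p hp
    beta_reduce
    split_ifs with hpS
    · have h1 := norm_sub_le_of_le (hbd θ hθ lam hlam p hp) (hbd θ' hθ' lam hlam p hp)
      linarith
    · have h1 := hhol ε hε lam hlam lam hlam p ⟨hp, hpS⟩ p ⟨hp, hpS⟩ θ hθ θ' hθ'
      rw [sub_self, abs_zero, Real.zero_rpow hα.ne', sub_self, norm_zero, Real.zero_rpow hβ.ne',
        zero_add, zero_add] at h1
      have h2 := hKδ ‖θ - θ'‖ (norm_nonneg _) (by rwa [← dist_eq_norm])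
      linarith
  · filter_upwards [hfrac, eventually_ge_atTop 1] with M hM hM1
    have hM' : (0 : ℝ) < M := by exact_mod_cast hM1
    simp only [Finset.sum_add_distrib, ← Finset.mul_sum, Finset.sum_const, Nat.card_Icc,
      nsmul_eq_mul, Nat.add_sub_cancel, mul_add]
    have h1 : ((M : ℝ) ^ 2)⁻¹ * (M * (M * (ξ / 2))) = ξ / 2 := by field_simp
    have h2 := mul_le_mul_of_nonneg_left hM (by positivity : 0 ≤ 2 * C)
    have h3 : 2 * C * (ξ / (4 * C)) = ξ / 2 := by field_simp; norm_num
    rw [h1, mul_left_comm]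
    linarith

variable {Ω : Type*} [MeasurableSpace Ω] {μ : Measure Ω} {Z : ℤ → Ω → ℝ} {q : ℕ}

theorem tendsto_discreteDivergence [IsProbabilityMeasure μ] (hstat : StrictlyStationary μ Z)
    (hZ : ∀ t, Measurable (Z t)) (hsum : CumulantSummable μ Z q) (hF : UBPH L Θ F S τ α β γ)
    (hα : 0 < α) (hβ : 0 < β) (hγ : 0 < γ) (hS : IsSingularSet L S) (hL : 0 < L) {M : ℕ → ℕ}
    (hM : Tendsto M atTop atTop) {θ : EuclideanSpace ℝ (Fin d)} (hθ : θ ∈ Θ) :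
    Tendsto (fun n => discreteDivergence L n (M n) (spectrum2 μ Z) (F θ)) atTop
      (𝓝 (divergence L (spectrum2 μ Z) (F θ))) := by
  obtain ⟨C, hC, hbd, -⟩ := id hF
  refine tendsto_riemann_sum (g := fun lam u v => ‖spectrum2 μ Z lam u v - F θ lam u v‖ ^ 2)
    (C := (specBound μ Z + C) ^ 2) hS hL ?_ ?_ hM
  · intro lam hlam u hu v hv
    rw [Real.norm_of_nonneg (by positivity)]
    refine pow_le_pow_left₀ (norm_nonneg _) ?_ 2
    exact norm_sub_le_of_le (norm_spectrum2_le hstat hZ hsum lam u v)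
      (hbd θ hθ lam hlam (toPlane (u, v)) (toPlane_mem_square hu hv))
  · exact (((continuous_spectrum2 hstat hZ hsum).continuousOn.sub
      ((hF.holderOff hγ hθ).continuousOn_off hα hβ hS)).norm.pow 2)

/-- Equicontinuity in grid mean passes to the limit of the Riemann sums, so the majorant `ζ` never
has to be integrated. -/
theorem continuousOn_divergence [IsProbabilityMeasure μ] (hstat : StrictlyStationary μ Z)
    (hZ : ∀ t, Measurable (Z t)) (hsum : CumulantSummable μ Z q) (hF : UBPH L Θ F S τ α β γ)
    (hα : 0 < α) (hβ : 0 < β) (hγ : 0 < γ) (hS : IsSingularSet L S) (hL : 0 < L) :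
    ContinuousOn (fun θ => divergence L (spectrum2 μ Z) (F θ)) Θ := by
  have hpi := Real.pi_pos
  obtain ⟨C, hC, hbd, -⟩ := id hF
  have hB := specBound_nonneg (μ := μ) (Z := Z)
  rw [Metric.continuousOn_iff]
  intro θ' hθ' e he
  set A : ℝ := 8 * Real.pi * L ^ 2 * (2 * specBound μ Z + 2 * C) with hA
  have hA0 : 0 < A := by positivity
  obtain ⟨δ, hδ, ζ, hζ0, hζ, hav⟩ := hF.exists_majorant hα hβ hγ hS hL (ξ := e / (2 * A))
    (by positivity)
  refine ⟨δ, hδ, fun θ hθ hd => ?_⟩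
  -- Any grid size tending to infinity will do here; `M n = n` is taken.
  have h1 := tendsto_discreteDivergence hstat hZ hsum hF hα hβ hγ hS hL tendsto_id hθ
  have h2 := tendsto_discreteDivergence hstat hZ hsum hF hα hβ hγ hS hL tendsto_id hθ'
  have h3 : |divergence L (spectrum2 μ Z) (F θ) - divergence L (spectrum2 μ Z) (F θ')| ≤ e / 2 := by
    refine le_of_tendsto (h1.sub h2).abs ?_
    filter_upwards [hav] with n hn
    rw [discreteDivergence_eq, discreteDivergence_eq, ← gridAverage_sub]
    refine (abs_gridAverage_le _ _ _ _).trans ?_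
    calc _ ≤ gridAverage L n n fun _ u v => (2 * specBound μ Z + 2 * C) * ζ (toPlane (u, v)) := by
          refine gridAverage_mono fun j hj i₁ hi₁ i₂ hi₂ => ?_
          have hp := gridPair_mem hL hi₁ hi₂
          have hl := fourier_freq_mem hj
          refine (abs_norm_sub_sq_sub_le (hbd θ hθ _ hl _ hp) (hbd θ' hθ' _ hl _ hp)
            (hζ θ hθ θ' hθ' hd _ hl _ hp)).trans ?_
          rw [mul_comm]
          refine mul_le_mul_of_nonneg_right ?_ (hζ0 _)
          linarith [norm_spectrum2_le hstat hZ hsum (2 * Real.pi * j / n)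
            (gridPoint L (id n) i₁) (gridPoint L (id n) i₂)]
      _ = (2 * specBound μ Z + 2 * C) * gridAverage L n n fun _ u v => ζ (toPlane (u, v)) :=
          gridAverage_const_mul _ _ _ _ _
      _ ≤ (2 * specBound μ Z + 2 * C) * (8 * Real.pi * L ^ 2 * (e / (2 * A))) :=
          mul_le_mul_of_nonneg_left (gridAverage_le_of_average_le hζ0 hn) (by positivity)
      _ = e / 2 := by
          have : (2 * specBound μ Z + 2 * C) * (8 * Real.pi * L ^ 2 * (e / (2 * A))) =
              A * (e / (2 * A)) := by rw [hA]; ring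
          rw [this]
          field_simp
  rw [Real.dist_eq]
  linarith

open Classical in
/-- Grid averages of `(I_n - f) φ` converge to zero in mean. -/
theorem eventually_integral_norm_gridAverage_le [IsProbabilityMeasure μ]
    (hstat : StrictlyStationary μ Z) (hZ : ∀ t, Measurable (Z t)) (hsum : CumulantSummable μ Z q)
    (hS : IsSingularSet L S) (hL : 0 < L) {φ : ℝ → ℝ → ℝ → ℂ} (hφ : HolderOff L φ S α β)
    (hα : 0 < α) (hβ : 0 < β) {C : ℝ}
    (hC : ∀ lam ∈ Icc 0 (2 * Real.pi), ∀ p ∈ square L, ‖φ lam (p 0) (p 1)‖ ≤ C) {M : ℕ → ℕ}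
    (hM : Tendsto M atTop atTop) {η : ℝ} (hη : 0 < η) :
    ∀ᶠ n : ℕ in atTop, ∫ ω, ‖gridAverage L n (M n) fun lam u v =>
      (periodogram Z n lam u v ω - spectrum2 μ Z lam u v) * φ lam u v‖ ∂μ ≤ η := by
  have hpi := Real.pi_pos
  have hB := specBound_nonneg (μ := μ) (Z := Z)
  have hC0 : 0 ≤ C := (norm_nonneg _).trans (hC 0 ⟨le_rfl, by positivity⟩ (toPlane (0, 0))
    (toPlane_mem_square ⟨by simpa using hL.le, hL.le⟩ ⟨by simpa using hL.le, hL.le⟩))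
  -- With `B = specBound μ Z`, grid points off `S_ε` contribute `η / A` each, while the others form
  -- a fraction at most `η / A` and cost at most `2BC` each. The total is `A * (η / A)`.
  set A : ℝ := 8 * Real.pi * L ^ 2 * (1 + 2 * specBound μ Z * C) with hA
  have hA0 : 0 < A := by positivity
  have hη' : 0 < η / A := by positivity
  obtain ⟨ε, hε, hfrac⟩ := hS.exists_grid_fraction_le hL hη'
  filter_upwards [eventually_integral_norm_average_le hstat hZ hsum hφ hα hβ hε hη',
    hM.eventually hfrac, hM.eventually_ge_atTop 1, eventually_ge_atTop 1] with n hn hfr hM1 hn1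
  have hM' : (0 : ℝ) < M n := by exact_mod_cast hM1
  have hn' : (0 : ℝ) < n := by exact_mod_cast hn1
  have hpt : ∀ i₁ ∈ Finset.Icc 1 (M n), ∀ i₂ ∈ Finset.Icc 1 (M n),
      ∫ ω, ‖(n : ℂ)⁻¹ * ∑ j ∈ Finset.Icc 1 (n - 1),
        (periodogram Z n (2 * Real.pi * j / n) (gridPoint L (M n) i₁) (gridPoint L (M n) i₂) ω -
          spectrum2 μ Z (2 * Real.pi * j / n) (gridPoint L (M n) i₁) (gridPoint L (M n) i₂)) *
            φ (2 * Real.pi * j / n) (gridPoint L (M n) i₁) (gridPoint L (M n) i₂)‖ ∂μ ≤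
        η / A + 2 * specBound μ Z * C *
          (if gridPair L (M n) i₁ i₂ ∈ nbhd L S ε then 1 else 0) := by
    intro i₁ hi₁ i₂ hi₂
    have hp := gridPair_mem hL hi₁ hi₂
    split_ifs with hin
    · refine (integral_norm_average_le hstat hZ hsum n _ _ fun j =>
        φ (2 * Real.pi * j / n) (gridPoint L (M n) i₁) (gridPoint L (M n) i₂)).trans ?_
      have h1 : (n : ℝ)⁻¹ * ∑ j ∈ Finset.Icc 1 (n - 1),
          ‖φ (2 * Real.pi * j / n) (gridPoint L (M n) i₁) (gridPoint L (M n) i₂)‖ ≤ C := by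
        rw [inv_mul_le_iff₀ hn']
        refine (Finset.sum_le_sum fun j hj => hC _ (fourier_freq_mem hj) _ hp).trans ?_
        rw [Finset.sum_const, nsmul_eq_mul, Nat.card_Icc]
        have h5 : (((n - 1 + 1 - 1 : ℕ) : ℝ)) ≤ n := by exact_mod_cast (by omega)
        exact mul_le_mul_of_nonneg_right h5 hC0
      have h2 := mul_le_mul_of_nonneg_left h1 (by positivity : 0 ≤ 2 * specBound μ Z)
      linarith
    · have := hn _ ⟨hp, hin⟩
      rw [mul_zero, add_zero]
      exact this
  have hint := fun i₁ i₂ : ℕ => (integrable_average (μ := μ) hZ n (gridPoint L (M n) i₁)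
    (gridPoint L (M n) i₂) fun j =>
      φ (2 * Real.pi * j / n) (gridPoint L (M n) i₁) (gridPoint L (M n) i₂)).norm
  calc _ ≤ ∫ ω, 8 * Real.pi * L ^ 2 * (((M n : ℝ) ^ 2)⁻¹ * ∑ i₁ ∈ Finset.Icc 1 (M n),
        ∑ i₂ ∈ Finset.Icc 1 (M n), ‖(n : ℂ)⁻¹ * ∑ j ∈ Finset.Icc 1 (n - 1),
        (periodogram Z n (2 * Real.pi * j / n) (gridPoint L (M n) i₁) (gridPoint L (M n) i₂) ω -
          spectrum2 μ Z (2 * Real.pi * j / n) (gridPoint L (M n) i₁) (gridPoint L (M n) i₂)) *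
            φ (2 * Real.pi * j / n) (gridPoint L (M n) i₁) (gridPoint L (M n) i₂)‖) ∂μ := by
        refine integral_mono_of_nonneg (ae_of_all _ fun ω => norm_nonneg _)
          (((integrable_finsetSum _ fun i₁ _ => integrable_finsetSum _ fun i₂ _ =>
            hint i₁ i₂).const_mul _).const_mul _) (ae_of_all _ fun ω => ?_)
        simp only
        rw [gridAverage_eq_average, norm_smul, Real.norm_of_nonneg (by positivity), mul_assoc]
        refine mul_le_mul_of_nonneg_left (mul_le_mul_of_nonneg_left ?_ (by positivity))
          (by positivity)
        refine norm_sum_le_of_le _ fun i₁ _ => norm_sum_le_of_le _ fun i₂ _ => ?_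
        rw [Complex.real_smul]
        push_cast
        exact le_rfl
    _ = 8 * Real.pi * L ^ 2 * (((M n : ℝ) ^ 2)⁻¹ * ∑ i₁ ∈ Finset.Icc 1 (M n),
        ∑ i₂ ∈ Finset.Icc 1 (M n), ∫ ω, ‖(n : ℂ)⁻¹ * ∑ j ∈ Finset.Icc 1 (n - 1),
        (periodogram Z n (2 * Real.pi * j / n) (gridPoint L (M n) i₁) (gridPoint L (M n) i₂) ω -
          spectrum2 μ Z (2 * Real.pi * j / n) (gridPoint L (M n) i₁) (gridPoint L (M n) i₂)) *
            φ (2 * Real.pi * j / n) (gridPoint L (M n) i₁) (gridPoint L (M n) i₂)‖ ∂μ) := by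
        rw [integral_const_mul, integral_const_mul,
          integral_finsetSum _ fun i₁ _ => integrable_finsetSum _ fun i₂ _ => hint i₁ i₂]
        congr 2
        exact Finset.sum_congr rfl fun i₁ _ => integral_finsetSum _ fun i₂ _ => hint i₁ i₂
    _ ≤ 8 * Real.pi * L ^ 2 * (((M n : ℝ) ^ 2)⁻¹ * ∑ i₁ ∈ Finset.Icc 1 (M n),
        ∑ i₂ ∈ Finset.Icc 1 (M n), (η / A + 2 * specBound μ Z * C *
          (if gridPair L (M n) i₁ i₂ ∈ nbhd L S ε then 1 else 0))) := by
        refine mul_le_mul_of_nonneg_left (mul_le_mul_of_nonneg_left ?_ (by positivity))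
          (by positivity)
        exact Finset.sum_le_sum fun i₁ hi₁ => Finset.sum_le_sum fun i₂ hi₂ => hpt i₁ hi₁ i₂ hi₂
    _ ≤ 8 * Real.pi * L ^ 2 * (η / A + 2 * specBound μ Z * C * (η / A)) := by
        refine mul_le_mul_of_nonneg_left ?_ (by positivity)
        simp only [Finset.sum_add_distrib, ← Finset.mul_sum, Finset.sum_const, Nat.card_Icc,
          nsmul_eq_mul, Nat.add_sub_cancel, mul_add]
        have h1 : ((M n : ℝ) ^ 2)⁻¹ * (M n * (M n * (η / A))) = η / A := by field_simp
        rw [h1, mul_left_comm]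
        have h2 := mul_le_mul_of_nonneg_left hfr
          (by positivity : 0 ≤ 2 * specBound μ Z * C)
        linarith
    _ = η := by
        have : 8 * Real.pi * L ^ 2 * (η / A + 2 * specBound μ Z * C * (η / A)) = A * (η / A) := by
          rw [hA]; ring
        rw [this]
        field_simp

/-- The majorant is deterministic and free of `λ`, so the expectation acts only on `‖I_n‖`, whose
mean is bounded uniformly over the grid. -/
theorem integral_gridAverage_majorant_le [IsProbabilityMeasure μ]
    (hstat : StrictlyStationary μ Z) (hZ : ∀ t, Measurable (Z t)) (hsum : CumulantSummable μ Z q)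
    {C : ℝ} (hC : 0 ≤ C) {n M : ℕ} {ζ : EuclideanSpace ℝ (Fin 2) → ℝ}
    (hζ : ∀ p, 0 ≤ ζ p) {ξ : ℝ} (h : ((M : ℝ) ^ 2)⁻¹ * ∑ i₁ ∈ Finset.Icc 1 M,
      ∑ i₂ ∈ Finset.Icc 1 M, ζ (gridPair L M i₁ i₂) ≤ ξ) :
    ∫ ω, gridAverage L n M (fun lam u v => ζ (toPlane (u, v)) *
      (2 * ‖periodogram Z n lam u v ω‖ + 2 * C)) ∂μ ≤
      8 * Real.pi * L ^ 2 * (2 * specBound μ Z + 2 * C) * ξ := by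
  have hB := specBound_nonneg (μ := μ) (Z := Z)
  have hI := fun lam u v : ℝ => (integrable_of_norm_le (μ := μ) (measurable_periodogram hZ n lam u v)
    (norm_periodogram_le_natCast n lam u v)).norm
  have hI' := fun lam u v : ℝ => ((hI lam u v).const_mul 2).add (integrable_const (2 * C))
  rw [integral_gridAverage (g := fun lam u v ω => ζ (toPlane (u, v)) *
      (2 * ‖periodogram Z n lam u v ω‖ + 2 * C)) _ _ _ fun lam u v => (hI' lam u v).const_mul _]
  calc _ ≤ gridAverage L n M fun _ u v => (2 * specBound μ Z + 2 * C) * ζ (toPlane (u, v)) := by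
        refine gridAverage_mono fun j hj i₁ hi₁ i₂ hi₂ => ?_
        rw [integral_const_mul, integral_add ((hI _ _ _).const_mul 2) (integrable_const (2 * C)),
          integral_const_mul, mul_comm]
        refine mul_le_mul_of_nonneg_right ?_ (hζ _)
        have := integral_norm_periodogram_le hstat hZ hsum hj (gridPoint L M i₁) (gridPoint L M i₂)
        simp only [integral_const, probReal_univ, one_smul]
        linarith
    _ = (2 * specBound μ Z + 2 * C) * gridAverage L n M fun _ u v => ζ (toPlane (u, v)) :=
        gridAverage_const_mul _ _ _ _ _
    _ ≤ (2 * specBound μ Z + 2 * C) * (8 * Real.pi * L ^ 2 * ξ) :=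
        mul_le_mul_of_nonneg_left (gridAverage_le_of_average_le hζ h) (by positivity)
    _ = _ := by ring

end

end GenSpectrum

/-! ### Consistency of the minimum divergence estimator -/

theorem theorem1 {Ω : Type*} [MeasurableSpace Ω] (μ : Measure Ω) [IsProbabilityMeasure μ]
    -- the observed process
    (Z : ℤ → Ω → ℝ) (hZ : ∀ t, Measurable (Z t))
    (hstat : GenSpectrum.StrictlyStationary μ Z)
    (hsum : GenSpectrum.CumulantSummable μ Z 1)
    -- the parametric family
    (L : ℝ) (hL : 0 < L) (d : ℕ) (Θ : Set (EuclideanSpace ℝ (Fin d)))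
    (F : EuclideanSpace ℝ (Fin d) → ℝ → ℝ → ℝ → ℂ)
    (hΘ : IsCompact Θ) (hident : GenSpectrum.Identifiable L Θ F)
    (S : Set (EuclideanSpace ℝ (Fin 2))) (hS : GenSpectrum.IsSingularSet L S)
    (τ α β γ : ℝ) (hτ : 0 ≤ τ) (hα : α ∈ Ioc (0 : ℝ) 1) (hβ : β ∈ Ioc (0 : ℝ) 1)
    (hγ : γ ∈ Ioc (0 : ℝ) 1) (hF : GenSpectrum.UBPH L Θ F S τ α β γ)
    -- regularity of the spectrum of the process
    (τ' α' β' : ℝ) (hτ' : 0 ≤ τ') (hα' : 0 < α') (hβ' : 0 < β')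
    (hf : GenSpectrum.PH L (GenSpectrum.spectrum2 μ Z) S τ' α' β')
    (M : ℕ → ℕ) (hM : Tendsto M atTop atTop)
    -- the unique minimizer of the divergence
    (θ₀ : EuclideanSpace ℝ (Fin d)) (hθ₀ : θ₀ ∈ Θ)
    (hmin : ∀ θ ∈ Θ, θ ≠ θ₀ →
      GenSpectrum.divergence L (GenSpectrum.spectrum2 μ Z) (F θ₀) <
        GenSpectrum.divergence L (GenSpectrum.spectrum2 μ Z) (F θ))
    -- the estimator: any minimizer over `Θ` of the discretized divergence
    (θhat : ℕ → Ω → EuclideanSpace ℝ (Fin d))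
    (hhat : ∀ n, ∀ᵐ ω ∂μ, θhat n ω ∈ Θ ∧ ∀ θ ∈ Θ,
      GenSpectrum.discreteDivergence L n (M n)
          (fun lam u v => GenSpectrum.periodogram Z n lam u v ω) (F (θhat n ω)) ≤
        GenSpectrum.discreteDivergence L n (M n)
          (fun lam u v => GenSpectrum.periodogram Z n lam u v ω) (F θ)) :
    TendstoInMeasure μ θhat atTop (fun _ => θ₀) := by
  have hα0 := hα.1
  have hβ0 := hβ.1
  have hγ0 := hγ.1
  have hpi := Real.pi_pos
  have hB := GenSpectrum.specBound_nonneg (μ := μ) (Z := Z)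
  obtain ⟨C, hC, hbd, -⟩ := id hF
  set f := GenSpectrum.spectrum2 μ Z with hfdef
  set D : EuclideanSpace ℝ (Fin d) → ℝ := fun θ => GenSpectrum.divergence L f (F θ) with hD
  have hDcont : ContinuousOn D Θ :=
    GenSpectrum.continuousOn_divergence hstat hZ hsum hF hα0 hβ0 hγ0 hS hL
  rw [tendstoInMeasure_iff_dist]
  intro r hr
  -- separation of the minimum
  obtain ⟨g, hg, hsep⟩ : ∃ g > 0, ∀ θ ∈ Θ, r / 2 ≤ dist θ θ₀ → D θ₀ + g ≤ D θ := by
    set A := Θ ∩ {θ | r / 2 ≤ dist θ θ₀} with hA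
    have hAc : IsCompact A :=
      hΘ.inter_right (isClosed_le continuous_const (continuous_id.dist continuous_const))
    rcases A.eq_empty_or_nonempty with hne | hne
    · refine ⟨1, one_pos, fun θ hθ hd => ?_⟩
      exact absurd (show θ ∈ A from ⟨hθ, hd⟩) (hne ▸ notMem_empty θ)
    · obtain ⟨θ₁, hθ₁, hle⟩ := hAc.exists_isMinOn hne (hDcont.mono inter_subset_left)
      have hne₁ : θ₁ ≠ θ₀ := by
        rintro rfl
        have := hθ₁.2
        simp only [mem_ofPred_eq, dist_self] at this
        linarith
      refine ⟨D θ₁ - D θ₀, sub_pos.2 (hmin θ₁ hθ₁.1 hne₁), fun θ hθ hd => ?_⟩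
      have : D θ₁ ≤ D θ := hle ⟨hθ, hd⟩
      linarith
  -- The criterion will be off by less than `4η` at the estimator and at `θ₀`, in total `8η = g /
  -- 2`, less than the gap `g`.
  set η : ℝ := g / 16 with hη
  have hη0 : 0 < η := by positivity
  rw [ENNReal.tendsto_nhds_zero]
  intro x hx
  -- Truncation at `1` covers `x = ∞`.
  obtain ⟨y, hy, hyx⟩ : ∃ y : ℝ, 0 < y ∧ ENNReal.ofReal y ≤ x := by
    have hxm : min x 1 ≠ ∞ := ne_top_of_le_ne_top ENNReal.one_ne_top (min_le_right x 1)
    refine ⟨(min x 1).toReal, ENNReal.toReal_pos (lt_min hx one_pos).ne' hxm, ?_⟩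
    rw [ENNReal.ofReal_toReal hxm]
    exact min_le_left x 1
  -- a finite net of the parameter set
  set A : ℝ := 8 * Real.pi * L ^ 2 * (2 * GenSpectrum.specBound μ Z + 2 * C) with hA
  have hA0 : 0 < A := by positivity
  -- This `ξ` makes the mean of the majorant term at most `η (y / 2)`, so Markov's inequality leaves
  -- probability `y / 2`. The other `y / 2` is shared equally among the net points.
  obtain ⟨δ, hδ, ζ, hζ0, hζ, hav⟩ := hF.exists_majorant hα0 hβ0 hγ0 hS hL
    (ξ := η * (y / 2) / A) (by positivity)
  obtain ⟨t, htΘ, htfin, hcov⟩ := Metric.finite_approx_of_totallyBounded hΘ.totallyBounded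
    (min δ (r / 2)) (by positivity)
  -- `θ₀` is added so that the criterion at `θ₀` is compared with `D θ₀` itself.
  set s : Finset (EuclideanSpace ℝ (Fin d)) := insert θ₀ htfin.toFinset with hs
  have hsΘ : ∀ k ∈ s, k ∈ Θ := by
    intro k hk
    rcases Finset.mem_insert.1 hk with rfl | hk
    · exact hθ₀
    · exact htΘ (htfin.mem_toFinset.1 hk)
  have hscard : (0 : ℝ) < s.card := by
    exact_mod_cast Finset.card_pos.2 ⟨θ₀, Finset.mem_insert_self _ _⟩
  -- the good event
  have hW : ∀ᶠ n : ℕ in atTop, ∀ k ∈ s, ∫ ω, ‖GenSpectrum.gridAverage L n (M n) fun lam u v =>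
      (GenSpectrum.periodogram Z n lam u v ω - f lam u v) *
        (starRingEnd ℂ) (F k lam u v)‖ ∂μ ≤ η * (y / 2 / s.card) := by
    rw [Filter.eventually_all_finset]
    intro k hk
    refine GenSpectrum.eventually_integral_norm_gridAverage_le hstat hZ hsum hS hL
      (hF.holderOff hγ0 (hsΘ k hk)).conj hα0 hβ0 (C := C) ?_ hM (by positivity)
    intro lam hlam p hp
    rw [RCLike.norm_conj]
    exact hbd k (hsΘ k hk) lam hlam p hp
  have hR : ∀ᶠ n : ℕ in atTop, ∀ k ∈ s,
      |GenSpectrum.discreteDivergence L n (M n) f (F k) - D k| < η := by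
    rw [Filter.eventually_all_finset]
    intro k hk
    exact Metric.tendsto_nhds.1 (GenSpectrum.tendsto_discreteDivergence hstat hZ hsum hF hα0 hβ0
      hγ0 hS hL hM (hsΘ k hk)) η hη0
  filter_upwards [hW, hR, hM.eventually hav] with n hWn hRn havn
  set I : Ω → ℝ → ℝ → ℝ → ℂ := fun ω lam u v => GenSpectrum.periodogram Z n lam u v ω with hI
  set V : Ω → ℝ := fun ω => GenSpectrum.gridAverage L n (M n) fun lam u v =>
    ζ (GenSpectrum.toPlane (u, v)) * (2 * ‖I ω lam u v‖ + 2 * C) with hV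
  set W : EuclideanSpace ℝ (Fin d) → Ω → ℝ := fun k ω =>
    ‖GenSpectrum.gridAverage L n (M n) fun lam u v =>
      (I ω lam u v - f lam u v) * (starRingEnd ℂ) (F k lam u v)‖ with hWdef
  have hIint := fun lam u v : ℝ => GenSpectrum.integrable_of_norm_le (μ := μ)
    (GenSpectrum.measurable_periodogram hZ n lam u v)
    (GenSpectrum.norm_periodogram_le_natCast n lam u v)
  have hVint : Integrable V μ := GenSpectrum.integrable_gridAverage L n (M n)
    (g := fun lam u v ω => ζ (GenSpectrum.toPlane (u, v)) * (2 * ‖I ω lam u v‖ + 2 * C))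
    fun lam u v => (((hIint lam u v).norm.const_mul 2).add (integrable_const _)).const_mul _
  have hV0 : ∀ ω, 0 ≤ V ω := by
    intro ω
    refine smul_nonneg (by positivity) (Finset.sum_nonneg fun _ _ => Finset.sum_nonneg fun _ _ =>
      Finset.sum_nonneg fun _ _ => mul_nonneg (hζ0 _) (by positivity))
  have hWint : ∀ k, Integrable (W k) μ := fun k => (GenSpectrum.integrable_gridAverage L n (M n)
    (g := fun lam u v ω => (I ω lam u v - f lam u v) * (starRingEnd ℂ) (F k lam u v))
    fun lam u v => ((hIint lam u v).sub (integrable_const _)).mul_const _).norm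
  have hVm : μ {ω | η ≤ V ω} ≤ ENNReal.ofReal (y / 2) := by
    refine GenSpectrum.measure_ge_le_of_integral_le hV0 hVint hη0 ?_
    refine (GenSpectrum.integral_gridAverage_majorant_le hstat hZ hsum hC.le hζ0 havn).trans ?_
    rw [← hA]
    exact le_of_eq (by field_simp)
  have hWm : ∀ k ∈ s, μ {ω | η ≤ W k ω} ≤ ENNReal.ofReal (y / 2 / s.card) := fun k hk =>
    GenSpectrum.measure_ge_le_of_integral_le (fun ω => norm_nonneg _) (hWint k) hη0 (hWn k hk)
  set N : Set Ω := {ω | ¬ (θhat n ω ∈ Θ ∧ ∀ θ ∈ Θ,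
      GenSpectrum.discreteDivergence L n (M n) (I ω) (F (θhat n ω)) ≤
        GenSpectrum.discreteDivergence L n (M n) (I ω) (F θ))} with hN
  have hN0 : μ N = 0 := ae_iff.1 (hhat n)
  -- An inclusion suffices for the outer measure, so the estimator need not be measurable.
  have hsub : {ω | r ≤ dist (θhat n ω) θ₀} ⊆
      N ∪ ({ω | η ≤ V ω} ∪ ⋃ k ∈ s, {ω | η ≤ W k ω}) := by
    intro ω hω
    by_contra hbad
    simp only [mem_union, mem_iUnion, mem_ofPred_eq, not_or, not_exists, not_le, hN, not_not]
      at hbad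
    obtain ⟨⟨hθΘ, hθmin⟩, hVω, hWω⟩ := hbad
    -- This random offset need not be small, but it is the same for all parameters and cancels
    -- below.
    set c : ℝ := GenSpectrum.gridAverage L n (M n) fun lam u v =>
      ‖I ω lam u v‖ ^ 2 - ‖f lam u v‖ ^ 2 with hc
    -- The four errors `η`: twice the cross term `W k`, the majorant `V`, and the Riemann sum.
    have hclose : ∀ θ ∈ Θ, ∀ k ∈ s, dist θ k < δ →
        |GenSpectrum.discreteDivergence L n (M n) (I ω) (F θ) - c - D k| < 4 * η := by
      intro θ hθ k hk hd
      have h1 := GenSpectrum.abs_discreteDivergence_sub_le (n := n) (M := M n) (x := I ω) (f := f)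
        hL (hbd θ hθ) (hbd k (hsΘ k hk)) (hζ θ hθ k (hsΘ k hk) hd)
      have h2 := hRn k hk
      have h3 : W k ω < η := hWω k hk
      simp only [hWdef] at h3
      simp only [hV] at hVω
      rw [abs_lt] at h2 ⊢
      rw [abs_le] at h1
      constructor <;> linarith [h1.1, h1.2, h2.1, h2.2]
    obtain ⟨k, hk, hball⟩ := mem_iUnion₂.1 (hcov hθΘ)
    have hdk : dist (θhat n ω) k < min δ (r / 2) := hball
    have hks : k ∈ s := Finset.mem_insert_of_mem (htfin.mem_toFinset.2 hk)
    have h1 := hclose _ hθΘ k hks (hdk.trans_le (min_le_left _ _))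
    have h2 := hclose θ₀ hθ₀ θ₀ (Finset.mem_insert_self _ _) (by simpa using hδ)
    have h3 := hθmin θ₀ hθ₀
    have h4 : r / 2 ≤ dist k θ₀ := by
      have h5 := dist_triangle (θhat n ω) k θ₀
      have h6 := hdk.trans_le (min_le_right _ _)
      have h7 : r ≤ dist (θhat n ω) θ₀ := hω
      linarith
    have h5 := hsep k (htΘ hk) h4
    rw [abs_lt] at h1 h2
    -- `D k - 4η < D_n(θhat) - c ≤ D_n(θ₀) - c < D θ₀ + 4η`, whereas `D k ≥ D θ₀ + 16η`.
    linarith [h1.1, h1.2, h2.1, h2.2]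
  calc μ {ω | r ≤ dist (θhat n ω) θ₀}
      ≤ μ N + (μ {ω | η ≤ V ω} + ∑ k ∈ s, μ {ω | η ≤ W k ω}) :=
        (measure_mono hsub).trans ((measure_union_le _ _).trans (add_le_add_right
          ((measure_union_le _ _).trans (add_le_add_right (measure_biUnion_finset_le _ _) _)) _))
    _ ≤ 0 + (ENNReal.ofReal (y / 2) + ∑ k ∈ s, ENNReal.ofReal (y / 2 / s.card)) :=
        add_le_add hN0.le (add_le_add hVm (Finset.sum_le_sum hWm))
    _ = ENNReal.ofReal y := by
        rw [zero_add, Finset.sum_const, nsmul_eq_mul, ← ENNReal.ofReal_natCast,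
          ← ENNReal.ofReal_mul hscard.le, ← ENNReal.ofReal_add (by positivity) (by positivity)]
        congr 1
        field_simp
        norm_num
    _ ≤ x := hyx
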